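/- Let $d\ge 1$, $\mathbb T^d=\{x\in\mathbb R^d: x_1,\dots,x_d\ge 0,\ 1-|x|\ge 0\}$ with $|x|=\sum_j|x_j|$, and let $W^T$ be one of the weights $$W^T(x)=\Big(\prod_{i=1}^d x_i^{\kappa_i-1/2}\Big)(1-|x|)^{\kappa_{d+1}-1/2}\quad(\kappa_1,\dots,\kappa_{d+1}\ge 0;\ \text{type }\mathbb Z_2^d),$$ $$W^T(x)=\prod_{i=1}^d x_i^{\kappa'-1/2}\prod_{1\le i<j\le d}|x_i-x_j|^{\kappa}\,(1-|x|)^{\mu-1/2}\quad(\kappa',\kappa,\mu\ge 0;\ \text{type } H_d).$$ Put $\psi(u)=(u_1^2,\dots,u_d^2)$ and $\psi^{-1}(x)=(\sqrt{x_1},\dots,\sqrt{x_d})$. Let $\Delta^T$ be the second order differential-difference operator on $\mathbb T^d$ given by $(\Delta^T f)\circ\psi=\tfrac14\,\Delta^B(f\circ\psi)$, where $\Delta^B=\sum_{j=1}^d\mathcal D_j^2-\langle x,\nabla\rangle^2-2\lambda\langle x,\nabla\rangle$, $\lambda=\sum_v\kappa_v+\mu+\frac{d-1}2$, and $\mathcal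 D_jF(x)=\partial_jF(x)+\sum_v\kappa_v\langle v,e_j\rangle\frac{F(x)-F(\sigma_vx)}{\langle x,v\rangle}$ are the Dunkl operators; here $\sigma_v$ is the reflection in $v^\perp$. For the type $\mathbb Z_2^d$ the sums run over $v=\sqrt2e_i$ with $\kappa_v=\kappa_i$, and $\mu=\kappa_{d+1}$. For the type $H_d$ they run over $v=\sqrt2e_i$ with $\kappa_v=\kappa'$ and over $v=e_i\pm e_j$, $i<j$, with $\kappa_v=\kappa/2$ (the multiplicities that belong to $W^T$ under $x=\psi(u)$). A function $g\in L^2(\mathbb T^d;W^T)$ is $\sqrt{-\Delta^T}f$ if $\int gP\,W^T=\sqrt\nu\int fP\,W^T$ for every polynomial $P$ and real $\nu$ with $-\Delta^TP=\nu P$. **Theorem.** There is a constant $C>0$ that depends only on $d$ and on the parameters of the weight, such that for every real- or complex-valued $f\in C^1(\mathbb T^d)$ with $\int_{\mathbb T^d}f\,W^T\,dx=0$ and $\int_{\mathbb T^d}|f|^2W^T\,dx=1$, the function $\sqrt{-\Delta^T}f$ exists in $L^2(\mathbb T^d;W^T)$, the minimum below is attained, and $$\Big[\min_{y\in\mathbb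 T^d}\int_{\mathbb T^d}\big(1-\langle\psi^{-1}(x),\psi^{-1}(y)\rangle\big)|f(x)|^2W^T(x)\,dx\Big]\cdot\Big[\int_{\mathbb T^d}\big|\sqrt{-\Delta^T}f(x)\big|^2W^T(x)\,dx\Big]\ \ge\ C.$$ -/

import Mathlib

open MeasureTheory
open scoped NNReal

noncomputable section

/-- The simplex `T^d = {x ∈ ℝ^d : x_1 ≥ 0, …, x_d ≥ 0, 1 - |x| ≥ 0}`. -/
def simplexT (d : ℕ) : Set (Fin d → ℝ) :=
  {x | (∀ i, 0 ≤ x i) ∧ 0 ≤ 1 - ∑ i, |x i|}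

/-- The map `ψ(u) = (u_1², …, u_d²)`; it carries the unit ball onto the simplex. -/
def psi {d : ℕ} (u : Fin d → ℝ) : Fin d → ℝ := fun i => u i ^ 2

/-- The inverse `ψ⁻¹(x) = (√x_1, …, √x_d)` on the simplex. -/
def psiInv {d : ℕ} (x : Fin d → ℝ) : Fin d → ℝ := fun i => √(x i)

/-- Index set of the pairs `i < j`. -/
abbrev OrderedPair (d : ℕ) : Type := {p : Fin d × Fin d // p.1 < p.2}

/-- Parameters of the two families of weights on the simplex: the type `ℤ₂^d`, with parameters
`κ_1, …, κ_{d+1} ≥ 0`, and the hyperoctahedral type `H_d`, with parameters `κ', κ, μ ≥ 0`. -/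
inductive SimplexWeight (d : ℕ) : Type where
  | signChange (κ : Fin (d + 1) → ℝ≥0) : SimplexWeight d
  | hyperoctahedral (κ' κ μ : ℝ≥0) : SimplexWeight d

/-- The weight function `W^T`:
`∏ x_i^{κ_i - 1/2} (1 - |x|)^{κ_{d+1} - 1/2}` for the type `ℤ₂^d`, and
`∏ x_i^{κ' - 1/2} ∏_{i<j} |x_i - x_j|^κ (1 - |x|)^{μ - 1/2}` for the type `H_d`. -/
def SimplexWeight.weight {d : ℕ} : SimplexWeight d → (Fin d → ℝ) → ℝ
  | .signChange κ => fun x =>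
      (∏ i : Fin d, x i ^ ((κ i.castSucc : ℝ) - 1 / 2)) *
        (1 - ∑ i, |x i|) ^ ((κ (Fin.last d) : ℝ) - 1 / 2)
  | .hyperoctahedral κ' κ μ => fun x =>
      (∏ i : Fin d, x i ^ ((κ' : ℝ) - 1 / 2)) *
        (∏ p : OrderedPair d, |x p.1.1 - x p.1.2| ^ (κ : ℝ)) *
        (1 - ∑ i, |x i|) ^ ((μ : ℝ) - 1 / 2)

/-- The measure `W^T(x) dx` on the simplex. -/
def SimplexWeight.measure {d : ℕ} (w : SimplexWeight d) : Measure (Fin d → ℝ) :=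
  (volume.restrict (simplexT d)).withDensity fun x => ENNReal.ofReal (w.weight x)

/-- The partial derivative `∂_j F`. -/
def partialD {d : ℕ} (j : Fin d) (F : (Fin d → ℝ) → ℝ) (x : Fin d → ℝ) : ℝ :=
  lineDeriv ℝ F x (Pi.single j 1)

/-- The reflection `σ_v x = x - (2⟨x, v⟩ / ‖v‖²) v`. -/
def rootReflection {d : ℕ} (v x : Fin d → ℝ) : Fin d → ℝ :=
  x - (2 * (x ⬝ᵥ v) / (v ⬝ᵥ v)) • v

/-- The Dunkl operator
`D_j F(x) = ∂_j F(x) + ∑_v κ_v ⟨v, e_j⟩ (F(x) - F(σ_v x)) / ⟨x, v⟩`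
for the positive roots `root a` with multiplicities `mult a`, `a ∈ ι`. The formula is meaningful
off the hyperplanes `⟨x, v⟩ = 0`, hence at almost every point. -/
def dunklOp {d : ℕ} {ι : Type} [Fintype ι] (root : ι → Fin d → ℝ) (mult : ι → ℝ) (j : Fin d)
    (F : (Fin d → ℝ) → ℝ) (x : Fin d → ℝ) : ℝ :=
  partialD j F x +
    ∑ a, mult a * root a j * ((F x - F (rootReflection (root a) x)) / (x ⬝ᵥ root a))

/-- The `κ`-Laplacian `Δ_κ = ∑_j D_j²` on `ℝ^d`. -/
def dunklLaplacian {d : ℕ} {ι : Type} [Fintype ι] (root : ι → Fin d → ℝ) (mult : ι → ℝ)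
    (F : (Fin d → ℝ) → ℝ) (x : Fin d → ℝ) : ℝ :=
  ∑ j, dunklOp root mult j (dunklOp root mult j F) x

/-- The Euler operator `⟨x, ∇⟩`. -/
def eulerOp {d : ℕ} (F : (Fin d → ℝ) → ℝ) (x : Fin d → ℝ) : ℝ :=
  ∑ i, x i * partialD i F x

/-- The analogue of the Dunkl-Laplace-Beltrami operator on the unit ball, for the weight
`∏_v |⟨x, v⟩|^{2 κ_v} (1 - ‖x‖²)^{μ - 1/2}`:
`Δ^B = Δ_κ - ⟨x, ∇⟩² - 2 λ ⟨x, ∇⟩`, with `λ = ∑_v κ_v + μ + (d - 1) / 2`. -/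
def ballLaplacian {d : ℕ} {ι : Type} [Fintype ι] (root : ι → Fin d → ℝ) (mult : ι → ℝ) (μ : ℝ)
    (F : (Fin d → ℝ) → ℝ) (x : Fin d → ℝ) : ℝ :=
  dunklLaplacian root mult F x - eulerOp (eulerOp F) x
    - 2 * ((∑ a, mult a) + μ + ((d : ℝ) - 1) / 2) * eulerOp F x

/-- Positive roots `√2 e_i` of the group `ℤ₂^d`. -/
def signChangeRoot {d : ℕ} (i : Fin d) : Fin d → ℝ := √2 • Pi.single i 1

/-- Positive roots `√2 e_i`, `e_i - e_j`, `e_i + e_j` (`i < j`) of the hyperoctahedral group. -/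
def hyperoctahedralRoot {d : ℕ} : Fin d ⊕ (OrderedPair d ⊕ OrderedPair d) → Fin d → ℝ
  | .inl i => √2 • Pi.single i 1
  | .inr (.inl p) => Pi.single p.1.1 1 - Pi.single p.1.2 1
  | .inr (.inr p) => Pi.single p.1.1 1 + Pi.single p.1.2 1

/-- Multiplicities on the positive roots of the hyperoctahedral group: `κ'` on `√2 e_i` and
`κ / 2` on `e_i ± e_j`, so that `∏_v |⟨u, v⟩|^{2 κ_v}` is, up to a constant factor,
`∏_i |u_i|^{2κ'} ∏_{i<j} |u_i² - u_j²|^κ`; this and `x = ψ(u)` give the factor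
`∏_{i<j} |x_i - x_j|^κ` of the weight on the simplex. -/
def hyperoctahedralMult {d : ℕ} (κ' κ : ℝ) : Fin d ⊕ (OrderedPair d ⊕ OrderedPair d) → ℝ
  | .inl _ => κ'
  | .inr _ => κ / 2

/-- The operator `Δ^B` on the ball that belongs to the weight `W^T` under `x = ψ(u)`. -/
def SimplexWeight.ballOp {d : ℕ} :
    SimplexWeight d → ((Fin d → ℝ) → ℝ) → (Fin d → ℝ) → ℝ
  | .signChange κ =>
      ballLaplacian signChangeRoot (fun i : Fin d => (κ i.castSucc : ℝ)) (κ (Fin.last d))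
  | .hyperoctahedral κ' κ μ =>
      ballLaplacian hyperoctahedralRoot (hyperoctahedralMult κ' κ) μ

/-- The analogue `Δ^T` of the Dunkl-Laplace-Beltrami operator on the simplex:
`(Δ^T f) ∘ ψ = (1/4) Δ^B (f ∘ ψ)`. -/
def SimplexWeight.laplacian {d : ℕ} (w : SimplexWeight d)
    (f : (Fin d → ℝ) → ℝ) (x : Fin d → ℝ) : ℝ :=
  (1 / 4) * w.ballOp (f ∘ psi) (psiInv x)

/-- `g = √(-Δ^T) f`: the function `g` is in `L²(W^T)`, and for every polynomial eigenfunction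
`-Δ^T P = ν P` the component of `g` along `P` is `√ν` times that of `f`. (The polynomial
eigenfunctions are the orthogonal polynomials of degree `n = 0, 1, …` for `W^T`, so this says
`proj_n g = √ν_n proj_n f` for all `n`, and it determines `g` almost everywhere.) -/
def SimplexWeight.IsSqrtNegLaplacian {d : ℕ} {𝕜 : Type*} [RCLike 𝕜] (w : SimplexWeight d)
    (f g : (Fin d → ℝ) → 𝕜) : Prop :=
  MemLp g 2 w.measure ∧
    ∀ (P : MvPolynomial (Fin d) ℝ) (ν : ℝ),
      (∀ᵐ x ∂volume.restrict (simplexT d),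
        -w.laplacian (fun z => MvPolynomial.eval z P) x = ν * MvPolynomial.eval x P) →
      ∫ x, g x * ((MvPolynomial.eval x P : ℝ) : 𝕜) ∂w.measure =
        ((√ν : ℝ) : 𝕜) * ∫ x, f x * ((MvPolynomial.eval x P : ℝ) : 𝕜) ∂w.measure

/-- The spread `∫_{T^d} (1 - ⟨ψ⁻¹(x), ψ⁻¹(y)⟩) |f(x)|² W^T(x) dx` of `f` around `y`. -/
def SimplexWeight.spread {d : ℕ} {𝕜 : Type*} [RCLike 𝕜] (w : SimplexWeight d)
    (f : (Fin d → ℝ) → 𝕜) (y : Fin d → ℝ) : ℝ :=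
  ∫ x, (1 - psiInv x ⬝ᵥ psiInv y) * ‖f x‖ ^ 2 ∂w.measure

end

/-!
Write `t = 1 - |x|`, let `Γ` be the carré du champ of `Δ^T`, and let `a > 0` be the exponent of `t`
in `W^T`, raised by `1`. By the arithmetic-geometric mean inequality in each coordinate,
`1 - ⟨ψ⁻¹(x), ψ⁻¹(y)⟩ ≥ t / 2` for every `y`, so it suffices to bound `M = ∫ t |f|² W^T` from below
in terms of `G = ∫ |√(-Δ^T) f|² W^T`.

The function `|x|` is invariant under the coordinate permutations, so the difference terms drop out
of `Γ(F, |x|) = t ⟨x, ∇F⟩`, while `Δ^T |x| = (λ + 1) t - a`. Green's identity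
`∫ (Γ(F, P) + F Δ^T P) W^T = 0` for `F = f²`, `P = |x|`, together with `t ⟨x, ∇f⟩² ≤ Γ(f, f)`, gives
`a ∫ f² W^T ≤ (λ + 1 + s) M + G / s` for all `s > 0`. For `∫ f W^T = 0` and `∫ f² W^T = 1` the
spectral gap `G ≥ λ + 1` and the choice `s = 2 G / a` turn this into a lower bound of `M G`.

Green's identity follows from integration by parts along the edges of the simplex: a pair term
antisymmetric under its transposition integrates to zero against a symmetric weight. As `Δ^T` is
symmetric and acts on polynomials of degree `n` modulo lower degree as `-n (n + λ)`, polynomials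
split orthogonally into eigenspaces. The components of `√(-Δ^T) f` are square summable because for
`f ∈ C^1` the energies of the polynomial projections of `f` are at most `∫ Γ(f, f) W^T`.
-/

section PolynomialDegree

open MvPolynomial

variable {σ R : Type*}

/-- Polynomials of total degree less than `n`. -/
noncomputable def totalDegreeLT (σ R : Type*) [CommSemiring R] (n : ℕ) :
    Submodule R (MvPolynomial σ R) :=
  restrictSupport R {s | s.degree < n}

section Semiring

variable [CommSemiring R] {n : ℕ} {P : MvPolynomial σ R}

lemma mem_totalDegreeLT_iff_coeff :
    P ∈ totalDegreeLT σ R n ↔ ∀ s : σ →₀ ℕ, n ≤ s.degree → P.coeff s = 0 := by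
  simp only [totalDegreeLT, mem_restrictSupport_iff, Set.subset_def, Finset.mem_coe,
    Set.mem_ofPred_eq, mem_support_iff]
  exact forall_congr' fun s => by rw [not_imp_comm, not_lt]

lemma totalDegreeLT_zero : totalDegreeLT σ R 0 = ⊥ := by
  ext P
  simp only [mem_totalDegreeLT_iff_coeff, Nat.zero_le, forall_true_left, Submodule.mem_bot,
    MvPolynomial.ext_iff, coeff_zero]

lemma totalDegreeLT_mono : Monotone (totalDegreeLT σ R) := fun _ _ h =>
  restrictSupport_mono _ fun _ hs => lt_of_lt_of_le hs h

lemma mem_totalDegreeLT_of_totalDegree_lt (h : P.totalDegree < n) : P ∈ totalDegreeLT σ R n :=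
  fun _ hs => (le_totalDegree hs).trans_lt h

lemma totalDegree_lt_of_mem_totalDegreeLT (h : P ∈ totalDegreeLT σ R n) (hP : P ≠ 0) :
    P.totalDegree < n := by
  have hn : 0 < n := Nat.pos_of_ne_zero fun hn => hP (by simpa [hn, totalDegreeLT_zero] using h)
  rw [totalDegree, Finset.sup_lt_iff hn]
  exact fun s hs => h hs

lemma exists_mem_totalDegreeLT (P : MvPolynomial σ R) : ∃ n, P ∈ totalDegreeLT σ R n :=
  ⟨P.totalDegree + 1, mem_totalDegreeLT_of_totalDegree_lt (Nat.lt_succ_self _)⟩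

instance finite_totalDegreeLT [Finite σ] (n : ℕ) : Module.Finite R (totalDegreeLT σ R n) := by
  have hfin : Finite {s : σ →₀ ℕ | s.degree < n} := by
    have := Fintype.ofFinite σ
    classical
    refine (Set.Finite.subset (Finset.Iic (Finsupp.equivFunOnFinite.symm fun _ => n)).finite_toSet
      fun s hs => ?_).to_subtype
    rw [Finset.mem_coe, Finset.mem_Iic]
    exact fun i => (Finsupp.le_degree i s).trans (le_of_lt hs)
  exact Module.Finite.of_basis (basisRestrictSupport R {s : σ →₀ ℕ | s.degree < n})

lemma pderiv_mem_totalDegreeLT (hP : P ∈ totalDegreeLT σ R (n + 1)) (i : σ) :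
    pderiv i P ∈ totalDegreeLT σ R n := by
  rw [mem_totalDegreeLT_iff_coeff] at hP ⊢
  intro s hs
  rw [coeff_pderiv, hP _ (by simpa using hs), zero_mul]

lemma rename_mem_totalDegreeLT {τ : Type*} (hP : P ∈ totalDegreeLT σ R n) (e : σ → τ) :
    rename e P ∈ totalDegreeLT τ R n := by
  by_cases h : P = 0
  · simp [h]
  · exact mem_totalDegreeLT_of_totalDegree_lt
      ((totalDegree_rename_le _ _).trans_lt (totalDegree_lt_of_mem_totalDegreeLT hP h))

lemma coeff_X_mul_pderiv (i : σ) (P : MvPolynomial σ R) (s : σ →₀ ℕ) :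
    (X i * pderiv i P).coeff s = s i * P.coeff s := by
  classical
  induction P using MvPolynomial.induction_on' with
  | monomial t r =>
    rw [X_mul_pderiv_monomial, coeff_smul, nsmul_eq_mul, coeff_monomial]
    split_ifs with h <;> simp [h]
  | add P Q hP hQ => rw [map_add, mul_add, coeff_add, coeff_add, mul_add, hP, hQ]

lemma X_mul_pderiv_mem_totalDegreeLT (hP : P ∈ totalDegreeLT σ R n) (i : σ) :
    X i * pderiv i P ∈ totalDegreeLT σ R n := by
  rw [mem_totalDegreeLT_iff_coeff] at hP ⊢
  intro s hs
  rw [coeff_X_mul_pderiv, hP s hs, mul_zero]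

end Semiring

section Euler

variable [Fintype σ]

/-- The Euler operator `∑ X_i ∂_i` on polynomials, the algebraic counterpart of `eulerOp`. -/
noncomputable def eulerPoly (σ R : Type*) [Fintype σ] [CommSemiring R] :
    MvPolynomial σ R →ₗ[R] MvPolynomial σ R :=
  ∑ i, (LinearMap.mulLeft R (X i)).comp (pderiv i).toLinearMap

variable {n : ℕ}

section

variable [CommSemiring R] {P : MvPolynomial σ R}

lemma eulerPoly_apply (P : MvPolynomial σ R) : eulerPoly σ R P = ∑ i, X i * pderiv i P := by
  simp [eulerPoly]

lemma coeff_eulerPoly (P : MvPolynomial σ R) (s : σ →₀ ℕ) :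
    (eulerPoly σ R P).coeff s = s.degree * P.coeff s := by
  simp_rw [eulerPoly_apply, coeff_sum, coeff_X_mul_pderiv, ← Finset.sum_mul,
    Finsupp.degree_eq_sum, Nat.cast_sum]

lemma eulerPoly_mem_totalDegreeLT (hP : P ∈ totalDegreeLT σ R n) :
    eulerPoly σ R P ∈ totalDegreeLT σ R n := by
  rw [eulerPoly_apply]
  exact sum_mem fun i _ => X_mul_pderiv_mem_totalDegreeLT hP i

end

lemma eulerPoly_sub_smul_mem_totalDegreeLT [CommRing R] {P : MvPolynomial σ R}
    (hP : P ∈ totalDegreeLT σ R (n + 1)) :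
    eulerPoly σ R P - (n : R) • P ∈ totalDegreeLT σ R n := by
  rw [mem_totalDegreeLT_iff_coeff] at hP ⊢
  intro s hs
  rw [coeff_sub, coeff_smul, coeff_eulerPoly, smul_eq_mul]
  rcases hs.eq_or_lt with h | h
  · rw [h, sub_self]
  · rw [hP s h, mul_zero, mul_zero, sub_zero]

end Euler

end PolynomialDegree

section DividedDifference

open MvPolynomial

variable {σ R : Type*} [CommRing R] {n : ℕ}

lemma X_sub_X_ne_zero [Nontrivial R] {i j : σ} (hij : i ≠ j) :
    (X i - X j : MvPolynomial σ R) ≠ 0 :=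
  sub_ne_zero.2 fun h => hij (X_injective h)

/-- The derivation `X_i ∂_i - X_j ∂_j`. -/
noncomputable def eulerDiff (R : Type*) [CommRing R] (i j : σ) :
    Derivation R (MvPolynomial σ R) (MvPolynomial σ R) :=
  (X i : MvPolynomial σ R) • pderiv i - (X j : MvPolynomial σ R) • pderiv j

lemma eulerDiff_apply (i j : σ) (P : MvPolynomial σ R) :
    eulerDiff R i j P = X i * pderiv i P - X j * pderiv j P := rfl

variable [DecidableEq σ]

lemma X_sub_X_dvd_sub_rename_swap (i j : σ) (P : MvPolynomial σ R) :
    X i - X j ∣ P - rename (Equiv.swap i j) P := by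
  induction P using MvPolynomial.induction_on with
  | C c => simp
  | add P Q hP hQ => rw [map_add, add_sub_add_comm]; exact dvd_add hP hQ
  | mul_X P k hP =>
    rw [map_mul, rename_X]
    have hX : X i - X j ∣ (X k - X (Equiv.swap i j k) : MvPolynomial σ R) := by
      rcases eq_or_ne k i with rfl | hi
      · rw [Equiv.swap_apply_left]
      rcases eq_or_ne k j with rfl | hj
      · rw [Equiv.swap_apply_right, ← neg_sub, neg_dvd]
      · rw [Equiv.swap_apply_of_ne_of_ne hi hj, sub_self]
        exact dvd_zero _
    have hsplit : P * X k - rename (Equiv.swap i j) P * X (Equiv.swap i j k) =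
        (P - rename (Equiv.swap i j) P) * X k +
          rename (Equiv.swap i j) P * (X k - X (Equiv.swap i j k)) := by ring
    rw [hsplit]
    exact dvd_add (hP.mul_right _) (hX.mul_left _)

lemma rename_swap_pderiv (i j k : σ) (P : MvPolynomial σ R) :
    rename (Equiv.swap i j) (pderiv k P) =
      pderiv (Equiv.swap i j k) (rename (Equiv.swap i j) P) :=
  (pderiv_rename (Equiv.swap i j).injective k P).symm

lemma rename_swap_eulerDiff (i j : σ) (P : MvPolynomial σ R) :
    rename (Equiv.swap i j) (eulerDiff R i j P) =
      -eulerDiff R i j (rename (Equiv.swap i j) P) := by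
  simp only [eulerDiff_apply, map_sub, map_mul, rename_X, rename_swap_pderiv,
    Equiv.swap_apply_left, Equiv.swap_apply_right, neg_sub]

variable [IsDomain R]

/-- The divided difference `P ↦ (P - σ_ij P) / (X_i - X_j)`, where `σ_ij` swaps the variables
`X_i` and `X_j`; it is the difference part of the Dunkl operators on polynomials. By convention it
vanishes for `i = j`. -/
noncomputable def divDiff (i j : σ) : MvPolynomial σ R →ₗ[R] MvPolynomial σ R where
  toFun P := if i = j then 0 else (X_sub_X_dvd_sub_rename_swap i j P).choose
  map_add' P Q := by
    split_ifs with h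
    · rw [add_zero]
    apply mul_left_cancel₀ (X_sub_X_ne_zero h)
    rw [mul_add, ← (X_sub_X_dvd_sub_rename_swap i j (P + Q)).choose_spec,
      ← (X_sub_X_dvd_sub_rename_swap i j P).choose_spec,
      ← (X_sub_X_dvd_sub_rename_swap i j Q).choose_spec, map_add, add_sub_add_comm]
  map_smul' c P := by
    split_ifs with h
    · rw [smul_zero]
    apply mul_left_cancel₀ (X_sub_X_ne_zero h)
    rw [RingHom.id_apply, mul_smul_comm,
      ← (X_sub_X_dvd_sub_rename_swap i j (c • P)).choose_spec,
      ← (X_sub_X_dvd_sub_rename_swap i j P).choose_spec, map_smul, smul_sub]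

lemma X_sub_X_mul_divDiff (i j : σ) (P : MvPolynomial σ R) :
    (X i - X j) * divDiff i j P = P - rename (Equiv.swap i j) P := by
  by_cases h : i = j
  · simp [h]
  · simpa [divDiff, h] using (X_sub_X_dvd_sub_rename_swap i j P).choose_spec.symm

lemma divDiff_self (i : σ) (P : MvPolynomial σ R) : divDiff i i P = 0 := by
  simp [divDiff]

lemma divDiff_eq_of_X_sub_X_mul_eq {i j : σ} (hij : i ≠ j) {P Q : MvPolynomial σ R}
    (h : (X i - X j) * Q = P - rename (Equiv.swap i j) P) : divDiff i j P = Q :=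
  mul_left_cancel₀ (X_sub_X_ne_zero hij) ((X_sub_X_mul_divDiff i j P).trans h.symm)

lemma divDiff_comm (i j : σ) (P : MvPolynomial σ R) : divDiff j i P = -divDiff i j P := by
  rcases eq_or_ne j i with rfl | hij
  · rw [divDiff_self, neg_zero]
  refine divDiff_eq_of_X_sub_X_mul_eq hij ?_
  rw [Equiv.swap_comm, ← X_sub_X_mul_divDiff i j]
  ring

lemma divDiff_mem_totalDegreeLT {P : MvPolynomial σ R} (hP : P ∈ totalDegreeLT σ R (n + 1))
    (i j : σ) : divDiff i j P ∈ totalDegreeLT σ R n := by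
  by_cases h : divDiff i j P = 0
  · rw [h]
    exact zero_mem _
  have hij : i ≠ j := fun hij => h (by rw [hij, divDiff_self])
  have hmul : (X i - X j) * divDiff i j P ∈ totalDegreeLT σ R (n + 1) := by
    rw [X_sub_X_mul_divDiff]
    exact sub_mem hP (rename_mem_totalDegreeLT hP _)
  have hlt := totalDegree_lt_of_mem_totalDegreeLT hmul (mul_ne_zero (X_sub_X_ne_zero hij) h)
  rw [totalDegree_mul_of_isDomain (X_sub_X_ne_zero hij) h] at hlt
  have hpos : (X i - X j : MvPolynomial σ R).totalDegree ≠ 0 := fun h0 => by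
    rw [totalDegree_eq_zero_iff] at h0
    have := h0 (Finsupp.single i 1) (by
      simp [mem_support_iff, coeff_X, Finsupp.single_left_inj, hij.symm]) i
    simp at this
  exact mem_totalDegreeLT_of_totalDegree_lt (by omega)

/-- Twice the contribution of a pair of variables to the Dunkl Laplacian on the simplex: the
anticommutator of `X_i ∂_i - X_j ∂_j` with the divided difference. -/
noncomputable def pairOp (i j : σ) : MvPolynomial σ R →ₗ[R] MvPolynomial σ R :=
  (eulerDiff R i j).toLinearMap ∘ₗ divDiff i j + divDiff i j ∘ₗ (eulerDiff R i j).toLinearMap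

lemma pairOp_apply (i j : σ) (P : MvPolynomial σ R) :
    pairOp i j P = eulerDiff R i j (divDiff i j P) + divDiff i j (eulerDiff R i j P) := rfl

lemma pairOp_mem_totalDegreeLT {P : MvPolynomial σ R} (hP : P ∈ totalDegreeLT σ R (n + 1))
    (i j : σ) : pairOp i j P ∈ totalDegreeLT σ R n := by
  have eulerDiff_mem {m : ℕ} {Q : MvPolynomial σ R} (hQ : Q ∈ totalDegreeLT σ R m) :
      eulerDiff R i j Q ∈ totalDegreeLT σ R m :=
    sub_mem (X_mul_pderiv_mem_totalDegreeLT hQ i) (X_mul_pderiv_mem_totalDegreeLT hQ j)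
  exact add_mem (eulerDiff_mem (divDiff_mem_totalDegreeLT hP i j))
    (divDiff_mem_totalDegreeLT (eulerDiff_mem hP) i j)

lemma sq_mul_pairOp (i j : σ) (P : MvPolynomial σ R) :
    (X i - X j) ^ 2 * pairOp i j P = 2 * (X i - X j) * eulerDiff R i j P -
      (X i + X j) * (P - rename (Equiv.swap i j) P) := by
  rcases eq_or_ne i j with rfl | hij
  · simp
  have hXi : eulerDiff R i j (X i - X j) = X i + X j := by
    simp [eulerDiff_apply, pderiv_X_of_ne hij, pderiv_X_of_ne hij.symm]
  have hleib := congrArg (eulerDiff R i j) (X_sub_X_mul_divDiff i j P)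
  rw [Derivation.leibniz, hXi, map_sub, smul_eq_mul, smul_eq_mul] at hleib
  have hA := X_sub_X_mul_divDiff i j (eulerDiff R i j P)
  rw [rename_swap_eulerDiff] at hA
  rw [pairOp_apply]
  linear_combination (X i - X j) * hleib + (X i - X j) * hA -
    (X i + X j) * X_sub_X_mul_divDiff i j P

end DividedDifference

section PairSums

lemma sum_orderedPair_add_swap {d : ℕ} {M : Type*} [AddCommMonoid M] (f : Fin d → Fin d → M)
    (hf : ∀ i, f i i = 0) :
    ∑ p : OrderedPair d, (f p.1.1 p.1.2 + f p.1.2 p.1.1) = ∑ i, ∑ j, f i j := by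
  have sum_lt (g : Fin d → Fin d → M) :
      ∑ p : OrderedPair d, g p.1.1 p.1.2 = ∑ i, ∑ j, if i < j then g i j else 0 := by
    rw [← Fintype.sum_prod_type' fun i j => if i < j then g i j else 0, ← Finset.sum_filter]
    exact (Finset.sum_subtype (Finset.univ.filter fun q : Fin d × Fin d => q.1 < q.2)
      (fun q => by simp) fun q => g q.1 q.2).symm
  rw [Finset.sum_add_distrib, sum_lt, sum_lt fun i j => f j i,
    Finset.sum_comm (f := fun i j => if i < j then f j i else 0), ← Finset.sum_add_distrib]
  refine Finset.sum_congr rfl fun i _ => ?_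
  rw [← Finset.sum_add_distrib]
  refine Finset.sum_congr rfl fun j _ => ?_
  rcases lt_trichotomy i j with h | rfl | h
  · simp [h, h.not_gt]
  · simp [hf]
  · simp [h, h.not_gt]

lemma sum_orderedPair_incident {d : ℕ} {M : Type*} [AddCommMonoid M] (j : Fin d) (φ : Fin d → M)
    (hφ : φ j = 0) :
    ∑ p : OrderedPair d, ((if p.1.1 = j then φ p.1.2 else 0) + (if p.1.2 = j then φ p.1.1 else 0))
      = ∑ l, φ l := by
  rw [sum_orderedPair_add_swap (fun i k => if i = j then φ k else 0)]
  · rw [Finset.sum_comm]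
    simp only [Finset.sum_ite_eq', Finset.mem_univ, if_true]
  · intro i
    split_ifs with h
    · rw [h, hφ]
    · rfl

variable {ι M : Type*} [Fintype ι] [AddCommGroup M] [IsAddTorsionFree M]

lemma sum_sum_eq_zero_of_antisymm (f : ι → ι → M) (hf : ∀ i j, f i j = -f j i) :
    ∑ i, ∑ j, f i j = 0 := by
  rw [← self_eq_neg, ← Finset.sum_neg_distrib, Finset.sum_comm]
  simp only [← Finset.sum_neg_distrib, ← hf]

lemma sum_sum_sum_eq_zero_of_symmetrized (f : ι → ι → ι → M)
    (hf : ∀ i j k, f i j k + f i k j + f j i k + f j k i + f k i j + f k j i = 0) :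
    ∑ i, ∑ j, ∑ k, f i j k = 0 := by
  have swap_right (g : ι → ι → ι → M) : ∑ i, ∑ j, ∑ k, g i k j = ∑ i, ∑ j, ∑ k, g i j k :=
    Finset.sum_congr rfl fun i _ => Finset.sum_comm
  have swap_left (g : ι → ι → ι → M) : ∑ i, ∑ j, ∑ k, g j i k = ∑ i, ∑ j, ∑ k, g i j k :=
    Finset.sum_comm
  have hsum : ∑ i, ∑ j, ∑ k,
      (f i j k + f i k j + f j i k + f j k i + f k i j + f k j i) = 0 :=
    Finset.sum_eq_zero fun i _ => Finset.sum_eq_zero fun j _ => Finset.sum_eq_zero fun k _ =>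
      hf i j k
  simp only [Finset.sum_add_distrib] at hsum
  have rotate : ∑ i, ∑ j, ∑ k, f j k i = ∑ i, ∑ j, ∑ k, f i j k :=
    (swap_left fun i j k => f i k j).trans (swap_right f)
  rw [swap_right f, swap_left f, rotate, (swap_right fun i j k => f j i k).trans (swap_left f),
    (swap_right fun i j k => f j k i).trans rotate] at hsum
  refine (nsmul_eq_zero_iff_right (show (6 : ℕ) ≠ 0 by decide)).1 ?_
  rw [← hsum]
  abel

end PairSums

section DunklPolynomial

open MvPolynomial

variable {σ R : Type*} [DecidableEq σ] [CommRing R]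

lemma rename_swap_rename_swap (i j : σ) (P : MvPolynomial σ R) :
    rename (Equiv.swap i j) (rename (Equiv.swap i j) P) = P := by
  rw [rename_rename, ← Equiv.coe_trans, Equiv.swap_swap, Equiv.coe_refl, rename_id_apply]

lemma rename_swap_rename_swap_rotate {i j k : σ} (hij : i ≠ j) (hik : i ≠ k) (hjk : j ≠ k)
    (P : MvPolynomial σ R) :
    rename (Equiv.swap i j) (rename (Equiv.swap i k) P) =
      rename (Equiv.swap j k) (rename (Equiv.swap j i) P) := by
  rw [rename_rename, rename_rename]
  congr 2
  funext n
  simp only [Function.comp_apply, Equiv.swap_apply_def]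
  grind

variable [IsDomain R]

lemma divDiff_X_mul {i j : σ} (hij : i ≠ j) (P : MvPolynomial σ R) :
    divDiff i j (X i * P) = P + X j * divDiff i j P := by
  refine divDiff_eq_of_X_sub_X_mul_eq hij ?_
  rw [map_mul, rename_X, Equiv.swap_apply_left]
  linear_combination X j * X_sub_X_mul_divDiff i j P

lemma divDiff_divDiff_self (i j : σ) (P : MvPolynomial σ R) :
    divDiff i j (divDiff i j P) = 0 := by
  rcases eq_or_ne i j with rfl | hij
  · exact divDiff_self _ _
  refine divDiff_eq_of_X_sub_X_mul_eq hij ?_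
  have hP := congrArg (rename (Equiv.swap i j)) (X_sub_X_mul_divDiff i j P)
  rw [map_mul, map_sub, map_sub, rename_X, rename_X, Equiv.swap_apply_left,
    Equiv.swap_apply_right, rename_swap_rename_swap] at hP
  apply mul_left_cancel₀ (X_sub_X_ne_zero hij)
  linear_combination -X_sub_X_mul_divDiff i j P - hP

lemma mul_divDiff_divDiff {i j k : σ} (hik : i ≠ k) (hjk : j ≠ k) (P : MvPolynomial σ R) :
    (X i - X j) * (X i - X k) * (X j - X k) * divDiff i j (divDiff i k P) =
      (X j - X k) * (P - rename (Equiv.swap i k) P) - (X i - X k) *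
        (rename (Equiv.swap i j) P - rename (Equiv.swap i j) (rename (Equiv.swap i k) P)) := by
  have hQ := X_sub_X_mul_divDiff i j (divDiff i k P)
  have hP := X_sub_X_mul_divDiff i k P
  have hs := congrArg (rename (Equiv.swap i j)) hP
  rw [map_mul, map_sub, map_sub, rename_X, rename_X, Equiv.swap_apply_left,
    Equiv.swap_apply_of_ne_of_ne hik.symm hjk.symm] at hs
  linear_combination (X i - X k) * (X j - X k) * hQ + (X j - X k) * hP - (X i - X k) * hs

lemma divDiff_divDiff_symmetrized {i j k : σ} (hij : i ≠ j) (hik : i ≠ k) (hjk : j ≠ k)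
    (P : MvPolynomial σ R) :
    X j * divDiff i j (divDiff i k P) + X k * divDiff i k (divDiff i j P) +
      X i * divDiff j i (divDiff j k P) + X k * divDiff j k (divDiff j i P) +
      X i * divDiff k i (divDiff k j P) + X j * divDiff k j (divDiff k i P) = 0 := by
  have h₁ := mul_divDiff_divDiff hik hjk P
  have h₂ := mul_divDiff_divDiff hij hjk.symm P
  have h₃ := mul_divDiff_divDiff hjk hik P
  have h₄ := mul_divDiff_divDiff hij.symm hik.symm P
  have h₅ := mul_divDiff_divDiff hjk.symm hij P
  have h₆ := mul_divDiff_divDiff hik.symm hij.symm P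
  rw [rename_swap_rename_swap_rotate hij hik hjk,
    rename_swap_rename_swap_rotate hjk hij.symm hik.symm] at h₁
  rw [rename_swap_rename_swap_rotate hjk hij.symm hik.symm] at h₄
  rw [rename_swap_rename_swap_rotate hik hij hjk.symm,
    rename_swap_rename_swap_rotate hjk.symm hik.symm hij.symm] at h₂
  rw [rename_swap_rename_swap_rotate hjk.symm hik.symm hij.symm] at h₆
  simp only [Equiv.swap_comm j i, Equiv.swap_comm k i, Equiv.swap_comm k j] at h₁ h₂ h₃ h₄ h₅ h₆
  apply mul_left_cancel₀ (mul_ne_zero (mul_ne_zero (X_sub_X_ne_zero (R := R) hij)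
    (X_sub_X_ne_zero hik)) (X_sub_X_ne_zero hjk))
  linear_combination X j * h₁ - X k * h₂ - X i * h₃ + X k * h₄ + X i * h₅ - X j * h₆

variable [Fintype σ]

/-- The polynomial part of the Dunkl operator of the hyperoctahedral group in the coordinates
`x = ψ(u)`: it satisfies `D_j (P ∘ ψ) = u_j * (dunklQuot κ j P ∘ ψ)`. -/
noncomputable def dunklQuot (κ : R) (j : σ) : MvPolynomial σ R →ₗ[R] MvPolynomial σ R :=
  (2 : R) • (pderiv j).toLinearMap + κ • ∑ l, divDiff j l

lemma dunklQuot_apply (κ : R) (j : σ) (P : MvPolynomial σ R) :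
    dunklQuot κ j P = (2 : R) • pderiv j P + κ • ∑ l, divDiff j l P := by
  simp [dunklQuot]

lemma sum_orderedPair_pairOp {d : ℕ} (P : MvPolynomial (Fin d) R) :
    ∑ p : OrderedPair d, pairOp p.1.1 p.1.2 P =
      ∑ i, ∑ j, (X i * pderiv i (divDiff i j P) + divDiff i j (X i * pderiv i P)) := by
  rw [← sum_orderedPair_add_swap _ fun i => by simp [divDiff_self]]
  refine Finset.sum_congr rfl fun p _ => ?_
  simp only [pairOp_apply, eulerDiff_apply, divDiff_comm p.1.1 p.1.2, map_neg, map_sub]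
  ring

variable [CharZero R]

lemma sum_sum_divDiff (P : MvPolynomial σ R) : ∑ i, ∑ j, divDiff i j P = 0 :=
  sum_sum_eq_zero_of_antisymm _ fun i j => divDiff_comm j i P

lemma sum_sum_sum_X_mul_divDiff_divDiff (P : MvPolynomial σ R) :
    ∑ i, ∑ j, ∑ k, X j * divDiff i j (divDiff i k P) = 0 := by
  apply sum_sum_sum_eq_zero_of_symmetrized
  intro i j k
  rcases eq_or_ne i j with rfl | hij
  · simp [divDiff_self, divDiff_divDiff_self]
  rcases eq_or_ne i k with rfl | hik
  · simp [divDiff_self, divDiff_divDiff_self]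
  rcases eq_or_ne j k with rfl | hjk
  · simp [divDiff_self, divDiff_divDiff_self]
  exact divDiff_divDiff_symmetrized hij hik hjk P

lemma sum_sum_sum_divDiff_X_mul_divDiff (P : MvPolynomial σ R) :
    ∑ i, ∑ j, ∑ k, divDiff i j (X i * divDiff i k P) = 0 := by
  have expand (i j k : σ) : divDiff i j (X i * divDiff i k P) = divDiff i k P -
      (if j = i then divDiff i k P else 0) + X j * divDiff i j (divDiff i k P) := by
    split_ifs with h
    · simp [h, divDiff_self]
    · rw [divDiff_X_mul (Ne.symm h), sub_zero]
  have hsum : ∑ i : σ, ∑ _j : σ, ∑ k, divDiff i k P = 0 := by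
    rw [Finset.sum_comm]
    simp only [sum_sum_divDiff, Finset.sum_const_zero]
  have hdiag : ∑ i, ∑ j, ∑ k, (if j = i then divDiff i k P else 0) = 0 := by
    refine (Finset.sum_congr rfl fun i _ => Finset.sum_comm).trans ?_
    simp only [Finset.sum_ite_eq', Finset.mem_univ, if_true, sum_sum_divDiff]
  simp only [expand, Finset.sum_add_distrib, Finset.sum_sub_distrib, hsum, hdiag,
    sum_sum_sum_X_mul_divDiff_divDiff, sub_zero, add_zero]

lemma sum_dunklQuot {d : ℕ} (κ' κ : R) (P : MvPolynomial (Fin d) R) :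
    ∑ j, ((1 + 2 * κ') • dunklQuot κ j P + (2 : R) • (X j * pderiv j (dunklQuot κ j P)) +
        κ • ∑ l, divDiff j l (X j * dunklQuot κ j P)) =
      (4 : R) • ∑ j, X j * pderiv j (pderiv j P) + (2 * (1 + 2 * κ')) • ∑ j, pderiv j P +
        (2 * κ) • ∑ p : OrderedPair d, pairOp p.1.1 p.1.2 P := by
  have hfirst : ∑ j, dunklQuot κ j P = (2 : R) • ∑ j, pderiv j P := by
    simp only [dunklQuot_apply, Finset.sum_add_distrib, ← Finset.smul_sum, sum_sum_divDiff,
      smul_zero, add_zero]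
  have hsecond : ∑ j, X j * pderiv j (dunklQuot κ j P) =
      (2 : R) • ∑ j, X j * pderiv j (pderiv j P) +
        κ • ∑ j, ∑ l, X j * pderiv j (divDiff j l P) := by
    simp only [dunklQuot_apply, map_add, Derivation.map_smul, map_sum, mul_add, mul_smul_comm,
      Finset.mul_sum, Finset.sum_add_distrib, ← Finset.smul_sum]
  have hthird : ∑ j, ∑ l, divDiff j l (X j * dunklQuot κ j P) =
      (2 : R) • ∑ j, ∑ l, divDiff j l (X j * pderiv j P) := by
    simp only [dunklQuot_apply, mul_add, mul_smul_comm, Finset.mul_sum, map_add, map_smul, map_sum,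
      Finset.sum_add_distrib, ← Finset.smul_sum, sum_sum_sum_divDiff_X_mul_divDiff, smul_zero,
      add_zero]
  simp only [sum_orderedPair_pairOp, Finset.sum_add_distrib, ← Finset.smul_sum, hfirst, hsecond,
    hthird]
  module

end DunklPolynomial

section LaplacePolynomial

open MvPolynomial

variable {d : ℕ} (a : Option (Fin d) → ℝ) (κ : ℝ)

/-- The parameter `λ` of the weight `∏ x_i ^ (a_i - 1) ∏ |x_i - x_j| ^ κ` in terms of its
exponents; the barycentric coordinate `1 - |x|` is indexed by `none`. -/
noncomputable def lamParam : ℝ := ∑ k, a k + κ * Fintype.card (OrderedPair d) - 1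

/-- The operator `Δ^T` on polynomials, for the weight with exponents `a` and `κ`. -/
noncomputable def lapPoly : MvPolynomial (Fin d) ℝ →ₗ[ℝ] MvPolynomial (Fin d) ℝ :=
  ∑ i, (LinearMap.mulLeft ℝ (X i) ∘ₗ (pderiv i).toLinearMap ∘ₗ (pderiv i).toLinearMap
      + a (some i) • (pderiv i).toLinearMap)
    - eulerPoly (Fin d) ℝ ∘ₗ eulerPoly (Fin d) ℝ - lamParam a κ • eulerPoly (Fin d) ℝ
    + (κ / 2) • ∑ p : OrderedPair d, pairOp p.1.1 p.1.2

lemma lapPoly_apply (P : MvPolynomial (Fin d) ℝ) :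
    lapPoly a κ P = ∑ i, (X i * pderiv i (pderiv i P) + a (some i) • pderiv i P)
      - eulerPoly (Fin d) ℝ (eulerPoly (Fin d) ℝ P) - lamParam a κ • eulerPoly (Fin d) ℝ P
      + (κ / 2) • ∑ p : OrderedPair d, pairOp p.1.1 p.1.2 P := by
  simp [lapPoly]

/-- The eigenvalue `n (n + λ)` of `-Δ^T` on orthogonal polynomials of degree `n`. -/
noncomputable def eigVal (n : ℕ) : ℝ := n * (n + lamParam a κ)

lemma lapPoly_add_smul_mem_totalDegreeLT {n : ℕ} {P : MvPolynomial (Fin d) ℝ}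
    (hP : P ∈ totalDegreeLT (Fin d) ℝ (n + 1)) :
    lapPoly a κ P + eigVal a κ n • P ∈ totalDegreeLT (Fin d) ℝ n := by
  have hEuler := eulerPoly_sub_smul_mem_totalDegreeLT hP
  have hlocal (i : Fin d) : X i * pderiv i (pderiv i P) + a (some i) • pderiv i P ∈
      totalDegreeLT (Fin d) ℝ n :=
    add_mem (X_mul_pderiv_mem_totalDegreeLT (pderiv_mem_totalDegreeLT hP i) i)
      (Submodule.smul_mem _ _ (pderiv_mem_totalDegreeLT hP i))
  have hpair : ∑ p : OrderedPair d, pairOp p.1.1 p.1.2 P ∈ totalDegreeLT (Fin d) ℝ n :=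
    sum_mem fun p _ => pairOp_mem_totalDegreeLT hP _ _
  have hsplit : lapPoly a κ P + eigVal a κ n • P =
      ∑ i, (X i * pderiv i (pderiv i P) + a (some i) • pderiv i P)
        - eulerPoly (Fin d) ℝ (eulerPoly (Fin d) ℝ P - (n : ℝ) • P)
        - (n + lamParam a κ) • (eulerPoly (Fin d) ℝ P - (n : ℝ) • P)
        + (κ / 2) • ∑ p : OrderedPair d, pairOp p.1.1 p.1.2 P := by
    rw [lapPoly_apply, eigVal]
    simp only [map_sub, map_smul]
    module
  rw [hsplit]
  exact add_mem (sub_mem (sub_mem (sum_mem fun i _ => hlocal i)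
    (eulerPoly_mem_totalDegreeLT hEuler)) (Submodule.smul_mem _ _ hEuler))
    (Submodule.smul_mem _ _ hpair)

end LaplacePolynomial

section PolynomialEvaluation

open MvPolynomial

section Field

variable {σ K : Type*} [Field K]

lemma eval_divDiff [DecidableEq σ] {i j : σ} {x : σ → K} (hx : x i ≠ x j) (P : MvPolynomial σ K) :
    eval x (divDiff i j P) = (eval x P - eval (x ∘ Equiv.swap i j) P) / (x i - x j) := by
  have h := congrArg (eval x) (X_sub_X_mul_divDiff i j P)
  rw [map_mul, map_sub, map_sub, eval_X, eval_X, eval_rename] at h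
  rw [eq_div_iff (sub_ne_zero.2 hx), mul_comm, h]

lemma eval_eulerPoly [Fintype σ] (P : MvPolynomial σ K) (x : σ → K) :
    eval x (eulerPoly σ K P) = ∑ i, x i * eval x (pderiv i P) := by
  simp [eulerPoly_apply]

end Field

variable {d : ℕ}

lemma hasFDerivAt_eval (P : MvPolynomial (Fin d) ℝ) (x : Fin d → ℝ) :
    HasFDerivAt (fun z : Fin d → ℝ => eval z P)
      (∑ i, eval x (pderiv i P) • ContinuousLinearMap.proj (R := ℝ) (φ := fun _ : Fin d => ℝ) i)
      x := by
  induction P using MvPolynomial.induction_on with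
  | C c => simpa using hasFDerivAt_const c x
  | add P Q hP hQ =>
    simp only [map_add, add_smul, Finset.sum_add_distrib]
    exact hP.add hQ
  | mul_X P k hP =>
    simp only [map_mul, eval_X]
    refine (hP.mul (hasFDerivAt_apply (𝕜 := ℝ) k x)).congr_fderiv ?_
    ext v
    simp [pderiv_X, Pi.single_apply, apply_ite (eval x), add_mul, Finset.sum_add_distrib,
      Finset.mul_sum, mul_assoc]

lemma contDiff_eval (P : MvPolynomial (Fin d) ℝ) {n : WithTop ℕ∞} :
    ContDiff ℝ n (fun z : Fin d → ℝ => eval z P) :=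
  (AnalyticOnNhd.eval_mvPolynomial P).contDiff

lemma hasLineDerivAt_eval_psi (P : MvPolynomial (Fin d) ℝ) (u : Fin d → ℝ) (j : Fin d) :
    HasLineDerivAt ℝ (fun v => eval (psi v) P) (2 * u j * eval (psi u) (pderiv j P)) u
      (Pi.single j 1) := by
  have hpsi : HasFDerivAt psi (ContinuousLinearMap.pi fun l => (2 * u l) •
      ContinuousLinearMap.proj (R := ℝ) (φ := fun _ : Fin d => ℝ) l) u :=
    hasFDerivAt_pi.2 fun l => by simpa [psi] using (hasFDerivAt_apply (𝕜 := ℝ) l u).pow 2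
  refine (((hasFDerivAt_eval P (psi u)).comp u hpsi).hasLineDerivAt _).congr_deriv ?_
  simp [Pi.single_apply]
  ring

lemma partialD_eval_psi (P : MvPolynomial (Fin d) ℝ) (u : Fin d → ℝ) (j : Fin d) :
    partialD j (fun v => eval (psi v) P) u = 2 * u j * eval (psi u) (pderiv j P) :=
  (hasLineDerivAt_eval_psi P u j).lineDeriv

lemma partialD_mul_eval_psi (P : MvPolynomial (Fin d) ℝ) (u : Fin d → ℝ) (j : Fin d) :
    partialD j (fun v => v j * eval (psi v) P) u =
      eval (psi u) (P + (2 : ℝ) • (X j * pderiv j P)) := by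
  have hX : HasLineDerivAt ℝ (fun v : Fin d → ℝ => v j) 1 u (Pi.single j 1) := by
    simpa using (hasFDerivAt_apply (𝕜 := ℝ) j u).hasLineDerivAt (Pi.single j 1)
  refine (HasDerivAt.fun_mul hX (hasLineDerivAt_eval_psi P u j)).deriv.trans ?_
  simp [psi]
  ring

lemma eulerOp_eval_psi (P : MvPolynomial (Fin d) ℝ) :
    eulerOp (fun v : Fin d → ℝ => eval (psi v) P) =
      fun v => eval (psi v) ((2 : ℝ) • eulerPoly (Fin d) ℝ P) := by
  funext u
  rw [smul_eval, eval_eulerPoly, eulerOp, Finset.mul_sum]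
  refine Finset.sum_congr rfl fun i _ => ?_
  rw [partialD_eval_psi, psi]
  ring

end PolynomialEvaluation

section DunklOperator

open MvPolynomial

variable {d : ℕ}

/-- The point with the sign of the `j`-th coordinate changed. -/
def flipSign (j : Fin d) (u : Fin d → ℝ) : Fin d → ℝ := Function.update u j (-u j)

lemma flipSign_self (j : Fin d) (u : Fin d → ℝ) : flipSign j u j = -u j := by
  simp [flipSign]

lemma flipSign_of_ne {i j : Fin d} (h : i ≠ j) (u : Fin d → ℝ) : flipSign j u i = u i := by
  simp [flipSign, h]

lemma flipSign_comm (i j : Fin d) (u : Fin d → ℝ) :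
    flipSign i (flipSign j u) = flipSign j (flipSign i u) := by
  rcases eq_or_ne i j with rfl | h
  · rfl
  · simp [flipSign, h, h.symm, Function.update_comm h]

lemma psi_flipSign (j : Fin d) (u : Fin d → ℝ) : psi (flipSign j u) = psi u := by
  funext m
  rcases eq_or_ne m j with rfl | h <;> simp [psi, flipSign, *]

lemma psi_comp (u : Fin d → ℝ) (e : Fin d → Fin d) : psi (u ∘ e) = psi u ∘ e := rfl

lemma psi_psiInv {x : Fin d → ℝ} (hx : ∀ i, 0 ≤ x i) : psi (psiInv x) = x := by
  funext i
  simp [psi, psiInv, Real.sq_sqrt (hx i)]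

lemma rootReflection_sqrt_two_single (i : Fin d) (u : Fin d → ℝ) :
    rootReflection (√2 • Pi.single i 1) u = flipSign i u := by
  have h2 : √2 * √2 = 2 := Real.mul_self_sqrt (by norm_num)
  funext m
  rcases eq_or_ne m i with rfl | h
  · simp [rootReflection, flipSign, dotProduct_smul, h2]
    linear_combination (-u m) * h2
  · simp [rootReflection, flipSign, h]

lemma rootReflection_single_sub_single {i j : Fin d} (hij : i ≠ j) (u : Fin d → ℝ) :
    rootReflection (Pi.single i 1 - Pi.single j 1) u = u ∘ Equiv.swap i j := by
  funext m
  rcases eq_or_ne m i with rfl | hi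
  · simp [rootReflection, hij, hij.symm]
    ring
  rcases eq_or_ne m j with rfl | hj
  · simp [rootReflection, hij, hij.symm]
    ring
  · simp [rootReflection, hi, hj, Equiv.swap_apply_of_ne_of_ne]

lemma rootReflection_single_add_single {i j : Fin d} (hij : i ≠ j) (u : Fin d → ℝ) :
    rootReflection (Pi.single i 1 + Pi.single j 1) u =
      flipSign i (flipSign j (u ∘ Equiv.swap i j)) := by
  funext m
  rcases eq_or_ne m i with rfl | hi
  · simp [rootReflection, flipSign, hij, hij.symm]
    ring
  rcases eq_or_ne m j with rfl | hj
  · simp [rootReflection, flipSign, hij, hij.symm]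
    ring
  · simp [rootReflection, flipSign, hi, hj, Equiv.swap_apply_of_ne_of_ne]

lemma dunklOp_signChangeRoot (mult : Fin d → ℝ) (j : Fin d) (G : (Fin d → ℝ) → ℝ)
    (u : Fin d → ℝ) :
    dunklOp signChangeRoot mult j G u =
      partialD j G u + mult j * ((G u - G (flipSign j u)) / u j) := by
  rw [dunklOp, Finset.sum_eq_single j]
  · congr 1
    rw [signChangeRoot, rootReflection_sqrt_two_single]
    simp only [Pi.smul_apply, Pi.single_eq_same, smul_eq_mul, dotProduct_smul,
      dotProduct_single]
    field_simp
  · intro b _ hb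
    simp [signChangeRoot, hb.symm]
  · simp

lemma dunklOp_hyperoctahedralRoot (κ' κ : ℝ) (j : Fin d) (G : (Fin d → ℝ) → ℝ)
    (u : Fin d → ℝ) :
    dunklOp hyperoctahedralRoot (hyperoctahedralMult κ' κ) j G u =
      partialD j G u + κ' * ((G u - G (flipSign j u)) / u j) +
        κ / 2 * ∑ l, if l = j then 0 else (G u - G (u ∘ Equiv.swap j l)) / (u j - u l) +
          (G u - G (flipSign j (flipSign l (u ∘ Equiv.swap j l)))) / (u j + u l) := by
  have hsingle := dunklOp_signChangeRoot (fun _ => κ') j G u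
  rw [dunklOp] at hsingle ⊢
  rw [Fintype.sum_sum_type, Fintype.sum_sum_type, add_assoc, ← add_left_cancel hsingle]
  congr 2
  rw [← Finset.sum_add_distrib, ← sum_orderedPair_incident j _ (by simp), Finset.mul_sum]
  refine Finset.sum_congr rfl fun p _ => ?_
  have hp : p.1.1 ≠ p.1.2 := ne_of_lt p.2
  simp only [hyperoctahedralRoot, hyperoctahedralMult, rootReflection_single_sub_single hp,
    rootReflection_single_add_single hp, Pi.sub_apply, Pi.add_apply, dotProduct_sub,
    dotProduct_add, dotProduct_single, mul_one]
  rcases eq_or_ne p.1.1 j with rfl | h1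
  · simp [hp, hp.symm]
    ring
  rcases eq_or_ne p.1.2 j with rfl | h2
  · simp only [Pi.single_eq_same, Pi.single_eq_of_ne hp.symm, if_neg hp,
      ↓reduceIte, zero_add]
    rw [Equiv.swap_comm p.1.2, flipSign_comm p.1.2, add_comm (u p.1.2),
      ← neg_sub (u p.1.1) (u p.1.2), div_neg]
    ring
  · simp [h1, h2, h1.symm, h2.symm]

/-- The points of `ℝ^d` off all reflection hyperplanes of the hyperoctahedral group. -/
def genericBall (d : ℕ) : Set (Fin d → ℝ) := {u | (∀ i, u i ≠ 0) ∧ Function.Injective (psi u)}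

lemma isOpen_genericBall : IsOpen (genericBall d) := by
  have h : genericBall d = (⋂ i, {u | u i ≠ 0}) ∩ ⋂ i, ⋂ j, ⋂ _ : i ≠ j,
      {u | u i ^ 2 ≠ u j ^ 2} := by
    ext u
    simp [genericBall, Function.Injective, psi, not_imp_not]
  rw [h]
  refine (isOpen_iInter_of_finite fun i => ?_).inter (isOpen_iInter_of_finite fun i =>
    isOpen_iInter_of_finite fun j => isOpen_iInter_of_finite fun _ => ?_)
  · exact isOpen_ne_fun (continuous_apply i) continuous_const
  · exact isOpen_ne_fun ((continuous_apply i).pow 2) ((continuous_apply j).pow 2)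

lemma flipSign_mem_genericBall {u : Fin d → ℝ} (hu : u ∈ genericBall d) (j : Fin d) :
    flipSign j u ∈ genericBall d := by
  refine ⟨fun i => ?_, by rw [psi_flipSign]; exact hu.2⟩
  rcases eq_or_ne i j with rfl | h
  · simpa [flipSign] using hu.1 i
  · simpa [flipSign, h] using hu.1 i

lemma comp_perm_mem_genericBall {u : Fin d → ℝ} (hu : u ∈ genericBall d)
    (e : Equiv.Perm (Fin d)) : u ∘ e ∈ genericBall d :=
  ⟨fun i => hu.1 (e i), hu.2.comp e.injective⟩

lemma sub_ne_zero_and_add_ne_zero_of_mem_genericBall {u : Fin d → ℝ} (hu : u ∈ genericBall d)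
    {j l : Fin d} (h : j ≠ l) : u j - u l ≠ 0 ∧ u j + u l ≠ 0 := by
  rw [← mul_ne_zero_iff, mul_comm, ← sq_sub_sq, sub_ne_zero]
  exact hu.2.ne h

lemma dunklOp_signChangeRoot_eval_psi (mult : Fin d → ℝ) (P : MvPolynomial (Fin d) ℝ)
    (j : Fin d) (u : Fin d → ℝ) :
    dunklOp signChangeRoot mult j (fun v => eval (psi v) P) u =
      u j * eval (psi u) ((2 : ℝ) • pderiv j P) := by
  rw [dunklOp_signChangeRoot, partialD_eval_psi, psi_flipSign, smul_eval]
  ring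

lemma dunklOp_signChangeRoot_mul_eval_psi (mult : Fin d → ℝ) (j : Fin d)
    (Q : MvPolynomial (Fin d) ℝ) {u : Fin d → ℝ} (hu : u j ≠ 0) :
    dunklOp signChangeRoot mult j (fun v => v j * eval (psi v) Q) u =
      eval (psi u) ((1 + 2 * mult j) • Q + (2 : ℝ) • (X j * pderiv j Q)) := by
  rw [dunklOp_signChangeRoot, psi_flipSign, flipSign_self, partialD_mul_eval_psi]
  simp only [map_add, smul_eval]
  field_simp
  ring

lemma dunklOp_hyperoctahedralRoot_eval_psi (κ' κ : ℝ) (P : MvPolynomial (Fin d) ℝ) (j : Fin d)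
    {u : Fin d → ℝ} (hu : u ∈ genericBall d) :
    dunklOp hyperoctahedralRoot (hyperoctahedralMult κ' κ) j (fun v => eval (psi v) P) u =
      u j * eval (psi u) (dunklQuot κ j P) := by
  have hdiff (l : Fin d) : (if l = j then 0 else
      (eval (psi u) P - eval (psi u ∘ Equiv.swap j l) P) / (u j - u l) +
        (eval (psi u) P - eval (psi u ∘ Equiv.swap j l) P) / (u j + u l)) =
      2 * u j * eval (psi u) (divDiff j l P) := by
    split_ifs with h
    · simp [h, divDiff_self]
    obtain ⟨hsub, hadd⟩ := sub_ne_zero_and_add_ne_zero_of_mem_genericBall hu (Ne.symm h)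
    have hpsi : psi u j - psi u l = (u j - u l) * (u j + u l) := by simp only [psi]; ring
    rw [eval_divDiff (hu.2.ne (Ne.symm h)), hpsi]
    field_simp
    ring
  rw [dunklOp_hyperoctahedralRoot, partialD_eval_psi]
  simp only [psi_flipSign, psi_comp, hdiff, dunklQuot_apply, map_add, smul_eval, map_sum,
    ← Finset.mul_sum]
  ring

lemma dunklOp_hyperoctahedralRoot_of_eqOn (κ' κ : ℝ) (j : Fin d) (Q : MvPolynomial (Fin d) ℝ)
    {G : (Fin d → ℝ) → ℝ} (hG : Set.EqOn G (fun v => v j * eval (psi v) Q) (genericBall d))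
    {u : Fin d → ℝ} (hu : u ∈ genericBall d) :
    dunklOp hyperoctahedralRoot (hyperoctahedralMult κ' κ) j G u =
      eval (psi u) ((1 + 2 * κ') • Q + (2 : ℝ) • (X j * pderiv j Q) +
        κ • ∑ l, divDiff j l (X j * Q)) := by
  have hpartial : partialD j G u = partialD j (fun v => v j * eval (psi v) Q) u :=
    (hG.eventuallyEq_of_mem (isOpen_genericBall.mem_nhds hu)).lineDeriv_eq
  have hdiff (l : Fin d) : (if l = j then 0 else (G u - G (u ∘ Equiv.swap j l)) / (u j - u l) +
      (G u - G (flipSign j (flipSign l (u ∘ Equiv.swap j l)))) / (u j + u l)) =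
      2 * eval (psi u) (divDiff j l (X j * Q)) := by
    split_ifs with h
    · simp [h, divDiff_self]
    obtain ⟨hsub, hadd⟩ := sub_ne_zero_and_add_ne_zero_of_mem_genericBall hu (Ne.symm h)
    have hpsi : psi u j - psi u l = (u j - u l) * (u j + u l) := by simp only [psi]; ring
    have hswap := comp_perm_mem_genericBall hu (Equiv.swap j l)
    rw [eval_divDiff (hu.2.ne (Ne.symm h)), hpsi, hG hu, hG hswap,
      hG (flipSign_mem_genericBall (flipSign_mem_genericBall hswap l) j)]
    simp only [psi_flipSign, psi_comp, flipSign_self, flipSign_of_ne (Ne.symm h), map_mul, eval_X,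
      Function.comp_apply, Equiv.swap_apply_left]
    simp only [psi]
    field_simp
    ring
  rw [dunklOp_hyperoctahedralRoot]
  simp only [hdiff]
  rw [hpartial, partialD_mul_eval_psi, hG hu, hG (flipSign_mem_genericBall hu j)]
  have huj := hu.1 j
  simp only [psi_flipSign, flipSign_self, map_add, smul_eval, map_sum, ← Finset.mul_sum]
  field_simp
  ring

end DunklOperator

section Laplacian

open MvPolynomial

variable {d : ℕ}

lemma dunklLaplacian_signChangeRoot_eval_psi (mult : Fin d → ℝ) (P : MvPolynomial (Fin d) ℝ)
    {u : Fin d → ℝ} (hu : ∀ i, u i ≠ 0) :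
    dunklLaplacian signChangeRoot mult (fun v => eval (psi v) P) u =
      4 * eval (psi u) (∑ j, (X j * pderiv j (pderiv j P) + (mult j + 1 / 2) • pderiv j P)) := by
  rw [dunklLaplacian, map_sum, Finset.mul_sum]
  refine Finset.sum_congr rfl fun j _ => ?_
  have hinner : dunklOp signChangeRoot mult j (fun v => eval (psi v) P) =
      fun v => v j * eval (psi v) ((2 : ℝ) • pderiv j P) :=
    funext (dunklOp_signChangeRoot_eval_psi mult P j)
  rw [hinner, dunklOp_signChangeRoot_mul_eval_psi mult j _ (hu j)]
  simp only [Derivation.map_smul, map_add, map_mul, smul_eval, eval_X]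
  ring

lemma dunklLaplacian_hyperoctahedralRoot_eval_psi (κ' κ : ℝ) (P : MvPolynomial (Fin d) ℝ)
    {u : Fin d → ℝ} (hu : u ∈ genericBall d) :
    dunklLaplacian hyperoctahedralRoot (hyperoctahedralMult κ' κ) (fun v => eval (psi v) P) u =
      eval (psi u) ((4 : ℝ) • ∑ j, X j * pderiv j (pderiv j P) +
        (2 * (1 + 2 * κ')) • ∑ j, pderiv j P +
        (2 * κ) • ∑ p : OrderedPair d, pairOp p.1.1 p.1.2 P) := by
  rw [← sum_dunklQuot, map_sum, dunklLaplacian]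
  exact Finset.sum_congr rfl fun j _ => dunklOp_hyperoctahedralRoot_of_eqOn κ' κ j _
    (fun _ hv => dunklOp_hyperoctahedralRoot_eval_psi κ' κ P j hv) hu

lemma ballLaplacian_eval_psi {ι : Type} [Fintype ι] (root : ι → Fin d → ℝ) (mult : ι → ℝ) (μ : ℝ)
    (P : MvPolynomial (Fin d) ℝ) (u : Fin d → ℝ) :
    ballLaplacian root mult μ (fun v => eval (psi v) P) u =
      dunklLaplacian root mult (fun v => eval (psi v) P) u -
        4 * eval (psi u) (eulerPoly (Fin d) ℝ (eulerPoly (Fin d) ℝ P)) -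
        4 * ((∑ a, mult a) + μ + ((d : ℝ) - 1) / 2) * eval (psi u) (eulerPoly (Fin d) ℝ P) := by
  rw [ballLaplacian, eulerOp_eval_psi, eulerOp_eval_psi, map_smul]
  simp only [smul_eval]
  ring

namespace SimplexWeight

/-- The exponents of the weight in the barycentric coordinates (`none` stands for `1 - |x|`),
raised by `1` as for a Dirichlet density: coordinate `k` enters with the power `expo k - 1`. -/
noncomputable def expo : SimplexWeight d → Option (Fin d) → ℝ
  | .signChange κ => fun k => k.elim ((κ (Fin.last d) : ℝ) + 1 / 2)
      fun i => (κ i.castSucc : ℝ) + 1 / 2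
  | .hyperoctahedral κ' _ μ => fun k => k.elim ((μ : ℝ) + 1 / 2) fun _ => (κ' : ℝ) + 1 / 2

/-- The exponent of the factors `|x_i - x_j|` of the weight. -/
noncomputable def pairExpo : SimplexWeight d → ℝ
  | .signChange _ => 0
  | .hyperoctahedral _ κ _ => κ

lemma lamParam_signChange (κ : Fin (d + 1) → ℝ≥0) :
    lamParam (signChange κ).expo (signChange κ).pairExpo =
      (∑ i : Fin d, (κ i.castSucc : ℝ)) + κ (Fin.last d) + ((d : ℝ) - 1) / 2 := by
  simp only [lamParam, expo, pairExpo, Fintype.sum_option, Option.elim, Finset.sum_add_distrib,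
    Finset.sum_const, Finset.card_univ, Fintype.card_fin, nsmul_eq_mul]
  ring

lemma lamParam_hyperoctahedral (κ' κ μ : ℝ≥0) :
    lamParam (hyperoctahedral (d := d) κ' κ μ).expo (hyperoctahedral (d := d) κ' κ μ).pairExpo =
      (∑ i, hyperoctahedralMult (d := d) κ' κ i) + μ + ((d : ℝ) - 1) / 2 := by
  simp only [lamParam, expo, pairExpo, Fintype.sum_option, Option.elim, Finset.sum_const,
    Finset.card_univ, Fintype.card_fin, Fintype.sum_sum_type, hyperoctahedralMult, nsmul_eq_mul,
    Fintype.card_sum, Nat.cast_add]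
  ring

lemma laplacian_eval (w : SimplexWeight d) (P : MvPolynomial (Fin d) ℝ) {x : Fin d → ℝ}
    (hx : ∀ i, 0 < x i) (hx' : Function.Injective x) :
    w.laplacian (fun z => eval z P) x = eval x (lapPoly w.expo w.pairExpo P) := by
  have hpsi : psi (psiInv x) = x := psi_psiInv fun i => (hx i).le
  have hu : psiInv x ∈ genericBall d :=
    ⟨fun i => (Real.sqrt_pos.2 (hx i)).ne', by rwa [hpsi]⟩
  have hcomp : (fun z : Fin d → ℝ => eval z P) ∘ psi = fun v => eval (psi v) P := rfl
  cases w with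
  | signChange κ =>
    rw [lapPoly_apply, lamParam_signChange, laplacian, ballOp, hcomp, ballLaplacian_eval_psi,
      dunklLaplacian_signChangeRoot_eval_psi _ P hu.1, hpsi]
    simp only [map_sub, map_add, smul_eval, expo, Option.elim, pairExpo]
    ring
  | hyperoctahedral κ' κ μ =>
    rw [lapPoly_apply, lamParam_hyperoctahedral, laplacian, ballOp, hcomp, ballLaplacian_eval_psi,
      dunklLaplacian_hyperoctahedralRoot_eval_psi _ _ P hu, hpsi]
    simp only [map_sub, map_add, map_sum, smul_eval, expo, Option.elim, pairExpo,
      Finset.sum_add_distrib, ← Finset.mul_sum]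
    ring

end SimplexWeight

end Laplacian

section MeasureOfSets

open Set

variable {E : Type*} [NormedAddCommGroup E] [NormedSpace ℝ E] [MeasurableSpace E] [BorelSpace E]
  [FiniteDimensional ℝ E] (μ : Measure E) [μ.IsAddHaarMeasure]

lemma addHaar_setOf_linearMap_eq {f : E →ₗ[ℝ] ℝ} (hf : f ≠ 0) (c : ℝ) : μ {x | f x = c} = 0 := by
  rcases eq_empty_or_nonempty {x | f x = c} with h | ⟨x₀, rfl : f x₀ = c⟩
  · rw [h, measure_empty]
  · have h : {x | f x = f x₀} = (AffineSubspace.mk' x₀ (LinearMap.ker f) : Set E) := by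
      ext x
      simp [AffineSubspace.mem_mk', sub_eq_zero]
    rw [h]
    refine Measure.addHaar_affineSubspace μ _ fun htop => hf (LinearMap.ker_eq_top.1 ?_)
    rw [← AffineSubspace.direction_mk' x₀ (LinearMap.ker f), htop, AffineSubspace.direction_top]

lemma measurePreserving_linearMap_add_const_of_involutive (f : E →ₗ[ℝ] E) (c : E)
    (h : Function.Involutive fun x => f x + c) : MeasurePreserving (fun x => f x + c) μ μ := by
  have hc : f c + c = 0 := by simpa using h 0
  have hff : f ∘ₗ f = LinearMap.id := by
    ext x
    simpa [add_assoc, hc] using h x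
  have hdet : LinearMap.det f * LinearMap.det f = 1 := by
    rw [← LinearMap.det_comp, hff, LinearMap.det_id]
  have habs : |(LinearMap.det f)⁻¹| = 1 := by
    rcases mul_self_eq_one_iff.1 hdet with h | h <;> simp [h]
  refine (measurePreserving_add_right μ c).comp
    ⟨f.continuous_of_finiteDimensional.measurable, ?_⟩
  rw [Measure.map_linearMap_addHaar_eq_smul_addHaar μ (left_ne_zero_of_mul_eq_one hdet), habs,
    ENNReal.ofReal_one, one_smul]

end MeasureOfSets

section Simplex

open Set Filter Topology

variable {d : ℕ}

/-- The barycentric coordinates `1 - ∑ x_i` (index `none`) and `x_i` (index `some i`) on the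
simplex. -/
def bary (k : Option (Fin d)) (x : Fin d → ℝ) : ℝ := k.elim (1 - ∑ i, x i) fun i => x i

@[simp] lemma bary_none (x : Fin d → ℝ) : bary none x = 1 - ∑ i, x i := rfl

@[simp] lemma bary_some (i : Fin d) (x : Fin d → ℝ) : bary (some i) x = x i := rfl

@[fun_prop] lemma continuous_bary (k : Option (Fin d)) : Continuous (bary k) := by
  cases k with
  | none => exact continuous_const.sub (continuous_finsetSum _ fun i _ => continuous_apply i)
  | some i => exact continuous_apply i

lemma sum_bary (x : Fin d → ℝ) : ∑ k, bary k x = 1 := by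
  simp [Fintype.sum_option]

lemma mem_simplexT_iff {x : Fin d → ℝ} : x ∈ simplexT d ↔ ∀ k, 0 ≤ bary k x := by
  rw [Option.forall, and_comm]
  refine and_congr_right fun h => ?_
  rw [bary_none, Finset.sum_congr rfl fun i _ => abs_of_nonneg (h i)]

lemma bary_nonneg {x : Fin d → ℝ} (hx : x ∈ simplexT d) (k : Option (Fin d)) : 0 ≤ bary k x :=
  mem_simplexT_iff.1 hx k

lemma bary_le_one {x : Fin d → ℝ} (hx : x ∈ simplexT d) (k : Option (Fin d)) : bary k x ≤ 1 := by
  rw [← sum_bary x]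
  exact Finset.single_le_sum (fun m _ => bary_nonneg hx m) (Finset.mem_univ k)

/-- The interior of the simplex. -/
def openSimplex (d : ℕ) : Set (Fin d → ℝ) := {x | ∀ k, 0 < bary k x}

lemma openSimplex_subset : openSimplex d ⊆ simplexT d := fun _ hx =>
  mem_simplexT_iff.2 fun k => (hx k).le

lemma isOpen_openSimplex : IsOpen (openSimplex d) := by
  simp only [openSimplex, ofPred_forall]
  exact isOpen_iInter_of_finite fun k => isOpen_lt continuous_const (continuous_bary k)

lemma openSimplex_nonempty : (openSimplex d).Nonempty := by
  refine ⟨fun _ => 1 / (d + 1), fun k => ?_⟩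
  cases k with
  | none =>
    have h : (d : ℝ) / (d + 1) < 1 := (div_lt_one (by positivity)).2 (lt_add_one _)
    simpa [← div_eq_mul_inv] using h
  | some i =>
    rw [bary_some]
    positivity

lemma isClosed_simplexT : IsClosed (simplexT d) := by
  have h : simplexT d = ⋂ k, {x | 0 ≤ bary k x} := by
    ext x
    simp [mem_simplexT_iff]
  rw [h]
  exact isClosed_iInter fun k => isClosed_le continuous_const (continuous_bary k)

lemma measurableSet_simplexT : MeasurableSet (simplexT d) := isClosed_simplexT.measurableSet

lemma isCompact_simplexT : IsCompact (simplexT d) :=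
  isCompact_Icc.of_isClosed_subset isClosed_simplexT fun _ hx =>
    ⟨fun i => bary_nonneg hx (some i), fun i => bary_le_one hx (some i)⟩

lemma bary_convexComb (k : Option (Fin d)) (x y : Fin d → ℝ) {s t : ℝ} (hst : s + t = 1) :
    bary k (s • x + t • y) = s * bary k x + t * bary k y := by
  cases k with
  | none =>
    simp only [bary_none, Pi.add_apply, Pi.smul_apply, smul_eq_mul, Finset.sum_add_distrib,
      ← Finset.mul_sum]
    linear_combination -hst
  | some i => simp

lemma convex_simplexT : Convex ℝ (simplexT d) := by
  intro x hx y hy s t hs ht hst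
  refine mem_simplexT_iff.2 fun k => ?_
  rw [bary_convexComb k x y hst]
  exact add_nonneg (mul_nonneg hs (bary_nonneg hx k)) (mul_nonneg ht (bary_nonneg hy k))

lemma uniqueDiffOn_simplexT : UniqueDiffOn ℝ (simplexT d) :=
  uniqueDiffOn_convex convex_simplexT
    (openSimplex_nonempty.mono (interior_maximal openSimplex_subset isOpen_openSimplex))

lemma ae_bary_ne_zero (k : Option (Fin d)) : ∀ᵐ x : Fin d → ℝ, bary k x ≠ 0 := by
  have hproj (i : Fin d) : (LinearMap.proj i : (Fin d → ℝ) →ₗ[ℝ] ℝ) ≠ 0 := fun h => by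
    simpa using LinearMap.congr_fun h (Pi.single i 1)
  rw [ae_iff]
  cases k with
  | none =>
    rcases isEmpty_or_nonempty (Fin d) with hd | ⟨⟨i⟩⟩
    · simp
    · have hsum : (∑ i, LinearMap.proj i : (Fin d → ℝ) →ₗ[ℝ] ℝ) ≠ 0 := fun h => by
        simpa [LinearMap.sum_apply] using LinearMap.congr_fun h (Pi.single i 1)
      simpa [LinearMap.sum_apply, sub_eq_zero, eq_comm (a := (1 : ℝ))] using
        addHaar_setOf_linearMap_eq volume hsum 1
  | some i => simpa using addHaar_setOf_linearMap_eq volume (hproj i) 0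

lemma simplexT_ae_eq_openSimplex : simplexT d =ᵐ[volume] openSimplex d := by
  filter_upwards [ae_all_iff.2 ae_bary_ne_zero] with x hx
  exact propext ⟨fun h k => (bary_nonneg h k).lt_of_ne' (hx k), fun h => openSimplex_subset h⟩

lemma ae_restrict_simplexT_mem_openSimplex :
    ∀ᵐ x ∂volume.restrict (simplexT d), x ∈ openSimplex d := by
  rw [Measure.restrict_congr_set simplexT_ae_eq_openSimplex]
  exact ae_restrict_mem isOpen_openSimplex.measurableSet

lemma ae_injective {ι : Type*} [Fintype ι] : ∀ᵐ x : ι → ℝ, Function.Injective x := by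
  classical
  have h (i j : ι) (hij : i ≠ j) : ∀ᵐ x : ι → ℝ, x i ≠ x j := by
    have hf : LinearMap.proj (R := ℝ) (φ := fun _ : ι => ℝ) i - LinearMap.proj j ≠ 0 := fun h => by
      simpa [LinearMap.sub_apply, hij.symm] using LinearMap.congr_fun h (Pi.single i 1)
    simpa [LinearMap.sub_apply, ae_iff, sub_eq_zero] using addHaar_setOf_linearMap_eq volume hf 0
  have h' : ∀ᵐ x : ι → ℝ, ∀ i j, i ≠ j → x i ≠ x j := by
    simpa only [ae_all_iff, eventually_imp_distrib_left] using h
  filter_upwards [h'] with x hx i j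
  exact not_imp_not.1 (hx i j)

section Swap

variable {ι : Type*} [DecidableEq ι] (i j : ι)

lemma continuous_comp_swap : Continuous fun x : ι → ℝ => x ∘ Equiv.swap i j :=
  Pi.continuous_precomp _

lemma involutive_comp_swap : Function.Involutive fun x : ι → ℝ => x ∘ Equiv.swap i j :=
  fun x => by ext; simp

lemma measurableEmbedding_comp_swap [Countable ι] :
    MeasurableEmbedding fun x : ι → ℝ => x ∘ Equiv.swap i j :=
  (MeasurableEquiv.ofInvolutive _ (involutive_comp_swap i j)
    (continuous_comp_swap i j).measurable).measurableEmbedding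

lemma measurePreserving_comp_swap [Fintype ι] :
    MeasurePreserving (fun x : ι → ℝ => x ∘ Equiv.swap i j) volume volume := by
  have h := measurePreserving_linearMap_add_const_of_involutive volume
    (LinearMap.funLeft ℝ ℝ (Equiv.swap i j)) 0
    (by simp only [add_zero]; exact involutive_comp_swap i j)
  simp only [add_zero] at h
  exact h

end Swap

end Simplex

section BaryFlip

open Set

variable {d : ℕ}

/-- The affine involution of `ℝ^d` exchanging the barycentric coordinates `none` and `some i`. -/
def baryFlip (i : Fin d) (x : Fin d → ℝ) : Fin d → ℝ := Function.update x i (bary none x)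

lemma bary_baryFlip (i : Fin d) (x : Fin d → ℝ) (k : Option (Fin d)) :
    bary k (baryFlip i x) = bary (Equiv.swap none (some i) k) x := by
  cases k with
  | none =>
    have h := Finset.sum_erase_eq_sub (f := x) (Finset.mem_univ i)
    rw [Finset.erase_eq] at h
    rw [Equiv.swap_apply_left, bary_none, baryFlip, Finset.sum_update_of_mem (Finset.mem_univ i),
      h, bary_none, bary_some]
    ring
  | some j =>
    rcases eq_or_ne j i with rfl | h
    · simp [baryFlip]
    · rw [Equiv.swap_apply_of_ne_of_ne (by simp) (by simpa using h)]
      simp [baryFlip, h]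

lemma involutive_baryFlip (i : Fin d) : Function.Involutive (baryFlip i) := fun x => by
  funext j
  have h := bary_baryFlip i (baryFlip i x) (some j)
  rwa [bary_baryFlip i x, ← Equiv.Perm.mul_apply, Equiv.swap_mul_self] at h

lemma measurePreserving_baryFlip (i : Fin d) : MeasurePreserving (baryFlip i) volume volume := by
  let f : (Fin d → ℝ) →ₗ[ℝ] (Fin d → ℝ) :=
    LinearMap.id - ∑ k, LinearMap.toSpanSingleton ℝ _ (Pi.single i 1) ∘ₗ LinearMap.proj k
      - LinearMap.toSpanSingleton ℝ _ (Pi.single i 1) ∘ₗ LinearMap.proj i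
  have h : baryFlip i = fun x => f x + Pi.single i 1 := by
    funext x m
    rcases eq_or_ne m i with rfl | h
    · simp [baryFlip, f, LinearMap.sub_apply, LinearMap.sum_apply]
      ring
    · simp [baryFlip, f, LinearMap.sub_apply, LinearMap.sum_apply, h]
  rw [h]
  exact measurePreserving_linearMap_add_const_of_involutive volume f _
    (h ▸ involutive_baryFlip i)

lemma measurableEmbedding_baryFlip (i : Fin d) : MeasurableEmbedding (baryFlip i) :=
  (MeasurableEquiv.ofInvolutive _ (involutive_baryFlip i)
    (measurePreserving_baryFlip i).measurable).measurableEmbedding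

lemma baryFlip_preimage_simplexT (i : Fin d) : baryFlip i ⁻¹' simplexT d = simplexT d := by
  ext x
  simp only [mem_preimage, mem_simplexT_iff, bary_baryFlip]
  exact (Equiv.swap none (some i)).forall_congr_left.trans (by simp)

end BaryFlip

section DirichletDensity

open Set

variable {d : ℕ}

/-- The Dirichlet density `∏ (bary k)^(a k - 1)` with exponents `a`. -/
noncomputable def dirichletDensity (a : Option (Fin d) → ℝ) (x : Fin d → ℝ) : ℝ :=
  ∏ k, bary k x ^ (a k - 1)

lemma measurable_dirichletDensity (a : Option (Fin d) → ℝ) : Measurable (dirichletDensity a) :=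
  Finset.measurable_prod _ fun k _ => (continuous_bary k).measurable.pow_const _

lemma dirichletDensity_nonneg (a : Option (Fin d) → ℝ) {x : Fin d → ℝ} (hx : x ∈ simplexT d) :
    0 ≤ dirichletDensity a x :=
  Finset.prod_nonneg fun k _ => Real.rpow_nonneg (bary_nonneg hx k) _

lemma dirichletDensity_pos (a : Option (Fin d) → ℝ) {x : Fin d → ℝ} (hx : x ∈ openSimplex d) :
    0 < dirichletDensity a x :=
  Finset.prod_pos fun k _ => Real.rpow_pos_of_pos (hx k) _

lemma dirichletDensity_baryFlip (a : Option (Fin d) → ℝ) (i : Fin d) (x : Fin d → ℝ) :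
    dirichletDensity a (baryFlip i x) = dirichletDensity (a ∘ Equiv.swap none (some i)) x := by
  simp only [dirichletDensity, bary_baryFlip]
  exact Fintype.prod_equiv (Equiv.swap none (some i)) _ _ fun k => by simp

lemma integrableOn_dirichletDensity_of_le_bary_none {a : Option (Fin d) → ℝ}
    (ha : ∀ i, 0 < a (some i)) {ε : ℝ} (hε : 0 < ε) :
    IntegrableOn (dirichletDensity a) (simplexT d ∩ {x | ε ≤ bary none x}) := by
  have hcont : ContinuousOn (fun t : ℝ => t ^ (a none - 1)) (Icc ε 1) := fun t ht =>
    (Real.continuousAt_rpow_const _ _ (Or.inl (hε.trans_le ht.1).ne')).continuousWithinAt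
  obtain ⟨C, hC⟩ := isCompact_Icc.exists_bound_of_continuousOn hcont
  let g (i : Fin d) : ℝ → ℝ := (Icc 0 1).indicator fun t => t ^ (a (some i) - 1)
  have hg (i : Fin d) : Integrable (g i) := by
    rw [integrable_indicator_iff measurableSet_Icc,
      ← intervalIntegrable_iff_integrableOn_Icc_of_le zero_le_one]
    exact intervalIntegral.intervalIntegrable_rpow' (by linarith [ha i])
  have hG : Integrable fun x : Fin d → ℝ => C * ∏ i, g i (x i) :=
    (Integrable.fintype_prod hg).const_mul C
  refine hG.integrableOn.mono' (measurable_dirichletDensity a).aestronglyMeasurable ?_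
  have hmeas := measurableSet_simplexT.inter
    (measurableSet_le (measurable_const (a := ε)) (continuous_bary (d := d) none).measurable)
  refine (ae_restrict_iff' hmeas).2 (ae_of_all _ ?_)
  rintro x ⟨hx, hxε⟩
  have hgx (i : Fin d) : g i (x i) = bary (some i) x ^ (a (some i) - 1) :=
    indicator_of_mem (show x i ∈ Icc 0 1 from ⟨bary_nonneg hx (some i), bary_le_one hx (some i)⟩) _
  rw [Real.norm_of_nonneg (dirichletDensity_nonneg a hx), dirichletDensity, Fintype.prod_option]
  simp only [hgx]
  exact mul_le_mul_of_nonneg_right ((le_abs_self _).trans (hC (bary none x)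
    ⟨hxε, bary_le_one hx none⟩))
    (Finset.prod_nonneg fun i _ => Real.rpow_nonneg (bary_nonneg hx _) _)

lemma exists_le_bary (x : Fin d → ℝ) : ∃ k, 1 / (d + 1 : ℝ) ≤ bary k x := by
  by_contra! h
  have hlt := Finset.sum_lt_sum_of_nonempty Finset.univ_nonempty fun k _ => h k
  rw [sum_bary, Finset.sum_const, Finset.card_univ, Fintype.card_option, Fintype.card_fin,
    nsmul_eq_mul, Nat.cast_add_one, mul_one_div_cancel (Nat.cast_add_one_ne_zero d)] at hlt
  exact hlt.false

lemma integrableOn_dirichletDensity {a : Option (Fin d) → ℝ} (ha : ∀ k, 0 < a k) :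
    IntegrableOn (dirichletDensity a) (simplexT d) := by
  have hd : (0 : ℝ) < 1 / (d + 1) := by positivity
  have hcover : simplexT d ⊆ ⋃ k, simplexT d ∩ {x | 1 / (d + 1 : ℝ) ≤ bary k x} := fun x hx =>
    mem_iUnion.2 ((exists_le_bary x).imp fun _ h => ⟨hx, h⟩)
  refine IntegrableOn.mono_set (integrableOn_finite_iUnion.2 fun k => ?_) hcover
  cases k with
  | none => exact integrableOn_dirichletDensity_of_le_bary_none (fun i => ha _) hd
  | some i =>
    have h := integrableOn_dirichletDensity_of_le_bary_none
      (a := a ∘ Equiv.swap none (some i)) (fun k => ha _) hd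
    rw [← (measurePreserving_baryFlip i).integrableOn_comp_preimage
      (measurableEmbedding_baryFlip i), preimage_inter, baryFlip_preimage_simplexT] at h
    simpa [Function.comp_def, dirichletDensity_baryFlip, bary_baryFlip, -bary_none, -bary_some]
      using h

lemma integrableOn_mul_dirichletDensity {a : Option (Fin d) → ℝ} (ha : ∀ k, 0 < a k)
    {g : (Fin d → ℝ) → ℝ} (hg : ContinuousOn g (simplexT d)) :
    IntegrableOn (fun x => g x * dirichletDensity a x) (simplexT d) :=
  (integrableOn_dirichletDensity ha).continuousOn_mul hg isCompact_simplexT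

end DirichletDensity

section LineIntegrals

open Set Filter Topology

lemma integral_eq_zero_of_sub_eq_integral_line {E : Type*} [NormedAddCommGroup E] [NormedSpace ℝ E]
    [MeasurableSpace E] [BorelSpace E] [SecondCountableTopology E] {μ : Measure E} [SFinite μ]
    [μ.IsAddRightInvariant] {Φ Φ' : E → ℝ} (v : E) (hΦ : Integrable Φ μ) (hΦ' : Integrable Φ' μ)
    (h : ∀ x, IntervalIntegrable (fun s : ℝ => Φ' (x + s • v)) volume 0 1 →
      Φ (x + v) - Φ x = ∫ s in (0 : ℝ)..1, Φ' (x + s • v)) :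
    ∫ x, Φ' x ∂μ = 0 := by
  let ν : Measure ℝ := volume.restrict (Ioc 0 1)
  have hshear : MeasurePreserving (fun z : ℝ × E => (z.1, z.2 + z.1 • v)) (ν.prod μ) (ν.prod μ) :=
    (MeasurePreserving.id ν).skew_product (by fun_prop)
      (ae_of_all _ fun s => map_add_right_eq_self μ (s • v))
  have hint : Integrable (fun z : ℝ × E => Φ' (z.2 + z.1 • v)) (ν.prod μ) :=
    hshear.integrable_comp_of_integrable (hΦ'.comp_snd ν)
  have hinner (s : ℝ) : ∫ x, Φ' (x + s • v) ∂μ = ∫ x, Φ' x ∂μ :=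
    integral_add_right_eq_self Φ' (s • v)
  calc ∫ x, Φ' x ∂μ = ∫ s, ∫ x, Φ' (x + s • v) ∂μ ∂ν := by simp [hinner, ν]
    _ = ∫ x, ∫ s, Φ' (x + s • v) ∂ν ∂μ := integral_integral_swap hint
    _ = ∫ x, (Φ (x + v) - Φ x) ∂μ := by
      refine integral_congr_ae ?_
      filter_upwards [hint.prod_left_ae] with x hx
      rw [h x ((intervalIntegrable_iff_integrableOn_Ioc_of_le zero_le_one).2 hx),
        intervalIntegral.integral_of_le zero_le_one]
    _ = 0 := by
      rw [integral_sub (hΦ.comp_add_right v) hΦ, integral_add_right_eq_self, sub_self]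

lemma indicator_Icc_sub_eq_integral {A B s t : ℝ} {φ φ' : ℝ → ℝ}
    (hφ : ContinuousOn φ (Icc A B)) (hA : φ A = 0) (hB : φ B = 0)
    (hderiv : ∀ r ∈ Ioo A B, HasDerivAt φ (φ' r) r)
    (hint : IntervalIntegrable ((Icc A B).indicator φ') volume s t) :
    (Icc A B).indicator φ t - (Icc A B).indicator φ s = ∫ r in s..t, (Icc A B).indicator φ' r := by
  have hcont : Continuous ((Icc A B).indicator φ) := by
    refine continuous_indicator (fun r hr => ?_) (by rwa [isClosed_Icc.closure_eq])
    have hAB := (isClosed_Icc.frontier_subset hr).1.trans (isClosed_Icc.frontier_subset hr).2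
    rw [frontier, closure_Icc, interior_Icc, Icc_sdiff_Ioo_same hAB] at hr
    rcases hr with rfl | rfl <;> assumption
  refine (integral_eq_of_hasDerivAt_off_countable _ _ (Countable.insert A (countable_singleton B))
    hcont.continuousOn (fun r hr => ?_) hint).symm
  obtain ⟨hrA, hrB⟩ : r ≠ A ∧ r ≠ B := by simpa using hr.2
  by_cases hmem : r ∈ Icc A B
  · have hr : r ∈ Ioo A B := ⟨hmem.1.lt_of_ne' hrA, hmem.2.lt_of_ne hrB⟩
    rw [indicator_of_mem hmem]
    refine (hderiv r hr).congr_of_eventuallyEq ?_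
    filter_upwards [Icc_mem_nhds hr.1 hr.2] with y hy using indicator_of_mem hy φ
  · rw [indicator_of_notMem hmem]
    refine (hasDerivAt_const r 0).congr_of_eventuallyEq ?_
    filter_upwards [isClosed_Icc.isOpen_compl.mem_nhds hmem] with y hy using
      indicator_of_notMem hy φ

lemma hasDerivAt_mul_rpow_mul_rpow {g : ℝ → ℝ} {g' A B r : ℝ} (hg : HasDerivAt g g' r)
    (hr : r ∈ Ioo A B) (α β : ℝ) :
    HasDerivAt (fun s => g s * ((s - A) ^ α * (B - s) ^ β))
      (((r - A) * (B - r) * g' + (α * (B - r) - β * (r - A)) * g r) *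
        ((r - A) ^ (α - 1) * (B - r) ^ (β - 1))) r := by
  have hA : r - A ≠ 0 := (sub_pos.2 hr.1).ne'
  have hB : B - r ≠ 0 := (sub_pos.2 hr.2).ne'
  have hα := ((hasDerivAt_id' r).sub_const A).rpow_const (p := α) (Or.inl hA)
  have hβ := ((hasDerivAt_id' r).const_sub B).rpow_const (p := β) (Or.inl hB)
  refine (hg.mul (hα.mul hβ)).congr_deriv ?_
  simp only [Pi.mul_apply]
  rw [← sub_add_cancel α 1, ← sub_add_cancel β 1, Real.rpow_add_one hA, Real.rpow_add_one hB]
  simp only [add_sub_cancel_right]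
  ring

end LineIntegrals

section Edge

open Set

variable {d : ℕ}

/-- The vertex of the simplex at which the barycentric coordinate with index `k` is `1`. -/
def baryVertex (k : Option (Fin d)) : Fin d → ℝ := k.elim 0 fun i => Pi.single i 1

/-- The edge of the simplex from the vertex `l` to the vertex `k`. -/
def baryEdge (k l : Option (Fin d)) : Fin d → ℝ := baryVertex k - baryVertex l

lemma bary_add_smul_baryVertex (m k : Option (Fin d)) (x : Fin d → ℝ) (s : ℝ) :
    bary m (x + s • baryVertex k) =
      bary m x + s * ((if m = k then 1 else 0) - if m = none then 1 else 0) := by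
  cases k with
  | none => cases m <;> simp [baryVertex]
  | some i =>
    cases m with
    | none =>
      simp [baryVertex, Finset.sum_add_distrib, ← Finset.mul_sum]
      ring
    | some j => simp [baryVertex, Pi.single_apply]

lemma bary_add_smul_baryEdge (m k l : Option (Fin d)) (x : Fin d → ℝ) (s : ℝ) :
    bary m (x + s • baryEdge k l) =
      bary m x + s * ((if m = k then 1 else 0) - if m = l then 1 else 0) := by
  have h : x + s • baryEdge k l = x + s • baryVertex k + (-s) • baryVertex l := by
    rw [baryEdge]; module
  rw [h, bary_add_smul_baryVertex, bary_add_smul_baryVertex]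
  ring

lemma bary_left_add_smul_baryEdge {k l : Option (Fin d)} (hkl : k ≠ l) (x : Fin d → ℝ) (s : ℝ) :
    bary k (x + s • baryEdge k l) = bary k x + s := by
  simp [bary_add_smul_baryEdge, hkl]

lemma bary_right_add_smul_baryEdge {k l : Option (Fin d)} (hkl : k ≠ l) (x : Fin d → ℝ) (s : ℝ) :
    bary l (x + s • baryEdge k l) = bary l x - s := by
  simp [bary_add_smul_baryEdge, hkl.symm, sub_eq_add_neg]

lemma bary_add_smul_baryEdge_of_ne {k l m : Option (Fin d)} (hk : m ≠ k) (hl : m ≠ l)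
    (x : Fin d → ℝ) (s : ℝ) : bary m (x + s • baryEdge k l) = bary m x := by
  simp [bary_add_smul_baryEdge, hk, hl]

lemma add_smul_baryEdge_mem_simplexT_iff {k l : Option (Fin d)} (hkl : k ≠ l) {x : Fin d → ℝ}
    (hx : ∀ m, m ≠ k → m ≠ l → 0 ≤ bary m x) (s : ℝ) :
    x + s • baryEdge k l ∈ simplexT d ↔ s ∈ Icc (-bary k x) (bary l x) := by
  rw [mem_simplexT_iff]
  refine ⟨fun h => ⟨?_, ?_⟩, fun h m => ?_⟩
  · linarith [bary_left_add_smul_baryEdge hkl x s ▸ h k]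
  · linarith [bary_right_add_smul_baryEdge hkl x s ▸ h l]
  · rcases eq_or_ne m k with rfl | hmk
    · linarith [bary_left_add_smul_baryEdge hkl x s, h.1]
    rcases eq_or_ne m l with rfl | hml
    · linarith [bary_right_add_smul_baryEdge hkl x s, h.2]
    exact (bary_add_smul_baryEdge_of_ne hmk hml x s).symm ▸ hx m hmk hml

/-- The derivative of `q` along the edge of the simplex from `l` to `k`. It is taken within the
closed simplex, so that it is continuous up to the boundary for `q ∈ C^1(T^d)`. -/
noncomputable def edgeDeriv (k l : Option (Fin d)) (q : (Fin d → ℝ) → ℝ) (x : Fin d → ℝ) : ℝ :=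
  fderivWithin ℝ q (simplexT d) x (baryEdge k l)

variable {q : (Fin d → ℝ) → ℝ}

lemma continuousOn_edgeDeriv (hq : ContDiffOn ℝ 1 q (simplexT d)) (k l : Option (Fin d)) :
    ContinuousOn (edgeDeriv k l q) (simplexT d) :=
  (hq.continuousOn_fderivWithin uniqueDiffOn_simplexT le_rfl).clm_apply continuousOn_const

lemma edgeDeriv_self (k : Option (Fin d)) (x : Fin d → ℝ) : edgeDeriv k k q x = 0 := by
  simp [edgeDeriv, baryEdge]

lemma hasDerivAt_comp_add_smul_baryEdge (hq : DifferentiableOn ℝ q (simplexT d))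
    {k l : Option (Fin d)} (hkl : k ≠ l) {x : Fin d → ℝ}
    (hx : ∀ m, m ≠ k → m ≠ l → 0 ≤ bary m x) {s : ℝ} (hs : s ∈ Ioo (-bary k x) (bary l x)) :
    HasDerivAt (fun r : ℝ => q (x + r • baryEdge k l))
      (edgeDeriv k l q (x + s • baryEdge k l)) s := by
  have hmaps : MapsTo (fun r : ℝ => x + r • baryEdge k l) (Icc (-bary k x) (bary l x))
      (simplexT d) := fun r hr => (add_smul_baryEdge_mem_simplexT_iff hkl hx r).2 hr
  have hline : HasDerivAt (fun r : ℝ => x + r • baryEdge k l) (baryEdge k l) s := by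
    simpa using ((hasDerivAt_id s).smul_const (baryEdge k l)).const_add x
  exact ((hq _ (hmaps (Ioo_subset_Icc_self hs))).hasFDerivWithinAt.comp_hasDerivWithinAt s
    hline.hasDerivWithinAt hmaps).hasDerivAt (Icc_mem_nhds hs.1 hs.2)

/-- The density that integrates to zero by integration by parts along the edge from `l` to `k`:
the derivative of `bary k * bary l * q * dirichletDensity a` along this edge. -/
noncomputable def edgeDivergence (a : Option (Fin d) → ℝ) (k l : Option (Fin d))
    (q : (Fin d → ℝ) → ℝ) (x : Fin d → ℝ) : ℝ :=
  (bary k x * bary l x * edgeDeriv k l q x + (a k * bary l x - a l * bary k x) * q x) *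
    dirichletDensity a x

lemma integrableOn_edgeDivergence {a : Option (Fin d) → ℝ} (ha : ∀ k, 0 < a k)
    (k l : Option (Fin d)) (hq : ContDiffOn ℝ 1 q (simplexT d)) :
    IntegrableOn (edgeDivergence a k l q) (simplexT d) := by
  have hq' := continuousOn_edgeDeriv hq k l
  have hq'' := hq.continuousOn
  exact integrableOn_mul_dirichletDensity ha (by fun_prop)

lemma dirichletDensity_eq_mul_prod_erase (a : Option (Fin d) → ℝ) {k l : Option (Fin d)}
    (hkl : k ≠ l) (x : Fin d → ℝ) :
    dirichletDensity a x = bary k x ^ (a k - 1) * bary l x ^ (a l - 1) *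
      ∏ m ∈ (Finset.univ.erase k).erase l, bary m x ^ (a m - 1) := by
  rw [dirichletDensity, ← Finset.mul_prod_erase _ _ (Finset.mem_univ k),
    ← Finset.mul_prod_erase (Finset.univ.erase k) _
      (Finset.mem_erase.2 ⟨hkl.symm, Finset.mem_univ l⟩), mul_assoc]

lemma dirichletDensity_add_smul_baryEdge (a : Option (Fin d) → ℝ) {k l : Option (Fin d)}
    (hkl : k ≠ l) (x : Fin d → ℝ) (s : ℝ) :
    dirichletDensity a (x + s • baryEdge k l) =
      (bary k x + s) ^ (a k - 1) * (bary l x - s) ^ (a l - 1) *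
        ∏ m ∈ (Finset.univ.erase k).erase l, bary m x ^ (a m - 1) := by
  rw [dirichletDensity_eq_mul_prod_erase a hkl, bary_left_add_smul_baryEdge hkl,
    bary_right_add_smul_baryEdge hkl]
  congr 1
  refine Finset.prod_congr rfl fun m hm => ?_
  simp only [Finset.mem_erase] at hm
  rw [bary_add_smul_baryEdge_of_ne hm.2.1 hm.1]

lemma indicator_simplexT_comp_add_smul_baryEdge {k l : Option (Fin d)} (hkl : k ≠ l)
    {x : Fin d → ℝ} (hx : ∀ m, m ≠ k → m ≠ l → 0 ≤ bary m x) (f : (Fin d → ℝ) → ℝ) (s : ℝ) :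
    (simplexT d).indicator f (x + s • baryEdge k l) =
      (Icc (-bary k x) (bary l x)).indicator (fun r => f (x + r • baryEdge k l)) s := by
  classical
  simp only [indicator_apply, add_smul_baryEdge_mem_simplexT_iff hkl hx]

lemma bary_mul_bary_mul_dirichletDensity_add_smul_baryEdge {a : Option (Fin d) → ℝ}
    (ha : ∀ k, 0 < a k) {k l : Option (Fin d)} (hkl : k ≠ l) (x : Fin d → ℝ) {s : ℝ}
    (hs : s ∈ Icc (-bary k x) (bary l x)) :
    bary k (x + s • baryEdge k l) * bary l (x + s • baryEdge k l) *
        dirichletDensity a (x + s • baryEdge k l) =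
      (s - -bary k x) ^ a k * (bary l x - s) ^ a l *
        ∏ m ∈ (Finset.univ.erase k).erase l, bary m x ^ (a m - 1) := by
  have hpow {b e : ℝ} (hb : 0 ≤ b) (he : 0 < e) : b ^ (e - 1) * b = b ^ e := by
    rw [← Real.rpow_add_one' hb (by linarith), sub_add_cancel]
  rw [dirichletDensity_add_smul_baryEdge a hkl, bary_left_add_smul_baryEdge hkl,
    bary_right_add_smul_baryEdge hkl, ← hpow (sub_nonneg.2 hs.1) (ha k),
    ← hpow (sub_nonneg.2 hs.2) (ha l), sub_neg_eq_add, add_comm s]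
  ring

lemma indicator_sub_eq_integral_edgeDivergence_of_nonneg {a : Option (Fin d) → ℝ}
    (ha : ∀ k, 0 < a k) {k l : Option (Fin d)} (hkl : k ≠ l) (hq : ContDiffOn ℝ 1 q (simplexT d))
    {x : Fin d → ℝ} (hx : ∀ m, m ≠ k → m ≠ l → 0 ≤ bary m x) {s t : ℝ}
    (hint : IntervalIntegrable (fun r : ℝ => (simplexT d).indicator (edgeDivergence a k l q)
      (x + r • baryEdge k l)) volume s t) :
    (simplexT d).indicator (fun y => bary k y * bary l y * q y * dirichletDensity a y)
        (x + t • baryEdge k l) -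
      (simplexT d).indicator (fun y => bary k y * bary l y * q y * dirichletDensity a y)
        (x + s • baryEdge k l) =
      ∫ r in s..t, (simplexT d).indicator (edgeDivergence a k l q) (x + r • baryEdge k l) := by
  set A := -bary k x with hA
  set B := bary l x with hB
  set c := ∏ m ∈ (Finset.univ.erase k).erase l, bary m x ^ (a m - 1) with hc
  let φ (r : ℝ) : ℝ := q (x + r • baryEdge k l) * ((r - A) ^ a k * (B - r) ^ a l) * c
  have hφ : ContinuousOn φ (Icc A B) := by
    have hqe : ContinuousOn (fun r : ℝ => q (x + r • baryEdge k l)) (Icc A B) :=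
      hq.continuousOn.comp (by fun_prop)
        fun r hr => (add_smul_baryEdge_mem_simplexT_iff hkl hx r).2 hr
    have hk : Continuous fun r : ℝ => (r - A) ^ a k :=
      (Real.continuous_rpow_const (ha k).le).comp (by fun_prop)
    have hl : Continuous fun r : ℝ => (B - r) ^ a l :=
      (Real.continuous_rpow_const (ha l).le).comp (by fun_prop)
    exact (hqe.mul (hk.mul hl).continuousOn).mul continuousOn_const
  have hφA : φ A = 0 := by simp [φ, Real.zero_rpow (ha k).ne']
  have hφB : φ B = 0 := by simp [φ, Real.zero_rpow (ha l).ne']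
  have hderiv : ∀ r ∈ Ioo A B,
      HasDerivAt φ (edgeDivergence a k l q (x + r • baryEdge k l)) r := fun r hr => by
    refine ((hasDerivAt_mul_rpow_mul_rpow (hasDerivAt_comp_add_smul_baryEdge
      (hq.differentiableOn one_ne_zero) hkl hx hr) hr (a k) (a l)).mul_const c).congr_deriv ?_
    rw [edgeDivergence, dirichletDensity_add_smul_baryEdge a hkl, bary_left_add_smul_baryEdge hkl,
      bary_right_add_smul_baryEdge hkl, ← hc, ← hB, hA, sub_neg_eq_add, add_comm r]
    ring
  have hΦ (r : ℝ) : (simplexT d).indicator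
      (fun y => bary k y * bary l y * q y * dirichletDensity a y) (x + r • baryEdge k l) =
      (Icc A B).indicator φ r := by
    rw [indicator_simplexT_comp_add_smul_baryEdge hkl hx]
    refine congrFun (indicator_congr fun u hu => ?_) r
    linear_combination q (x + u • baryEdge k l) *
      bary_mul_bary_mul_dirichletDensity_add_smul_baryEdge ha hkl x hu
  simp only [indicator_simplexT_comp_add_smul_baryEdge hkl hx (edgeDivergence a k l q)] at hint ⊢
  rw [hΦ, hΦ]
  exact indicator_Icc_sub_eq_integral hφ hφA hφB hderiv hint

lemma indicator_sub_eq_integral_edgeDivergence {a : Option (Fin d) → ℝ} (ha : ∀ k, 0 < a k)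
    {k l : Option (Fin d)} (hkl : k ≠ l) (hq : ContDiffOn ℝ 1 q (simplexT d)) (x : Fin d → ℝ)
    {s t : ℝ}
    (hint : IntervalIntegrable (fun r : ℝ => (simplexT d).indicator (edgeDivergence a k l q)
      (x + r • baryEdge k l)) volume s t) :
    (simplexT d).indicator (fun y => bary k y * bary l y * q y * dirichletDensity a y)
        (x + t • baryEdge k l) -
      (simplexT d).indicator (fun y => bary k y * bary l y * q y * dirichletDensity a y)
        (x + s • baryEdge k l) =
      ∫ r in s..t, (simplexT d).indicator (edgeDivergence a k l q) (x + r • baryEdge k l) := by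
  by_cases hx : ∀ m, m ≠ k → m ≠ l → 0 ≤ bary m x
  · exact indicator_sub_eq_integral_edgeDivergence_of_nonneg ha hkl hq hx hint
  · push Not at hx
    obtain ⟨m, hmk, hml, hm⟩ := hx
    have hnot (r : ℝ) : x + r • baryEdge k l ∉ simplexT d := fun hr =>
      (bary_nonneg hr m).not_gt (by rwa [bary_add_smul_baryEdge_of_ne hmk hml])
    simp only [indicator_of_notMem (hnot _), sub_zero, intervalIntegral.integral_zero]

theorem setIntegral_edgeDivergence {a : Option (Fin d) → ℝ} (ha : ∀ k, 0 < a k)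
    (k l : Option (Fin d)) (hq : ContDiffOn ℝ 1 q (simplexT d)) :
    ∫ x in simplexT d, edgeDivergence a k l q x = 0 := by
  rcases eq_or_ne k l with rfl | hkl
  · simp [edgeDivergence, edgeDeriv_self]
  have hq' := hq.continuousOn
  have hΦ : IntegrableOn (fun y => bary k y * bary l y * q y * dirichletDensity a y)
      (simplexT d) := integrableOn_mul_dirichletDensity ha (by fun_prop)
  rw [← integral_indicator measurableSet_simplexT]
  refine integral_eq_zero_of_sub_eq_integral_line (baryEdge k l)
    (hΦ.integrable_indicator measurableSet_simplexT)
    ((integrableOn_edgeDivergence ha k l hq).integrable_indicator measurableSet_simplexT)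
    fun x hx => ?_
  simpa only [one_smul, zero_smul, add_zero] using
    indicator_sub_eq_integral_edgeDivergence ha hkl hq x hx

end Edge

section EnergyForm

open Set Filter Topology

variable {d : ℕ}

/-- The linear form `x_i - x_j` of a pair `i < j`. -/
def pairDiff (p : OrderedPair d) : (Fin d → ℝ) →L[ℝ] ℝ :=
  ContinuousLinearMap.proj (R := ℝ) (φ := fun _ : Fin d => ℝ) p.1.1 - ContinuousLinearMap.proj p.1.2

@[simp] lemma pairDiff_apply (p : OrderedPair d) (x : Fin d → ℝ) :
    pairDiff p x = x p.1.1 - x p.1.2 := rfl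

lemma abs_pairDiff_le_one {x : Fin d → ℝ} (hx : x ∈ simplexT d) (p : OrderedPair d) :
    |pairDiff p x| ≤ 1 := by
  have hi (i : Fin d) : 0 ≤ x i ∧ x i ≤ 1 := ⟨bary_nonneg hx (some i), bary_le_one hx (some i)⟩
  rw [pairDiff_apply, abs_le]
  constructor <;> linarith [hi p.1.1, hi p.1.2]

/-- The regularization `∏ (|x_i - x_j|² + ε)^(κ/2)` of the factor `∏ |x_i - x_j|^κ`. For `ε = 0` the
two agree off the hyperplanes `x_i = x_j`. -/
noncomputable def pairWeight (κ ε : ℝ) (x : Fin d → ℝ) : ℝ :=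
  Real.exp (κ / 2 * ∑ p : OrderedPair d, Real.log (pairDiff p x ^ 2 + ε))

lemma pairWeight_pos (κ ε : ℝ) (x : Fin d → ℝ) : 0 < pairWeight κ ε x := Real.exp_pos _

@[fun_prop]
lemma measurable_pairWeight (κ ε : ℝ) : Measurable (pairWeight (d := d) κ ε) := by
  unfold pairWeight
  fun_prop

lemma pairWeight_le {κ ε : ℝ} (hκ : 0 ≤ κ) (hε : 0 ≤ ε) (hε' : ε ≤ 1) {x : Fin d → ℝ}
    (hx : x ∈ simplexT d) :
    pairWeight κ ε x ≤ Real.exp (κ / 2 * ∑ _p : OrderedPair d, Real.log 2) := by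
  refine Real.exp_le_exp.2 (mul_le_mul_of_nonneg_left (Finset.sum_le_sum fun p _ => ?_)
    (by positivity))
  have hsq : pairDiff p x ^ 2 ≤ 1 := (sq_le_one_iff_abs_le_one _).2 (abs_pairDiff_le_one hx p)
  rcases (add_nonneg (sq_nonneg (pairDiff p x)) hε).eq_or_lt with h | h
  · rw [← h, Real.log_zero]
    exact Real.log_nonneg one_le_two
  · exact Real.log_le_log h (by linarith)

lemma sum_orderedPair_comp_perm (g : ℝ → ℝ → ℝ) (hg : ∀ s t, g s t = g t s)
    (τ : Equiv.Perm (Fin d)) (x : Fin d → ℝ) :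
    ∑ p : OrderedPair d, g (x (τ p.1.1)) (x (τ p.1.2)) =
      ∑ p : OrderedPair d, g (x p.1.1) (x p.1.2) := by
  have hdouble (y : Fin d → ℝ) : 2 * ∑ p : OrderedPair d, g (y p.1.1) (y p.1.2) =
      ∑ k, ∑ l, if k = l then 0 else g (y k) (y l) := by
    rw [← sum_orderedPair_add_swap _ fun i => by simp, Finset.mul_sum]
    refine Finset.sum_congr rfl fun p _ => ?_
    rw [if_neg p.2.ne, if_neg p.2.ne', hg (y p.1.2), two_mul]
  have hperm : (∑ k, ∑ l, if k = l then 0 else g (x (τ k)) (x (τ l))) =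
      ∑ k, ∑ l, if k = l then 0 else g (x k) (x l) := by
    rw [← Equiv.sum_comp τ fun k => ∑ l, if k = l then 0 else g (x k) (x l)]
    refine Finset.sum_congr rfl fun k _ => ?_
    rw [← Equiv.sum_comp τ fun l => if τ k = l then 0 else g (x (τ k)) (x l)]
    simp only [τ.injective.eq_iff]
  exact mul_left_cancel₀ two_ne_zero ((hdouble (x ∘ τ)).trans (hperm.trans (hdouble x).symm))

lemma pairWeight_comp_perm (κ ε : ℝ) (τ : Equiv.Perm (Fin d)) (x : Fin d → ℝ) :
    pairWeight κ ε (x ∘ τ) = pairWeight κ ε x := by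
  simp only [pairWeight, pairDiff_apply, Function.comp_apply]
  rw [sum_orderedPair_comp_perm (fun s t => Real.log ((s - t) ^ 2 + ε))]
  intro s t
  rw [← neg_sub, neg_sq]

lemma hasFDerivAt_pairWeight (κ : ℝ) {ε : ℝ} (hε : 0 < ε) (x : Fin d → ℝ) :
    HasFDerivAt (pairWeight κ ε) ((pairWeight κ ε x * κ) •
      ∑ p : OrderedPair d, (pairDiff p x / (pairDiff p x ^ 2 + ε)) • pairDiff p) x := by
  have hpos (p : OrderedPair d) : pairDiff p x ^ 2 + ε ≠ 0 := by positivity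
  have hlog := HasFDerivAt.fun_sum (u := Finset.univ) fun (p : OrderedPair d) _ =>
    ((((pairDiff p).hasFDerivAt (x := x)).pow 2).add_const ε).log (hpos p)
  refine (hlog.const_mul (κ / 2)).exp.congr_fderiv ?_
  simp only [pairWeight, mul_smul]
  congr 1
  rw [Finset.smul_sum, Finset.smul_sum]
  refine Finset.sum_congr rfl fun p _ => ?_
  rw [smul_smul, smul_smul, smul_smul]
  congr 1
  push_cast
  ring

lemma contDiff_pairWeight (κ : ℝ) {ε : ℝ} (hε : 0 < ε) {n : WithTop ℕ∞} :
    ContDiff ℝ n (pairWeight (d := d) κ ε) := by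
  refine Real.contDiff_exp.comp (contDiff_const.mul (ContDiff.sum fun p _ => ContDiff.log ?_ ?_))
  · exact ((pairDiff p).contDiff.pow 2).add contDiff_const
  · intro x
    positivity

lemma comp_perm_mem_simplexT_iff (τ : Equiv.Perm (Fin d)) {x : Fin d → ℝ} :
    x ∘ τ ∈ simplexT d ↔ x ∈ simplexT d :=
  and_congr (τ.forall_congr_right (q := fun i => 0 ≤ x i))
    (by simp only [Function.comp_apply, Equiv.sum_comp τ fun i => |x i|])

/-- The difference of `F` and of its composition with the transposition of a pair of coordinates. -/
def swapDiff (p : OrderedPair d) (F : (Fin d → ℝ) → ℝ) (x : Fin d → ℝ) : ℝ :=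
  F x - F (x ∘ Equiv.swap p.1.1 p.1.2)

lemma continuousOn_swapDiff {F : (Fin d → ℝ) → ℝ} (hF : ContinuousOn F (simplexT d))
    (p : OrderedPair d) : ContinuousOn (swapDiff p F) (simplexT d) :=
  hF.sub (hF.comp (continuous_comp_swap _ _).continuousOn
    fun _ hx => (comp_perm_mem_simplexT_iff _).2 hx)

lemma norm_sub_comp_swap_le (p : OrderedPair d) (x : Fin d → ℝ) :
    ‖x - x ∘ Equiv.swap p.1.1 p.1.2‖ ≤ |pairDiff p x| := by
  rw [pi_norm_le_iff_of_nonneg (abs_nonneg _)]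
  intro m
  rw [Real.norm_eq_abs, Pi.sub_apply, Function.comp_apply, pairDiff_apply, Equiv.swap_apply_def]
  split_ifs with h1 h2
  · rw [h1]
  · rw [h2, abs_sub_comm]
  · simp

lemma exists_abs_swapDiff_le {F : (Fin d → ℝ) → ℝ} (hF : ContDiffOn ℝ 1 F (simplexT d)) :
    ∃ C, 0 ≤ C ∧ ∀ p : OrderedPair d, ∀ x ∈ simplexT d, |swapDiff p F x| ≤ C * |pairDiff p x| := by
  obtain ⟨C, hC⟩ := isCompact_simplexT.exists_bound_of_continuousOn
    (hF.continuousOn_fderivWithin uniqueDiffOn_simplexT le_rfl)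
  have hC0 : 0 ≤ C := by
    obtain ⟨z, hz⟩ := openSimplex_nonempty (d := d)
    exact (norm_nonneg _).trans (hC z (openSimplex_subset hz))
  refine ⟨C, hC0, fun p x hx => ?_⟩
  refine (convex_simplexT.norm_image_sub_le_of_norm_fderivWithin_le
    (hF.differentiableOn one_ne_zero) hC ((comp_perm_mem_simplexT_iff _).2 hx) hx).trans ?_
  exact mul_le_mul_of_nonneg_left (norm_sub_comp_swap_le p x) hC0

/-- The contribution of a pair of coordinates to the carré du champ, regularized like
`pairWeight`. -/
noncomputable def swapCarre (p : OrderedPair d) (ε : ℝ) (F G : (Fin d → ℝ) → ℝ)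
    (x : Fin d → ℝ) : ℝ :=
  (x p.1.1 + x p.1.2) * (swapDiff p F x * swapDiff p G x) / (pairDiff p x ^ 2 + ε)

/-- The carré du champ of the operator `Δ^T`: half the defect in the Leibniz rule for a product. The
parameter `ε` regularizes its difference part, the operator itself belongs to `ε = 0`. -/
noncomputable def carre (κ ε : ℝ) (F G : (Fin d → ℝ) → ℝ) (x : Fin d → ℝ) : ℝ :=
  1 / 2 * ∑ k, ∑ l, bary k x * bary l x * (edgeDeriv k l F x * edgeDeriv k l G x) +
    κ / 4 * ∑ p : OrderedPair d, swapCarre p ε F G x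

lemma carre_comm (κ ε : ℝ) (F G : (Fin d → ℝ) → ℝ) (x : Fin d → ℝ) :
    carre κ ε F G x = carre κ ε G F x := by
  simp only [carre, swapCarre, mul_comm (edgeDeriv _ _ F x), mul_comm (swapDiff _ F x)]

lemma swapCarre_self_nonneg (p : OrderedPair d) {ε : ℝ} (hε : 0 ≤ ε) (F : (Fin d → ℝ) → ℝ)
    {x : Fin d → ℝ} (hx : x ∈ simplexT d) : 0 ≤ swapCarre p ε F F x :=
  div_nonneg (mul_nonneg (add_nonneg (hx.1 _) (hx.1 _)) (mul_self_nonneg _)) (by positivity)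

lemma half_sum_edgeDeriv_sq_le_carre {κ ε : ℝ} (hκ : 0 ≤ κ) (hε : 0 ≤ ε) (F : (Fin d → ℝ) → ℝ)
    {x : Fin d → ℝ} (hx : x ∈ simplexT d) :
    1 / 2 * ∑ k, ∑ l, bary k x * bary l x * (edgeDeriv k l F x * edgeDeriv k l F x) ≤
      carre κ ε F F x :=
  le_add_of_nonneg_right (mul_nonneg (by positivity)
    (Finset.sum_nonneg fun p _ => swapCarre_self_nonneg p hε F hx))

lemma carre_self_nonneg {κ ε : ℝ} (hκ : 0 ≤ κ) (hε : 0 ≤ ε) (F : (Fin d → ℝ) → ℝ)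
    {x : Fin d → ℝ} (hx : x ∈ simplexT d) : 0 ≤ carre κ ε F F x :=
  (mul_nonneg one_half_pos.le (Finset.sum_nonneg fun k _ => Finset.sum_nonneg fun l _ =>
    mul_nonneg (mul_nonneg (bary_nonneg hx k) (bary_nonneg hx l)) (mul_self_nonneg _))).trans
    (half_sum_edgeDeriv_sq_le_carre hκ hε F hx)

lemma edgeDeriv_fun_sub {F G : (Fin d → ℝ) → ℝ} (hF : DifferentiableOn ℝ F (simplexT d))
    (hG : DifferentiableOn ℝ G (simplexT d)) (k l : Option (Fin d)) {x : Fin d → ℝ}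
    (hx : x ∈ simplexT d) :
    edgeDeriv k l (fun y => F y - G y) x = edgeDeriv k l F x - edgeDeriv k l G x := by
  rw [edgeDeriv, fderivWithin_fun_sub (uniqueDiffOn_simplexT x hx) (hF x hx) (hG x hx)]
  rfl

lemma carre_sub_sub (κ ε : ℝ) {F G : (Fin d → ℝ) → ℝ} (hF : DifferentiableOn ℝ F (simplexT d))
    (hG : DifferentiableOn ℝ G (simplexT d)) {x : Fin d → ℝ} (hx : x ∈ simplexT d) :
    carre κ ε (fun y => F y - G y) (fun y => F y - G y) x =
      carre κ ε F F x - 2 * carre κ ε F G x + carre κ ε G G x := by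
  have hgrad (k l : Option (Fin d)) : bary k x * bary l x *
      (edgeDeriv k l (fun y => F y - G y) x * edgeDeriv k l (fun y => F y - G y) x) =
      bary k x * bary l x * (edgeDeriv k l F x * edgeDeriv k l F x) -
        2 * (bary k x * bary l x * (edgeDeriv k l F x * edgeDeriv k l G x)) +
        bary k x * bary l x * (edgeDeriv k l G x * edgeDeriv k l G x) := by
    rw [edgeDeriv_fun_sub hF hG k l hx]
    ring
  have hswap (p : OrderedPair d) : swapCarre p ε (fun y => F y - G y) (fun y => F y - G y) x =
      swapCarre p ε F F x - 2 * swapCarre p ε F G x + swapCarre p ε G G x := by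
    simp only [swapCarre, swapDiff]
    ring
  simp only [carre, hgrad, hswap, Finset.sum_add_distrib, Finset.sum_sub_distrib, ← Finset.mul_sum]
  ring

lemma exists_abs_swapCarre_le {F G : (Fin d → ℝ) → ℝ} (hF : ContDiffOn ℝ 1 F (simplexT d))
    (hG : ContDiffOn ℝ 1 G (simplexT d)) : ∃ C, ∀ p : OrderedPair d, ∀ ε, 0 ≤ ε →
      ∀ x ∈ simplexT d, |swapCarre p ε F G x| ≤ C := by
  obtain ⟨A, hA0, hA⟩ := exists_abs_swapDiff_le hF
  obtain ⟨B, hB0, hB⟩ := exists_abs_swapDiff_le hG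
  refine ⟨2 * (A * B), fun p ε hε x hx => ?_⟩
  have hsum : |x p.1.1 + x p.1.2| ≤ 2 := by
    have hi (i : Fin d) : 0 ≤ x i ∧ x i ≤ 1 := ⟨bary_nonneg hx (some i), bary_le_one hx (some i)⟩
    rw [abs_le]
    constructor <;> linarith [hi p.1.1, hi p.1.2]
  have hprod : |swapDiff p F x * swapDiff p G x| ≤ A * B * pairDiff p x ^ 2 := by
    rw [abs_mul, ← sq_abs (pairDiff p x)]
    refine (mul_le_mul (hA p x hx) (hB p x hx) (abs_nonneg _) (by positivity)).trans_eq ?_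
    ring
  have hratio : pairDiff p x ^ 2 / (pairDiff p x ^ 2 + ε) ≤ 1 :=
    div_le_one_of_le₀ (by linarith) (by positivity)
  calc |swapCarre p ε F G x|
      = |x p.1.1 + x p.1.2| * |swapDiff p F x * swapDiff p G x| / (pairDiff p x ^ 2 + ε) := by
        rw [swapCarre, abs_div, abs_mul, abs_of_nonneg (by positivity : 0 ≤ pairDiff p x ^ 2 + ε)]
    _ ≤ 2 * (A * B * pairDiff p x ^ 2) / (pairDiff p x ^ 2 + ε) := by gcongr
    _ = 2 * (A * B) * (pairDiff p x ^ 2 / (pairDiff p x ^ 2 + ε)) := by ring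
    _ ≤ 2 * (A * B) := mul_le_of_le_one_right (by positivity) hratio

lemma continuousOn_gradCarre {F G : (Fin d → ℝ) → ℝ} (hF : ContDiffOn ℝ 1 F (simplexT d))
    (hG : ContDiffOn ℝ 1 G (simplexT d)) : ContinuousOn (fun x => 1 / 2 * ∑ k, ∑ l,
      bary k x * bary l x * (edgeDeriv k l F x * edgeDeriv k l G x)) (simplexT d) := by
  have hF' := continuousOn_edgeDeriv hF
  have hG' := continuousOn_edgeDeriv hG
  fun_prop

lemma exists_abs_carre_le {κ : ℝ} (hκ : 0 ≤ κ) {F G : (Fin d → ℝ) → ℝ}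
    (hF : ContDiffOn ℝ 1 F (simplexT d)) (hG : ContDiffOn ℝ 1 G (simplexT d)) :
    ∃ C, ∀ ε, 0 ≤ ε → ∀ x ∈ simplexT d, |carre κ ε F G x| ≤ C := by
  obtain ⟨A, hA⟩ := isCompact_simplexT.exists_bound_of_continuousOn (continuousOn_gradCarre hF hG)
  obtain ⟨B, hB⟩ := exists_abs_swapCarre_le hF hG
  refine ⟨A + κ / 4 * ∑ _p : OrderedPair d, B, fun ε hε x hx => ?_⟩
  refine (abs_add_le _ _).trans (add_le_add (hA x hx) ?_)
  rw [abs_mul, abs_of_nonneg (by positivity : (0 : ℝ) ≤ κ / 4)]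
  gcongr
  exact (Finset.abs_sum_le_sum_abs _ _).trans (Finset.sum_le_sum fun p _ => hB p ε hε x hx)

lemma aestronglyMeasurable_carre (κ ε : ℝ) {F G : (Fin d → ℝ) → ℝ}
    (hF : ContDiffOn ℝ 1 F (simplexT d)) (hG : ContDiffOn ℝ 1 G (simplexT d)) :
    AEStronglyMeasurable (carre κ ε F G) (volume.restrict (simplexT d)) := by
  refine ((continuousOn_gradCarre hF hG).aestronglyMeasurable measurableSet_simplexT).add
    (aestronglyMeasurable_const.mul (Finset.aestronglyMeasurable_fun_sum _ fun p _ => ?_))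
  have hnum : ContinuousOn (fun x => (x p.1.1 + x p.1.2) * (swapDiff p F x * swapDiff p G x))
      (simplexT d) := by
    have hF' := continuousOn_swapDiff hF.continuousOn p
    have hG' := continuousOn_swapDiff hG.continuousOn p
    fun_prop
  have hden : Measurable fun x => (pairDiff p x ^ 2 + ε)⁻¹ := by fun_prop
  exact (hnum.aestronglyMeasurable measurableSet_simplexT).mul hden.aestronglyMeasurable

end EnergyForm

section EdgePolynomial

open MvPolynomial

variable {d : ℕ}

/-- The derivative of a polynomial in the direction of a vertex of the simplex. -/
noncomputable def vertexDeriv (k : Option (Fin d)) :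
    MvPolynomial (Fin d) ℝ →ₗ[ℝ] MvPolynomial (Fin d) ℝ :=
  k.elim 0 fun i => (pderiv i).toLinearMap

@[simp] lemma vertexDeriv_none (P : MvPolynomial (Fin d) ℝ) : vertexDeriv none P = 0 := rfl

@[simp] lemma vertexDeriv_some (i : Fin d) (P : MvPolynomial (Fin d) ℝ) :
    vertexDeriv (some i) P = pderiv i P := rfl

lemma fderiv_eval_baryVertex (P : MvPolynomial (Fin d) ℝ) (x : Fin d → ℝ) (k : Option (Fin d)) :
    fderiv ℝ (fun z => eval z P) x (baryVertex k) = eval x (vertexDeriv k P) := by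
  rw [(hasFDerivAt_eval P x).fderiv]
  cases k with
  | none => simp [baryVertex]
  | some i => simp [baryVertex, Pi.single_apply]

lemma edgeDeriv_eval (P : MvPolynomial (Fin d) ℝ) {x : Fin d → ℝ} (hx : x ∈ simplexT d)
    (k l : Option (Fin d)) :
    edgeDeriv k l (fun z => eval z P) x = eval x (vertexDeriv k P) - eval x (vertexDeriv l P) := by
  rw [edgeDeriv, fderivWithin_eq_fderiv (uniqueDiffOn_simplexT x hx)
    (hasFDerivAt_eval P x).differentiableAt, baryEdge, map_sub, fderiv_eval_baryVertex,
    fderiv_eval_baryVertex]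

lemma sum_bary_mul_vertexDeriv (P : MvPolynomial (Fin d) ℝ) (x : Fin d → ℝ) :
    ∑ k, bary k x * eval x (vertexDeriv k P) = eval x (eulerPoly (Fin d) ℝ P) := by
  simp [Fintype.sum_option, eval_eulerPoly]

lemma half_sum_mul_sub_mul_sub {ι : Type*} [Fintype ι] (y u w : ι → ℝ) (hy : ∑ k, y k = 1) :
    1 / 2 * ∑ k, ∑ l, y k * y l * ((u k - u l) * (w k - w l)) =
      ∑ k, y k * (u k * w k) - (∑ k, y k * u k) * ∑ k, y k * w k := by
  have h (k l : ι) : y k * y l * ((u k - u l) * (w k - w l)) =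
      (y k * (u k * w k)) * y l + y k * (y l * (u l * w l)) - (y k * u k) * (y l * w l) -
        (y k * w k) * (y l * u l) := by ring
  simp only [h, Finset.sum_sub_distrib, Finset.sum_add_distrib, ← Finset.mul_sum,
    ← Finset.sum_mul, hy]
  ring

lemma half_sum_antisymm_mul_sub {ι : Type*} [Fintype ι] (y a u : ι → ℝ) (hy : ∑ k, y k = 1) :
    1 / 2 * ∑ k, ∑ l, (a k * y l - a l * y k) * (u k - u l) =
      ∑ k, a k * u k - (∑ k, a k) * ∑ k, y k * u k := by
  have h (k l : ι) : (a k * y l - a l * y k) * (u k - u l) =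
      (a k * u k) * y l + y k * (a l * u l) - (y k * u k) * a l - a k * (y l * u l) := by ring
  simp only [h, Finset.sum_sub_distrib, Finset.sum_add_distrib, ← Finset.mul_sum,
    ← Finset.sum_mul, hy]
  ring

lemma eval_eulerPoly_eulerPoly (P : MvPolynomial (Fin d) ℝ) (x : Fin d → ℝ) :
    eval x (eulerPoly (Fin d) ℝ (eulerPoly (Fin d) ℝ P)) = eval x (eulerPoly (Fin d) ℝ P) +
      ∑ i, ∑ j, x i * x j * eval x (pderiv i (pderiv j P)) := by
  rw [eval_eulerPoly, eval_eulerPoly, ← Finset.sum_add_distrib]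
  refine Finset.sum_congr rfl fun i _ => ?_
  simp only [eulerPoly_apply, map_sum, Derivation.leibniz, pderiv_X, smul_eq_mul, map_add, map_mul,
    eval_X, Pi.single_apply, Finset.sum_add_distrib,
    mul_ite, mul_one, mul_zero, Finset.sum_ite_eq', Finset.mem_univ, if_true, mul_add,
    Finset.mul_sum]
  rw [add_comm]
  simp only [mul_assoc]

lemma half_sum_edge_secondOrder (a : Option (Fin d) → ℝ) (P : MvPolynomial (Fin d) ℝ)
    (x : Fin d → ℝ) :
    1 / 2 * ∑ k, ∑ l, (bary k x * bary l x *
        (eval x (vertexDeriv k (vertexDeriv k P - vertexDeriv l P)) -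
          eval x (vertexDeriv l (vertexDeriv k P - vertexDeriv l P))) +
      (a k * bary l x - a l * bary k x) *
        (eval x (vertexDeriv k P) - eval x (vertexDeriv l P))) = eval x (lapPoly a 0 P) := by
  have h (k l : Option (Fin d)) : bary k x * bary l x *
        (eval x (vertexDeriv k (vertexDeriv k P - vertexDeriv l P)) -
          eval x (vertexDeriv l (vertexDeriv k P - vertexDeriv l P))) =
      (bary k x * eval x (vertexDeriv k (vertexDeriv k P))) * bary l x +
      bary k x * (bary l x * eval x (vertexDeriv l (vertexDeriv l P))) -
      bary k x * bary l x * eval x (vertexDeriv k (vertexDeriv l P)) -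
      bary l x * bary k x * eval x (vertexDeriv l (vertexDeriv k P)) := by
    simp only [map_sub]
    ring
  have hcomm : ∑ k, ∑ l, bary l x * bary k x * eval x (vertexDeriv l (vertexDeriv k P)) =
      ∑ k, ∑ l, bary k x * bary l x * eval x (vertexDeriv k (vertexDeriv l P)) := Finset.sum_comm
  simp only [Finset.sum_add_distrib, mul_add (1 / 2 : ℝ)]
  rw [half_sum_antisymm_mul_sub (fun k => bary k x) a (fun k => eval x (vertexDeriv k P))
    (sum_bary x), sum_bary_mul_vertexDeriv]
  simp only [h, Finset.sum_sub_distrib, Finset.sum_add_distrib, hcomm, ← Finset.mul_sum,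
    ← Finset.sum_mul, sum_bary]
  simp only [lapPoly_apply, lamParam, Fintype.sum_option, bary_none, bary_some, vertexDeriv_none,
    vertexDeriv_some, map_zero, mul_zero, zero_add, Finset.sum_const_zero, map_add, map_sub,
    map_sum, map_mul, eval_X, smul_eval, eval_eulerPoly_eulerPoly, Finset.sum_add_distrib, zero_div,
    zero_mul, add_zero]
  ring

lemma half_sum_edge_pairDiff (P : MvPolynomial (Fin d) ℝ) (p : OrderedPair d) (x : Fin d → ℝ) :
    1 / 2 * ∑ k, ∑ l, bary k x * bary l x *
        ((eval x (vertexDeriv k P) - eval x (vertexDeriv l P)) * pairDiff p (baryEdge k l)) =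
      eval x (eulerDiff ℝ p.1.1 p.1.2 P) - pairDiff p x * eval x (eulerPoly (Fin d) ℝ P) := by
  simp only [baryEdge, map_sub]
  rw [half_sum_mul_sub_mul_sub (fun k => bary k x) (fun k => eval x (vertexDeriv k P))
    (fun k => pairDiff p (baryVertex k)) (sum_bary x), sum_bary_mul_vertexDeriv]
  simp only [Fintype.sum_option, vertexDeriv_none, vertexDeriv_some, bary_some, pairDiff_apply,
    baryVertex, Option.elim, Pi.zero_apply, map_zero, mul_zero, zero_add,
    Pi.single_apply, mul_sub, Finset.sum_sub_distrib, mul_ite, mul_one, Finset.sum_ite_eq,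
    Finset.mem_univ, if_true, eulerDiff_apply, map_sub, map_mul, eval_X]
  ring

end EdgePolynomial

section GreenIdentity

open Set Filter Topology MvPolynomial

variable {d : ℕ}

/-- The function of Green's identity for `F` and `P`, whose integral against the weight vanishes. It
is regularized like `pairWeight`. -/
noncomputable def greenIntegrand (a : Option (Fin d) → ℝ) (κ ε : ℝ) (F : (Fin d → ℝ) → ℝ)
    (P : MvPolynomial (Fin d) ℝ) (x : Fin d → ℝ) : ℝ :=
  carre κ ε F (fun z => eval z P) x + F x * (eval x (lapPoly a 0 P) +
    κ / 2 * ∑ p : OrderedPair d, pairDiff p x ^ 2 / (pairDiff p x ^ 2 + ε) *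
      (eval x (pairOp p.1.1 p.1.2 P) - 2 * eval x (eulerPoly (Fin d) ℝ P)))

/-- The contribution of a pair of coordinates to a flux. It is antisymmetric under the transposition
of the pair, so it integrates to zero against every function that is symmetric. -/
noncomputable def pairFlux (p : OrderedPair d) (ε : ℝ) (G : (Fin d → ℝ) → ℝ) (x : Fin d → ℝ) : ℝ :=
  (x p.1.1 + x p.1.2) * swapDiff p G x / (pairDiff p x ^ 2 + ε)

/-- The regularization of the weight `∏ (bary k)^(a k - 1) ∏ |x_i - x_j|^κ`. -/
noncomputable def regWeight (a : Option (Fin d) → ℝ) (κ ε : ℝ) (x : Fin d → ℝ) : ℝ :=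
  pairWeight κ ε x * dirichletDensity a x

lemma edgeDeriv_pairWeight_mul (κ : ℝ) {ε : ℝ} (hε : 0 < ε) {F : (Fin d → ℝ) → ℝ}
    (hF : DifferentiableOn ℝ F (simplexT d)) (Q : MvPolynomial (Fin d) ℝ) {x : Fin d → ℝ}
    (hx : x ∈ simplexT d) (k l : Option (Fin d)) :
    edgeDeriv k l (fun y => pairWeight κ ε y * (F y * eval y Q)) x =
      pairWeight κ ε x * (F x * (eval x (vertexDeriv k Q) - eval x (vertexDeriv l Q)) +
        edgeDeriv k l F x * eval x Q + F x * eval x Q * (κ * ∑ p : OrderedPair d,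
          pairDiff p x / (pairDiff p x ^ 2 + ε) * pairDiff p (baryEdge k l))) := by
  have hQ := ((hasFDerivAt_eval Q x).differentiableAt.differentiableWithinAt
    (s := simplexT d)).hasFDerivWithinAt
  have h := (hasFDerivAt_pairWeight κ hε x).hasFDerivWithinAt.fun_mul
    ((hF x hx).hasFDerivWithinAt.fun_mul hQ)
  rw [← edgeDeriv_eval Q hx, edgeDeriv, h.fderivWithin (uniqueDiffOn_simplexT x hx)]
  simp only [edgeDeriv, add_apply, smul_apply, sum_apply, smul_eq_mul]
  ring

lemma edgeDivergence_pairWeight_mul (a : Option (Fin d) → ℝ) (κ : ℝ) {ε : ℝ} (hε : 0 < ε)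
    {F : (Fin d → ℝ) → ℝ} (hF : DifferentiableOn ℝ F (simplexT d)) (P : MvPolynomial (Fin d) ℝ)
    {x : Fin d → ℝ} (hx : x ∈ simplexT d) (k l : Option (Fin d)) :
    edgeDivergence a k l
        (fun y => pairWeight κ ε y * (F y * eval y (vertexDeriv k P - vertexDeriv l P))) x =
      (bary k x * bary l x * (edgeDeriv k l F x * edgeDeriv k l (fun z => eval z P) x) +
        F x * (bary k x * bary l x *
          (eval x (vertexDeriv k (vertexDeriv k P - vertexDeriv l P)) -
            eval x (vertexDeriv l (vertexDeriv k P - vertexDeriv l P))) +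
          (a k * bary l x - a l * bary k x) *
          (eval x (vertexDeriv k P) - eval x (vertexDeriv l P))) +
        F x * κ * ∑ p : OrderedPair d, pairDiff p x / (pairDiff p x ^ 2 + ε) *
          (bary k x * bary l x *
            ((eval x (vertexDeriv k P) - eval x (vertexDeriv l P)) *
              pairDiff p (baryEdge k l)))) * regWeight a κ ε x := by
  have hsum : ∑ p : OrderedPair d, pairDiff p x / (pairDiff p x ^ 2 + ε) * (bary k x * bary l x *
        ((eval x (vertexDeriv k P) - eval x (vertexDeriv l P)) * pairDiff p (baryEdge k l))) =
      bary k x * bary l x * (eval x (vertexDeriv k P) - eval x (vertexDeriv l P)) *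
        ∑ p : OrderedPair d, pairDiff p x / (pairDiff p x ^ 2 + ε) * pairDiff p (baryEdge k l) := by
    rw [Finset.mul_sum]
    exact Finset.sum_congr rfl fun p _ => by ring
  rw [edgeDivergence, edgeDeriv_pairWeight_mul κ hε hF _ hx, edgeDeriv_eval P hx, hsum, regWeight,
    map_sub (eval x)]
  ring

lemma half_sum_edgeDivergence_pairWeight_mul (a : Option (Fin d) → ℝ) (κ : ℝ) {ε : ℝ} (hε : 0 < ε)
    {F : (Fin d → ℝ) → ℝ} (hF : DifferentiableOn ℝ F (simplexT d)) (P : MvPolynomial (Fin d) ℝ)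
    {x : Fin d → ℝ} (hx : x ∈ simplexT d) :
    1 / 2 * ∑ k, ∑ l, edgeDivergence a k l
        (fun y => pairWeight κ ε y * (F y * eval y (vertexDeriv k P - vertexDeriv l P))) x =
      (1 / 2 * ∑ k, ∑ l,
          bary k x * bary l x * (edgeDeriv k l F x * edgeDeriv k l (fun z => eval z P) x) +
        F x * (eval x (lapPoly a 0 P) +
          κ * ∑ p : OrderedPair d, pairDiff p x / (pairDiff p x ^ 2 + ε) *
            (eval x (eulerDiff ℝ p.1.1 p.1.2 P) -
              pairDiff p x * eval x (eulerPoly (Fin d) ℝ P)))) * regWeight a κ ε x := by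
  have hcomm (c : OrderedPair d → ℝ) (f : OrderedPair d → Option (Fin d) → Option (Fin d) → ℝ) :
      ∑ k, ∑ l, ∑ p, c p * f p k l = ∑ p, c p * ∑ k, ∑ l, f p k l := by
    simp only [Finset.mul_sum]
    exact (Finset.sum_congr rfl fun _ _ => Finset.sum_comm).trans Finset.sum_comm
  simp only [edgeDivergence_pairWeight_mul a κ hε hF P hx, ← half_sum_edge_secondOrder,
    ← half_sum_edge_pairDiff, ← Finset.sum_mul]
  rw [← mul_assoc]
  congr 1
  simp only [Finset.sum_add_distrib, ← Finset.mul_sum, hcomm, mul_left_comm _ (1 / 2 : ℝ)]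
  ring

lemma pairDiff_div_mul_eulerDiff_sub {ε : ℝ} (hε : 0 < ε) (P : MvPolynomial (Fin d) ℝ)
    (p : OrderedPair d) (x : Fin d → ℝ) :
    pairDiff p x / (pairDiff p x ^ 2 + ε) * (eval x (eulerDiff ℝ p.1.1 p.1.2 P) -
        pairDiff p x * eval x (eulerPoly (Fin d) ℝ P)) =
      1 / 2 * (pairDiff p x ^ 2 / (pairDiff p x ^ 2 + ε) *
          (eval x (pairOp p.1.1 p.1.2 P) - 2 * eval x (eulerPoly (Fin d) ℝ P))) +
        1 / 2 * pairFlux p ε (fun z => eval z P) x := by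
  have hpairOp := congrArg (eval x) (sq_mul_pairOp p.1.1 p.1.2 P)
  simp only [map_mul, map_sub, map_add, map_pow, eval_X, eval_rename, map_ofNat] at hpairOp
  have hne : pairDiff p x ^ 2 + ε ≠ 0 := by positivity
  rw [pairFlux, swapDiff]
  field_simp
  rw [pairDiff_apply]
  linear_combination -hpairOp

lemma swapCarre_eq_swapDiff_mul_pairFlux (p : OrderedPair d) (ε : ℝ) (F G : (Fin d → ℝ) → ℝ)
    (x : Fin d → ℝ) : swapCarre p ε F G x = swapDiff p F x * pairFlux p ε G x := by
  rw [swapCarre, pairFlux]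
  ring

lemma greenIntegrand_mul_regWeight (a : Option (Fin d) → ℝ) (κ : ℝ) {ε : ℝ} (hε : 0 < ε)
    {F : (Fin d → ℝ) → ℝ} (hF : DifferentiableOn ℝ F (simplexT d)) (P : MvPolynomial (Fin d) ℝ)
    {x : Fin d → ℝ} (hx : x ∈ simplexT d) :
    greenIntegrand a κ ε F P x * regWeight a κ ε x =
      1 / 2 * ∑ k, ∑ l, edgeDivergence a k l
        (fun y => pairWeight κ ε y * (F y * eval y (vertexDeriv k P - vertexDeriv l P))) x -
      κ / 4 * ∑ p : OrderedPair d, (F x + F (x ∘ Equiv.swap p.1.1 p.1.2)) *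
        pairFlux p ε (fun z => eval z P) x * regWeight a κ ε x := by
  have hpair (p : OrderedPair d) : swapCarre p ε F (fun z => eval z P) x =
      2 * (F x * pairFlux p ε (fun z => eval z P) x) -
        (F x + F (x ∘ Equiv.swap p.1.1 p.1.2)) * pairFlux p ε (fun z => eval z P) x := by
    rw [swapCarre_eq_swapDiff_mul_pairFlux, swapDiff]
    ring
  rw [half_sum_edgeDivergence_pairWeight_mul a κ hε hF P hx, ← Finset.sum_mul]
  simp only [greenIntegrand, carre, hpair, pairDiff_div_mul_eulerDiff_sub hε,
    Finset.sum_add_distrib, Finset.sum_sub_distrib, ← Finset.mul_sum]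
  ring

lemma regWeight_nonneg (a : Option (Fin d) → ℝ) (κ ε : ℝ) {x : Fin d → ℝ} (hx : x ∈ simplexT d) :
    0 ≤ regWeight a κ ε x :=
  mul_nonneg (pairWeight_pos κ ε x).le (dirichletDensity_nonneg a hx)

lemma measurable_regWeight (a : Option (Fin d) → ℝ) (κ ε : ℝ) : Measurable (regWeight a κ ε) :=
  (measurable_pairWeight κ ε).mul (measurable_dirichletDensity a)

lemma bary_comp_perm (τ : Equiv.Perm (Fin d)) (x : Fin d → ℝ) (k : Option (Fin d)) :
    bary k (x ∘ τ) = bary (k.map τ) x := by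
  cases k with
  | none => simp [Equiv.sum_comp τ x]
  | some m => rfl

lemma regWeight_comp_perm {a : Option (Fin d) → ℝ} (ha : ∀ i j, a (some i) = a (some j)) (κ ε : ℝ)
    (τ : Equiv.Perm (Fin d)) (x : Fin d → ℝ) : regWeight a κ ε (x ∘ τ) = regWeight a κ ε x := by
  rw [regWeight, regWeight, pairWeight_comp_perm, dirichletDensity, dirichletDensity]
  congr 1
  simp only [bary_comp_perm, Fintype.prod_option, Option.map_none, Option.map_some]
  congr 1
  refine Fintype.prod_equiv τ _ _ fun m => ?_
  rw [ha m (τ m)]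

lemma setIntegral_simplexT_eq_zero_of_antisymm (i j : Fin d) {g : (Fin d → ℝ) → ℝ}
    (hg : ∀ x, g (x ∘ Equiv.swap i j) = -g x) : ∫ x in simplexT d, g x = 0 := by
  have h := (measurePreserving_comp_swap i j).setIntegral_preimage_emb
    (measurableEmbedding_comp_swap i j) g (simplexT d)
  rw [show (fun x : Fin d → ℝ => x ∘ Equiv.swap i j) ⁻¹' simplexT d = simplexT d from
    Set.ext fun _ => comp_perm_mem_simplexT_iff _] at h
  simp only [hg, integral_neg] at h
  linarith

lemma pairFlux_comp_swap (p : OrderedPair d) (ε : ℝ) (G : (Fin d → ℝ) → ℝ) (x : Fin d → ℝ) :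
    pairFlux p ε G (x ∘ Equiv.swap p.1.1 p.1.2) = -pairFlux p ε G x := by
  simp only [pairFlux, swapDiff, involutive_comp_swap p.1.1 p.1.2 x, pairDiff_apply,
    Function.comp_apply, Equiv.swap_apply_left, Equiv.swap_apply_right]
  rw [← neg_sub (x p.1.1), neg_sq]
  ring

lemma continuousOn_pairFlux (p : OrderedPair d) {ε : ℝ} (hε : 0 < ε) {G : (Fin d → ℝ) → ℝ}
    (hG : ContinuousOn G (simplexT d)) : ContinuousOn (pairFlux p ε G) (simplexT d) := by
  have hnum := continuousOn_swapDiff hG p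
  exact ContinuousOn.div (by fun_prop) (by fun_prop) fun x _ => by positivity

lemma setIntegral_greenIntegrand_of_pos {a : Option (Fin d) → ℝ} (ha : ∀ k, 0 < a k) {κ ε : ℝ}
    (hsym : κ = 0 ∨ ∀ i j, a (some i) = a (some j)) (hε : 0 < ε)
    {F : (Fin d → ℝ) → ℝ} (hF : ContDiffOn ℝ 1 F (simplexT d)) (P : MvPolynomial (Fin d) ℝ) :
    ∫ x in simplexT d, greenIntegrand a κ ε F P x * regWeight a κ ε x = 0 := by
  have hq (k l : Option (Fin d)) : ContDiffOn ℝ 1 (fun y => pairWeight κ ε y *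
      (F y * eval y (vertexDeriv k P - vertexDeriv l P))) (simplexT d) :=
    (contDiff_pairWeight κ hε).contDiffOn.mul (hF.mul (contDiff_eval _).contDiffOn)
  have hedge (k l : Option (Fin d)) := integrableOn_edgeDivergence ha k l (hq k l)
  have hflux (p : OrderedPair d) : IntegrableOn (fun x => (F x + F (x ∘ Equiv.swap p.1.1 p.1.2)) *
      pairFlux p ε (fun z => eval z P) x * regWeight a κ ε x) (simplexT d) := by
    have hcont : ContinuousOn (fun x => (F x + F (x ∘ Equiv.swap p.1.1 p.1.2)) *
        pairFlux p ε (fun z => eval z P) x * pairWeight κ ε x) (simplexT d) :=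
      ((hF.continuousOn.add (hF.continuousOn.comp (continuous_comp_swap _ _).continuousOn
        fun _ hx => (comp_perm_mem_simplexT_iff _).2 hx)).mul
        (continuousOn_pairFlux p hε (continuous_eval P).continuousOn)).mul
        (contDiff_pairWeight κ hε (n := 0)).continuous.continuousOn
    simpa only [regWeight, mul_assoc] using integrableOn_mul_dirichletDensity ha hcont
  rw [setIntegral_congr_fun measurableSet_simplexT fun x hx =>
      greenIntegrand_mul_regWeight a κ hε (hF.differentiableOn one_ne_zero) P hx,
    integral_sub ((integrable_finsetSum _ fun k _ => integrable_finsetSum _ fun l _ =>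
      hedge k l).const_mul _) ((integrable_finsetSum _ fun p _ => hflux p).const_mul _),
    integral_const_mul, integral_const_mul,
    integral_finsetSum _ fun k _ => integrable_finsetSum _ fun l _ => hedge k l,
    integral_finsetSum _ fun p _ => hflux p]
  simp only [integral_finsetSum _ fun l _ => hedge _ l, setIntegral_edgeDivergence ha _ _ (hq _ _),
    Finset.sum_const_zero, mul_zero, zero_sub, neg_eq_zero]
  rcases hsym with rfl | hsym
  · simp
  · refine mul_eq_zero_of_right _ (Finset.sum_eq_zero fun p _ =>
      setIntegral_simplexT_eq_zero_of_antisymm p.1.1 p.1.2 fun x => ?_)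
    have hinv : (x ∘ Equiv.swap p.1.1 p.1.2) ∘ Equiv.swap p.1.1 p.1.2 = x :=
      involutive_comp_swap _ _ x
    rw [pairFlux_comp_swap, regWeight_comp_perm hsym, hinv]
    ring

lemma exists_abs_greenIntegrand_le (a : Option (Fin d) → ℝ) {κ : ℝ} (hκ : 0 ≤ κ)
    {F : (Fin d → ℝ) → ℝ} (hF : ContDiffOn ℝ 1 F (simplexT d)) (P : MvPolynomial (Fin d) ℝ) :
    ∃ C, ∀ ε, 0 ≤ ε → ∀ x ∈ simplexT d, |greenIntegrand a κ ε F P x| ≤ C := by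
  obtain ⟨A, hA⟩ := exists_abs_carre_le hκ hF (contDiff_eval P).contDiffOn
  obtain ⟨B, hB⟩ := isCompact_simplexT.exists_bound_of_continuousOn hF.continuousOn
  obtain ⟨L, hL⟩ := isCompact_simplexT.exists_bound_of_continuousOn
    (continuous_eval (lapPoly a 0 P)).continuousOn
  choose R hR using fun p : OrderedPair d =>
    isCompact_simplexT.exists_bound_of_continuousOn (f := fun x =>
      eval x (pairOp p.1.1 p.1.2 P) - 2 * eval x (eulerPoly (Fin d) ℝ P))
      ((continuous_eval _).sub (continuous_const.mul (continuous_eval _))).continuousOn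
  refine ⟨A + B * (L + κ / 2 * ∑ p, R p), fun ε hε x hx => ?_⟩
  refine (abs_add_le _ _).trans (add_le_add (hA ε hε x hx) ?_)
  rw [abs_mul]
  refine mul_le_mul (hB x hx) ?_ (abs_nonneg _) ((norm_nonneg _).trans (hB x hx))
  refine (abs_add_le _ _).trans (add_le_add (hL x hx) ?_)
  rw [abs_mul, abs_of_nonneg (by positivity : 0 ≤ κ / 2)]
  gcongr
  refine (Finset.abs_sum_le_sum_abs _ _).trans (Finset.sum_le_sum fun p _ => ?_)
  have hratio : pairDiff p x ^ 2 / (pairDiff p x ^ 2 + ε) ≤ 1 :=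
    div_le_one_of_le₀ (by linarith) (by positivity)
  rw [abs_mul, abs_of_nonneg (by positivity)]
  exact (mul_le_of_le_one_left (abs_nonneg _) hratio).trans (hR p x hx)

lemma aestronglyMeasurable_greenIntegrand (a : Option (Fin d) → ℝ) (κ ε : ℝ)
    {F : (Fin d → ℝ) → ℝ} (hF : ContDiffOn ℝ 1 F (simplexT d)) (P : MvPolynomial (Fin d) ℝ) :
    AEStronglyMeasurable (greenIntegrand a κ ε F P) (volume.restrict (simplexT d)) := by
  have hpoly (Q : MvPolynomial (Fin d) ℝ) : Measurable fun x : Fin d → ℝ => eval x Q :=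
    (continuous_eval Q).measurable
  exact (aestronglyMeasurable_carre κ ε hF (contDiff_eval P).contDiffOn).add
    ((hF.continuousOn.aestronglyMeasurable measurableSet_simplexT).mul
      (Measurable.aestronglyMeasurable (by fun_prop)))

lemma sq_pairDiff_ne_zero {x : Fin d → ℝ} (hx : Function.Injective x) (p : OrderedPair d) :
    pairDiff p x ^ 2 ≠ 0 :=
  pow_ne_zero 2 (sub_ne_zero.2 (hx.ne p.2.ne))

lemma greenIntegrand_zero (a : Option (Fin d) → ℝ) (κ : ℝ) (F : (Fin d → ℝ) → ℝ)
    (P : MvPolynomial (Fin d) ℝ) {x : Fin d → ℝ} (hx : Function.Injective x) :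
    greenIntegrand a κ 0 F P x =
      carre κ 0 F (fun z => eval z P) x + F x * eval x (lapPoly a κ P) := by
  have hratio (p : OrderedPair d) : pairDiff p x ^ 2 / (pairDiff p x ^ 2 + 0) = 1 := by
    rw [add_zero, div_self (sq_pairDiff_ne_zero hx p)]
  rw [greenIntegrand, lapPoly_apply, lapPoly_apply, lamParam, lamParam]
  simp only [hratio, one_mul, Finset.sum_sub_distrib, map_sub, map_add, map_sum, map_mul, eval_X,
    smul_eval, Finset.sum_const, Finset.card_univ, nsmul_eq_mul]
  ring

lemma continuousAt_greenIntegrand_mul_regWeight (a : Option (Fin d) → ℝ) (κ : ℝ)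
    (F : (Fin d → ℝ) → ℝ) (P : MvPolynomial (Fin d) ℝ) {x : Fin d → ℝ}
    (hx : Function.Injective x) :
    ContinuousAt (fun ε => greenIntegrand a κ ε F P x * regWeight a κ ε x) 0 := by
  have hne (p : OrderedPair d) : pairDiff p x ^ 2 + 0 ≠ 0 := by
    rw [add_zero]
    exact sq_pairDiff_ne_zero hx p
  unfold greenIntegrand regWeight carre swapCarre pairWeight
  fun_prop (disch := exact hne _)

theorem setIntegral_carre_add_mul_lapPoly {a : Option (Fin d) → ℝ} (ha : ∀ k, 0 < a k)
    {κ : ℝ} (hκ : 0 ≤ κ) (hsym : κ = 0 ∨ ∀ i j, a (some i) = a (some j)) {F : (Fin d → ℝ) → ℝ}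
    (hF : ContDiffOn ℝ 1 F (simplexT d)) (P : MvPolynomial (Fin d) ℝ) :
    ∫ x in simplexT d, (carre κ 0 F (fun z => eval z P) x + F x * eval x (lapPoly a κ P)) *
      regWeight a κ 0 x = 0 := by
  obtain ⟨C, hC⟩ := exists_abs_greenIntegrand_le a hκ hF P
  let M : ℝ := Real.exp (κ / 2 * ∑ _p : OrderedPair d, Real.log 2)
  let ε (n : ℕ) : ℝ := 1 / (n + 1)
  have hε (n : ℕ) : 0 < ε n := Nat.one_div_pos_of_nat
  have hε' (n : ℕ) : ε n ≤ 1 := div_le_one_of_le₀ (by linarith [n.cast_nonneg (α := ℝ)])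
    (by positivity)
  have hinj : ∀ᵐ x ∂volume.restrict (simplexT d), Function.Injective x :=
    ae_restrict_of_ae ae_injective
  have hbound (n : ℕ) : ∀ᵐ x ∂volume.restrict (simplexT d),
      ‖greenIntegrand a κ (ε n) F P x * regWeight a κ (ε n) x‖ ≤ C * M * dirichletDensity a x := by
    filter_upwards [ae_restrict_mem measurableSet_simplexT] with x hx
    rw [Real.norm_eq_abs, abs_mul, abs_of_nonneg (regWeight_nonneg a κ _ hx), regWeight,
      ← mul_assoc]
    have hCx := hC _ (hε n).le x hx
    exact mul_le_mul_of_nonneg_right (mul_le_mul hCx (pairWeight_le hκ (hε n).le (hε' n) hx)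
      (pairWeight_pos _ _ _).le ((abs_nonneg _).trans hCx)) (dirichletDensity_nonneg a hx)
  have hzero (n : ℕ) := setIntegral_greenIntegrand_of_pos ha hsym (hε n) hF P
  have hlim := tendsto_integral_of_dominated_convergence
    (F := fun n x => greenIntegrand a κ (ε n) F P x * regWeight a κ (ε n) x)
    (f := fun x => greenIntegrand a κ 0 F P x * regWeight a κ 0 x)
    (fun x => C * M * dirichletDensity a x)
    (fun n => (aestronglyMeasurable_greenIntegrand a κ (ε n) hF P).mul
      (measurable_regWeight a κ (ε n)).aestronglyMeasurable)
    ((integrableOn_dirichletDensity ha).const_mul _) hbound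
    (hinj.mono fun x hx => (continuousAt_greenIntegrand_mul_regWeight a κ F P hx).tendsto.comp
      tendsto_one_div_add_atTop_nhds_zero_nat)
  simp only [hzero] at hlim
  refine (integral_congr_ae ?_).trans (tendsto_nhds_unique hlim tendsto_const_nhds)
  filter_upwards [hinj] with x hx
  rw [greenIntegrand_zero a κ F P hx]

end GreenIdentity

section WeightMeasure

open Set Filter Topology MvPolynomial

variable {d : ℕ}

lemma pairWeight_zero (κ : ℝ) {x : Fin d → ℝ} (hx : Function.Injective x) :
    pairWeight κ 0 x = ∏ p : OrderedPair d, |x p.1.1 - x p.1.2| ^ κ := by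
  rw [pairWeight, Finset.mul_sum, Real.exp_sum]
  refine Finset.prod_congr rfl fun p _ => ?_
  have hpos : 0 < |x p.1.1 - x p.1.2| := abs_pos.2 (sub_ne_zero.2 (hx.ne p.2.ne))
  rw [Real.rpow_def_of_pos hpos, add_zero, pairDiff_apply, Real.log_pow, Real.log_abs]
  congr 1
  push_cast
  ring

lemma eq_zero_of_ae_eval_eq_zero {P : MvPolynomial (Fin d) ℝ}
    (h : ∀ᵐ x ∂volume.restrict (simplexT d), eval x P = 0) : P = 0 := by
  have hopen : EqOn (fun x => eval x P) 0 (openSimplex d) :=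
    Measure.eqOn_open_of_ae_eq (ae_restrict_of_ae_restrict_of_subset openSimplex_subset h)
      isOpen_openSimplex (continuous_eval P).continuousOn continuousOn_const
  obtain ⟨x, hx⟩ := openSimplex_nonempty (d := d)
  obtain ⟨ε, hε, hball⟩ := Metric.isOpen_iff.1 isOpen_openSimplex x hx
  refine funext_set (fun i => Metric.ball (x i) ε)
    (fun i => (Real.ball_eq_Ioo (x i) ε ▸ Ioo_infinite (by linarith))) fun y hy => ?_
  rw [map_zero]
  exact hopen (hball (ball_pi x hε ▸ hy))

namespace SimplexWeight

variable (w : SimplexWeight d)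

lemma expo_pos (k : Option (Fin d)) : 0 < w.expo k := by
  cases w <;> cases k <;> simp only [expo, Option.elim] <;> positivity

lemma pairExpo_nonneg : 0 ≤ w.pairExpo := by
  cases w <;> simp [pairExpo]

lemma pairExpo_eq_zero_or : w.pairExpo = 0 ∨ ∀ i j, w.expo (some i) = w.expo (some j) := by
  cases w with
  | signChange κ => exact Or.inl rfl
  | hyperoctahedral κ' κ μ => exact Or.inr fun _ _ => rfl

lemma weight_eq {x : Fin d → ℝ} (hx : x ∈ simplexT d) (hx' : Function.Injective x) :
    w.weight x = regWeight w.expo w.pairExpo 0 x := by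
  have habs : ∑ i, |x i| = ∑ i, x i := Finset.sum_congr rfl fun i _ => abs_of_nonneg (hx.1 i)
  have hhalf (c : ℝ) : c + 1 / 2 - 1 = c - 1 / 2 := by ring
  rw [regWeight, pairWeight_zero _ hx', dirichletDensity, Fintype.prod_option]
  cases w with
  | signChange κ =>
    simp only [weight, expo, pairExpo, habs, bary_none, bary_some, Option.elim, Real.rpow_zero,
      Finset.prod_const_one, one_mul, hhalf]
    exact mul_comm _ _
  | hyperoctahedral κ' κ μ =>
    simp only [weight, expo, pairExpo, habs, bary_none, bary_some, Option.elim, hhalf]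
    ring

lemma measure_eq : w.measure = (volume.restrict (simplexT d)).withDensity
    fun x => ENNReal.ofReal (regWeight w.expo w.pairExpo 0 x) := by
  refine withDensity_congr_ae ?_
  filter_upwards [ae_restrict_of_ae ae_injective, ae_restrict_mem measurableSet_simplexT]
    with x hinj hx
  rw [w.weight_eq hx hinj]

lemma measure_absolutelyContinuous : w.measure ≪ volume.restrict (simplexT d) :=
  withDensity_absolutelyContinuous _ _

lemma absolutelyContinuous_measure : volume.restrict (simplexT d) ≪ w.measure := by
  rw [measure_eq]
  refine withDensity_absolutelyContinuous'
    (measurable_regWeight _ _ _).ennreal_ofReal.aemeasurable ?_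
  filter_upwards [ae_restrict_simplexT_mem_openSimplex] with x hx
  exact (ENNReal.ofReal_pos.2
    (mul_pos (pairWeight_pos _ _ _) (dirichletDensity_pos _ hx))).ne'

lemma ae_mem_simplexT : ∀ᵐ x ∂w.measure, x ∈ simplexT d :=
  w.measure_absolutelyContinuous.ae_le (ae_restrict_mem measurableSet_simplexT)

instance isFiniteMeasure_measure : IsFiniteMeasure w.measure := by
  rw [measure_eq]
  refine isFiniteMeasure_withDensity_ofReal (Integrable.hasFiniteIntegral ?_)
  refine (integrableOn_dirichletDensity w.expo_pos).bdd_mul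
    (c := Real.exp (w.pairExpo / 2 * ∑ _p : OrderedPair d, Real.log 2))
    (measurable_pairWeight _ _).aestronglyMeasurable ?_
  filter_upwards [ae_restrict_mem measurableSet_simplexT] with x hx
  rw [Real.norm_of_nonneg (pairWeight_pos _ _ _).le]
  exact pairWeight_le w.pairExpo_nonneg le_rfl zero_le_one hx

lemma integral_measure (g : (Fin d → ℝ) → ℝ) : ∫ x, g x ∂w.measure =
    ∫ x in simplexT d, g x * regWeight w.expo w.pairExpo 0 x := by
  rw [measure_eq, integral_withDensity_eq_integral_toReal_smul
    (measurable_regWeight _ _ _).ennreal_ofReal (ae_of_all _ fun _ => ENNReal.ofReal_lt_top)]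
  refine setIntegral_congr_fun measurableSet_simplexT fun x hx => ?_
  simp only [smul_eq_mul]
  rw [ENNReal.toReal_ofReal (regWeight_nonneg _ _ _ hx), mul_comm]

lemma memLp_of_continuousOn {E : Type*} [NormedAddCommGroup E] {f : (Fin d → ℝ) → E}
    (hf : ContinuousOn f (simplexT d)) (p : ENNReal) : MemLp f p w.measure := by
  obtain ⟨C, hC⟩ := isCompact_simplexT.exists_bound_of_continuousOn hf
  exact .of_bound ((hf.aestronglyMeasurable_of_isCompact isCompact_simplexT
    measurableSet_simplexT).mono_ac w.measure_absolutelyContinuous) C (w.ae_mem_simplexT.mono hC)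

lemma integrable_of_continuousOn {E : Type*} [NormedAddCommGroup E] {f : (Fin d → ℝ) → E}
    (hf : ContinuousOn f (simplexT d)) : Integrable f w.measure :=
  (w.memLp_of_continuousOn hf 1).integrable le_rfl

lemma integrable_carre {F G : (Fin d → ℝ) → ℝ} (hF : ContDiffOn ℝ 1 F (simplexT d))
    (hG : ContDiffOn ℝ 1 G (simplexT d)) : Integrable (carre w.pairExpo 0 F G) w.measure := by
  obtain ⟨C, hC⟩ := exists_abs_carre_le w.pairExpo_nonneg hF hG
  exact .of_bound ((aestronglyMeasurable_carre _ _ hF hG).mono_ac w.measure_absolutelyContinuous) C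
    (w.ae_mem_simplexT.mono (hC 0 le_rfl))

/-- The energy form of `-Δ^T`. -/
noncomputable def energy (F G : (Fin d → ℝ) → ℝ) : ℝ :=
  ∫ x, carre w.pairExpo 0 F G x ∂w.measure

/-- The operator `Δ^T` on polynomials. -/
noncomputable def polyLap : MvPolynomial (Fin d) ℝ →ₗ[ℝ] MvPolynomial (Fin d) ℝ :=
  lapPoly w.expo w.pairExpo

/-- The parameter `λ` of the operator `Δ^T`. -/
noncomputable def lam : ℝ := lamParam w.expo w.pairExpo

lemma energy_eval {F : (Fin d → ℝ) → ℝ} (hF : ContDiffOn ℝ 1 F (simplexT d))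
    (P : MvPolynomial (Fin d) ℝ) : w.energy F (fun z => eval z P) =
      -∫ x, F x * eval x (w.polyLap P) ∂w.measure := by
  have h :=
    setIntegral_carre_add_mul_lapPoly w.expo_pos w.pairExpo_nonneg w.pairExpo_eq_zero_or hF P
  have hFP : Integrable (fun x => F x * eval x (w.polyLap P)) w.measure :=
    w.integrable_of_continuousOn (hF.continuousOn.mul (continuous_eval _).continuousOn)
  rw [← w.integral_measure, ← polyLap,
    integral_add (w.integrable_carre hF (contDiff_eval P).contDiffOn) hFP] at h
  exact eq_neg_of_add_eq_zero_left h

lemma energy_self_nonneg (F : (Fin d → ℝ) → ℝ) : 0 ≤ w.energy F F :=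
  integral_nonneg_of_ae (w.ae_mem_simplexT.mono fun _ hx =>
    carre_self_nonneg w.pairExpo_nonneg le_rfl F hx)

lemma energy_comm (F G : (Fin d → ℝ) → ℝ) : w.energy F G = w.energy G F :=
  integral_congr_ae (ae_of_all _ fun x => carre_comm _ _ F G x)

lemma two_mul_energy_le {F G : (Fin d → ℝ) → ℝ} (hF : ContDiffOn ℝ 1 F (simplexT d))
    (hG : ContDiffOn ℝ 1 G (simplexT d)) :
    2 * w.energy F G ≤ w.energy F F + w.energy G G := by
  have hFF := w.integrable_carre hF hF
  have hFG := (w.integrable_carre hF hG).const_mul 2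
  have hFFG : Integrable (fun x => carre w.pairExpo 0 F F x - 2 * carre w.pairExpo 0 F G x)
      w.measure := hFF.sub hFG
  have hexpand : w.energy (fun y => F y - G y) (fun y => F y - G y) =
      w.energy F F - 2 * w.energy F G + w.energy G G := by
    unfold energy
    rw [← integral_const_mul, ← integral_sub hFF hFG,
      ← integral_add hFFG (w.integrable_carre hG hG)]
    exact integral_congr_ae (w.ae_mem_simplexT.mono fun x hx =>
      carre_sub_sub _ _ (hF.differentiableOn one_ne_zero) (hG.differentiableOn one_ne_zero) hx)
  linarith [w.energy_self_nonneg fun y => F y - G y]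

lemma ae_laplacian_eval_eq (P : MvPolynomial (Fin d) ℝ) :
    ∀ᵐ x ∂volume.restrict (simplexT d),
      w.laplacian (fun z => eval z P) x = eval x (w.polyLap P) := by
  filter_upwards [ae_restrict_of_ae ae_injective, ae_restrict_simplexT_mem_openSimplex]
    with x hinj hx
  exact w.laplacian_eval P (fun i => hx (some i)) hinj

lemma ae_laplacian_eigen_iff (P : MvPolynomial (Fin d) ℝ) (ν : ℝ) :
    (∀ᵐ x ∂volume.restrict (simplexT d),
        -w.laplacian (fun z => eval z P) x = ν * eval x P) ↔ -w.polyLap P = ν • P := by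
  refine ⟨fun h => sub_eq_zero.1 (eq_zero_of_ae_eval_eq_zero ?_), fun h => ?_⟩
  · filter_upwards [h, w.ae_laplacian_eval_eq P] with x hx hlap
    rw [map_sub, map_neg, smul_eval, ← hlap, hx, sub_self]
  · filter_upwards [w.ae_laplacian_eval_eq P] with x hlap
    rw [hlap, ← map_neg, h, smul_eval]

end SimplexWeight

end WeightMeasure

section RadialInequality

open MvPolynomial

variable {d : ℕ}

/-- The radial polynomial `|x| = ∑ x_i`; the energy form with this argument is the radial
derivative. -/
noncomputable def radialPoly (d : ℕ) : MvPolynomial (Fin d) ℝ := ∑ i, X i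

lemma eval_radialPoly (x : Fin d → ℝ) : eval x (radialPoly d) = 1 - bary none x := by
  simp [radialPoly]

lemma pderiv_radialPoly (i : Fin d) : pderiv i (radialPoly d) = 1 := by
  rw [radialPoly, map_sum, Finset.sum_eq_single_of_mem i (Finset.mem_univ i)
    fun j _ hj => pderiv_X_of_ne hj, pderiv_X_self]

lemma eulerPoly_radialPoly : eulerPoly (Fin d) ℝ (radialPoly d) = radialPoly d := by
  simp only [eulerPoly_apply, pderiv_radialPoly, mul_one]
  rfl

lemma rename_radialPoly (σ : Equiv.Perm (Fin d)) : rename σ (radialPoly d) = radialPoly d := by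
  simp only [radialPoly, map_sum, rename_X]
  exact Equiv.sum_comp σ fun i => X i

lemma pairOp_radialPoly {i j : Fin d} (hij : i ≠ j) : pairOp i j (radialPoly d) = 2 := by
  apply mul_left_cancel₀ (pow_ne_zero 2 (X_sub_X_ne_zero (R := ℝ) hij))
  rw [sq_mul_pairOp, eulerDiff_apply, pderiv_radialPoly, pderiv_radialPoly, rename_radialPoly]
  ring

lemma eval_lapPoly_radialPoly (a : Option (Fin d) → ℝ) (κ : ℝ) (x : Fin d → ℝ) :
    eval x (lapPoly a κ (radialPoly d)) = (lamParam a κ + 1) * bary none x - a none := by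
  have hpair (p : OrderedPair d) : pairOp p.1.1 p.1.2 (radialPoly d) = 2 :=
    pairOp_radialPoly p.2.ne
  simp only [lapPoly_apply, pderiv_radialPoly, hpair, eulerPoly_radialPoly, map_sub, map_add,
    map_sum, map_mul, smul_eval, eval_radialPoly, map_one, map_ofNat, map_natCast,
    Derivation.map_one_eq_zero, Finset.sum_const, Finset.card_univ, nsmul_eq_mul, mul_zero,
    zero_add, mul_one]
  rw [lamParam, Fintype.sum_option]
  ring

/-- The radial derivative `⟨x, ∇F⟩` on the simplex. -/
noncomputable def radialDeriv (F : (Fin d → ℝ) → ℝ) (x : Fin d → ℝ) : ℝ :=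
  fderivWithin ℝ F (simplexT d) x x

lemma continuousOn_radialDeriv {F : (Fin d → ℝ) → ℝ} (hF : ContDiffOn ℝ 1 F (simplexT d)) :
    ContinuousOn (radialDeriv F) (simplexT d) :=
  (hF.continuousOn_fderivWithin uniqueDiffOn_simplexT le_rfl).clm_apply continuousOn_id

lemma radialDeriv_sq {F : (Fin d → ℝ) → ℝ} (hF : DifferentiableOn ℝ F (simplexT d))
    {x : Fin d → ℝ} (hx : x ∈ simplexT d) :
    radialDeriv (fun y => F y ^ 2) x = 2 * (F x * radialDeriv F x) := by
  rw [radialDeriv, fderivWithin_fun_pow (uniqueDiffOn_simplexT x hx) 2 (hF x hx)]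
  simp [radialDeriv, mul_assoc]

lemma radialDeriv_eq_sum (F : (Fin d → ℝ) → ℝ) (x : Fin d → ℝ) : radialDeriv F x =
    ∑ k, bary k x * fderivWithin ℝ F (simplexT d) x (baryVertex k) := by
  conv_lhs =>
    rw [radialDeriv]
    arg 2
    rw [pi_eq_sum_univ' x]
  simp [Fintype.sum_option, baryVertex]

lemma carre_radialPoly (κ ε : ℝ) (F : (Fin d → ℝ) → ℝ) {x : Fin d → ℝ} (hx : x ∈ simplexT d) :
    carre κ ε F (fun z => eval z (radialPoly d)) x = bary none x * radialDeriv F x := by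
  have hswap (p : OrderedPair d) : swapCarre p ε F (fun z => eval z (radialPoly d)) x = 0 := by
    simp [swapCarre, swapDiff, ← eval_rename, rename_radialPoly]
  have hvertex : ∑ k, bary k x * (fderivWithin ℝ F (simplexT d) x (baryVertex k) *
      eval x (vertexDeriv k (radialPoly d))) = radialDeriv F x := by
    rw [radialDeriv_eq_sum]
    simp [Fintype.sum_option, pderiv_radialPoly, baryVertex]
  simp only [carre, hswap, Finset.sum_const_zero, mul_zero, add_zero, edgeDeriv_eval _ hx]
  simp only [edgeDeriv, baryEdge, map_sub]
  rw [half_sum_mul_sub_mul_sub _ _ _ (sum_bary x), hvertex, ← radialDeriv_eq_sum,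
    sum_bary_mul_vertexDeriv, eulerPoly_radialPoly, eval_radialPoly]
  ring

lemma bary_mul_sq_radialDeriv_le_carre {κ ε : ℝ} (hκ : 0 ≤ κ) (hε : 0 ≤ ε) (F : (Fin d → ℝ) → ℝ)
    {x : Fin d → ℝ} (hx : x ∈ simplexT d) :
    bary none x * radialDeriv F x ^ 2 ≤ carre κ ε F F x := by
  set t := bary none x
  set S := ∑ k, bary k x * (fderivWithin ℝ F (simplexT d) x (baryVertex k) *
    fderivWithin ℝ F (simplexT d) x (baryVertex k)) with hS
  have hcarre : S - radialDeriv F x * radialDeriv F x ≤ carre κ ε F F x := by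
    rw [radialDeriv_eq_sum, hS, ← half_sum_mul_sub_mul_sub _ _ _ (sum_bary x)]
    simp only [← map_sub]
    exact half_sum_edgeDeriv_sq_le_carre hκ hε F hx
  have hcauchy : radialDeriv F x ^ 2 ≤ (1 - t) * S := by
    have hsum : 1 - t = ∑ i, x i := by simp [t]
    rw [radialDeriv_eq_sum, hsum, hS, Fintype.sum_option, Fintype.sum_option]
    simp only [baryVertex, Option.elim, map_zero, mul_zero, zero_add, bary_some]
    exact Finset.sum_sq_le_sum_mul_sum_of_sq_le_mul _ (fun i _ => hx.1 i)
      (fun i _ => mul_nonneg (hx.1 i) (mul_self_nonneg _)) fun i _ => le_of_eq (by ring)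
  have ht : 0 ≤ t := bary_nonneg hx none
  have hSnonneg : 0 ≤ S := Finset.sum_nonneg fun k _ =>
    mul_nonneg (bary_nonneg hx k) (mul_self_nonneg _)
  calc t * radialDeriv F x ^ 2
      = (1 + t) * radialDeriv F x ^ 2 - radialDeriv F x * radialDeriv F x := by ring
    _ ≤ (1 + t) * ((1 - t) * S) - radialDeriv F x * radialDeriv F x := by gcongr
    _ = S - radialDeriv F x * radialDeriv F x - t ^ 2 * S := by ring
    _ ≤ S - radialDeriv F x * radialDeriv F x := sub_le_self _ (by positivity)
    _ ≤ carre κ ε F F x := hcarre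

namespace SimplexWeight

variable (w : SimplexWeight d)

lemma radial_identity {F : (Fin d → ℝ) → ℝ} (hF : ContDiffOn ℝ 1 F (simplexT d)) :
    w.expo none * ∫ x, F x ∂w.measure = (w.lam + 1) * ∫ x, bary none x * F x ∂w.measure +
      ∫ x, bary none x * radialDeriv F x ∂w.measure := by
  have hcarre : w.energy F (fun z => eval z (radialPoly d)) =
      ∫ x, bary none x * radialDeriv F x ∂w.measure :=
    integral_congr_ae (w.ae_mem_simplexT.mono fun x hx => carre_radialPoly _ _ F hx)
  have hlap : ∫ x, F x * eval x (w.polyLap (radialPoly d)) ∂w.measure =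
      (w.lam + 1) * (∫ x, bary none x * F x ∂w.measure) - w.expo none * ∫ x, F x ∂w.measure := by
    rw [← integral_const_mul, ← integral_const_mul, ← integral_sub]
    · congr 1 with x
      rw [polyLap, eval_lapPoly_radialPoly, lam]
      ring
    · exact (w.integrable_of_continuousOn
        ((continuous_bary none).continuousOn.mul hF.continuousOn)).const_mul _
    · exact (w.integrable_of_continuousOn hF.continuousOn).const_mul _
  have henergy := w.energy_eval hF (radialPoly d)
  rw [hcarre, hlap] at henergy
  linarith

theorem radial_inequality {F : (Fin d → ℝ) → ℝ} (hF : ContDiffOn ℝ 1 F (simplexT d)) {s : ℝ}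
    (hs : 0 < s) : w.expo none * ∫ x, F x ^ 2 ∂w.measure ≤
      (w.lam + 1 + s) * ∫ x, bary none x * F x ^ 2 ∂w.measure + s⁻¹ * w.energy F F := by
  have hF' := hF.continuousOn
  have hR := continuousOn_radialDeriv (hF.pow 2)
  have hsq : Integrable (fun x => bary none x * F x ^ 2) w.measure :=
    w.integrable_of_continuousOn (by fun_prop)
  have hamgm : ∫ x, bary none x * radialDeriv (fun y => F y ^ 2) x ∂w.measure ≤
      s * (∫ x, bary none x * F x ^ 2 ∂w.measure) + s⁻¹ * w.energy F F := by
    rw [energy, ← integral_const_mul, ← integral_const_mul,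
      ← integral_add (hsq.const_mul _) ((w.integrable_carre hF hF).const_mul _)]
    refine integral_mono_ae (w.integrable_of_continuousOn (by fun_prop))
      ((hsq.const_mul _).add ((w.integrable_carre hF hF).const_mul _))
      (w.ae_mem_simplexT.mono fun x hx => ?_)
    set R := radialDeriv F x
    have ht : 0 ≤ bary none x := bary_nonneg hx none
    calc bary none x * radialDeriv (fun y => F y ^ 2) x
        = s * (bary none x * F x ^ 2) + s⁻¹ * (bary none x * R ^ 2) -
            bary none x * s⁻¹ * (s * F x - R) ^ 2 := by
          rw [radialDeriv_sq (hF.differentiableOn one_ne_zero) hx]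
          field_simp
          ring
      _ ≤ s * (bary none x * F x ^ 2) + s⁻¹ * (bary none x * R ^ 2) :=
          sub_le_self _ (by positivity)
      _ ≤ s * (bary none x * F x ^ 2) + s⁻¹ * carre w.pairExpo 0 F F x := by
          gcongr
          exact bary_mul_sq_radialDeriv_le_carre w.pairExpo_nonneg le_rfl F hx
  rw [w.radial_identity (hF.pow 2)]
  linarith

end SimplexWeight

end RadialInequality

section EigenFiltration

open Filter Topology
open scoped InnerProductSpace

/-- A nonnegative symmetric operator `op` on a space `E`, densely embedded by `toH` in an inner
product space `H`, that acts on the `n`-th quotient of a filtration `filt` by finite dimensional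
subspaces as the scalar `eig n`. The orthogonal complements of `filt n` in `filt (n + 1)` are then
eigenspaces. -/
structure EigenFiltration (E H : Type*) [AddCommGroup E] [Module ℝ E] [NormedAddCommGroup H]
    [InnerProductSpace ℝ H] where
  toH : E →ₗ[ℝ] H
  op : E →ₗ[ℝ] E
  filt : ℕ → Submodule ℝ E
  eig : ℕ → ℝ
  injective : Function.Injective toH
  dense : DenseRange toH
  filt_zero : filt 0 = ⊥
  mono : Monotone filt
  finiteDimensional : ∀ n, FiniteDimensional ℝ (filt n)
  exists_mem : ∀ P, ∃ n, P ∈ filt n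
  op_sub_smul_mem : ∀ n P, P ∈ filt (n + 1) → op P - eig n • P ∈ filt n
  symm : ∀ P Q, ⟪toH (op P), toH Q⟫_ℝ = ⟪toH P, toH (op Q)⟫_ℝ
  eig_nonneg : ∀ n, 0 ≤ eig n

namespace EigenFiltration

variable {E H : Type*} [AddCommGroup E] [Module ℝ E] [NormedAddCommGroup H]
    [InnerProductSpace ℝ H] (S : EigenFiltration E H)

instance (n : ℕ) : FiniteDimensional ℝ (S.filt n) := S.finiteDimensional n

lemma op_mem {n : ℕ} {P : E} (hP : P ∈ S.filt n) : S.op P ∈ S.filt n := by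
  cases n with
  | zero =>
    rw [S.filt_zero, Submodule.mem_bot] at hP ⊢
    rw [hP, map_zero]
  | succ n =>
    have h := S.mono n.le_succ (S.op_sub_smul_mem n P hP)
    simpa using add_mem h (Submodule.smul_mem _ (S.eig n) hP)

lemma op_eq_smul {n : ℕ} {Q : E} (hQ : Q ∈ S.filt (n + 1))
    (h : ∀ R ∈ S.filt n, ⟪S.toH Q, S.toH R⟫_ℝ = 0) : S.op Q = S.eig n • Q := by
  have hR := S.op_sub_smul_mem n Q hQ
  suffices ⟪S.toH (S.op Q - S.eig n • Q), S.toH (S.op Q - S.eig n • Q)⟫_ℝ = 0 from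
    sub_eq_zero.1 ((map_eq_zero_iff _ S.injective).1 (inner_self_eq_zero.1 this))
  nth_rw 1 [map_sub, map_smul]
  rw [inner_sub_left, real_inner_smul_left, S.symm, h _ (S.op_mem hR), h _ hR, mul_zero, sub_zero]

section Projection

lemma exists_approx (h : H) (n : ℕ) : ∃ P ∈ S.filt n,
    S.toH P = ((S.filt n).map S.toH).starProjection h :=
  Submodule.mem_map.1 (((S.filt n).map S.toH).starProjection_apply_mem h)

/-- The orthogonal projection of `h` to the `n`-th space of the filtration. -/
noncomputable def approx (h : H) (n : ℕ) : E := (S.exists_approx h n).choose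

lemma approx_mem (h : H) (n : ℕ) : S.approx h n ∈ S.filt n := (S.exists_approx h n).choose_spec.1

lemma toH_approx (h : H) (n : ℕ) :
    S.toH (S.approx h n) = ((S.filt n).map S.toH).starProjection h :=
  (S.exists_approx h n).choose_spec.2

lemma inner_approx (h : H) {n : ℕ} {R : E} (hR : R ∈ S.filt n) :
    ⟪S.toH (S.approx h n), S.toH R⟫_ℝ = ⟪h, S.toH R⟫_ℝ := by
  refine (sub_eq_zero.1 ?_).symm
  rw [← inner_sub_left, toH_approx]
  exact Submodule.starProjection_inner_eq_zero _ _ (Submodule.mem_map_of_mem hR)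

lemma tendsto_toH_approx [CompleteSpace H] (h : H) :
    Tendsto (fun n => S.toH (S.approx h n)) atTop (𝓝 h) := by
  simp only [toH_approx]
  refine Submodule.starProjection_tendsto_self (fun n => (S.filt n).map S.toH)
    (fun m n hmn => Submodule.map_mono (S.mono hmn)) h fun x _ => closure_mono ?_ (S.dense x)
  rintro _ ⟨P, rfl⟩
  obtain ⟨n, hn⟩ := S.exists_mem P
  exact Submodule.mem_iSup_of_mem n (Submodule.mem_map_of_mem hn)

/-- The component of `h` in the `n`-th eigenspace. -/
noncomputable def comp (h : H) (n : ℕ) : E := S.approx h (n + 1) - S.approx h n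

lemma comp_mem (h : H) (n : ℕ) : S.comp h n ∈ S.filt (n + 1) :=
  sub_mem (S.approx_mem h _) (S.mono n.le_succ (S.approx_mem h _))

lemma inner_comp_eq_zero (h : H) {n : ℕ} {R : E} (hR : R ∈ S.filt n) :
    ⟪S.toH (S.comp h n), S.toH R⟫_ℝ = 0 := by
  rw [comp, map_sub, inner_sub_left, S.inner_approx h hR, S.inner_approx h (S.mono n.le_succ hR),
    sub_self]

lemma inner_comp (h : H) {n : ℕ} {Q : E} (hQ : Q ∈ S.filt (n + 1))
    (hQ' : ∀ R ∈ S.filt n, ⟪S.toH Q, S.toH R⟫_ℝ = 0) :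
    ⟪S.toH (S.comp h n), S.toH Q⟫_ℝ = ⟪h, S.toH Q⟫_ℝ := by
  rw [comp, map_sub, inner_sub_left, S.inner_approx h hQ,
    real_inner_comm _ (S.toH (S.approx h n)), hQ' _ (S.approx_mem h n), sub_zero]

lemma op_comp (h : H) (n : ℕ) : S.op (S.comp h n) = S.eig n • S.comp h n :=
  S.op_eq_smul (S.comp_mem h n) fun _ hR => S.inner_comp_eq_zero h hR

lemma sum_comp (h : H) (N : ℕ) : ∑ n ∈ Finset.range N, S.comp h n = S.approx h N := by
  have happrox_zero : S.approx h 0 = 0 := by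
    simpa only [S.filt_zero, Submodule.mem_bot] using S.approx_mem h 0
  simp only [comp]
  rw [Finset.sum_range_sub, happrox_zero, sub_zero]

lemma inner_comp_comp (h : H) {m n : ℕ} (hmn : m ≠ n) :
    ⟪S.toH (S.comp h m), S.toH (S.comp h n)⟫_ℝ = 0 := by
  rcases lt_or_gt_of_ne hmn with hlt | hlt
  · rw [real_inner_comm]
    exact S.inner_comp_eq_zero h (S.mono hlt (S.comp_mem h m))
  · exact S.inner_comp_eq_zero h (S.mono hlt (S.comp_mem h n))

lemma orthogonalFamily_comp (h : H) :
    OrthogonalFamily ℝ (fun n => ℝ ∙ S.toH (S.comp h n))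
      fun n => (ℝ ∙ S.toH (S.comp h n)).subtypeₗᵢ :=
  OrthogonalFamily.of_pairwise fun _ _ hmn => Submodule.isOrtho_span.2 <| by
    simpa using S.inner_comp_comp h hmn

lemma norm_sq_approx (h : H) (N : ℕ) :
    ‖S.toH (S.approx h N)‖ ^ 2 = ∑ n ∈ Finset.range N, ‖S.toH (S.comp h n)‖ ^ 2 := by
  rw [← S.sum_comp, map_sum]
  exact (S.orthogonalFamily_comp h).norm_sum
    (fun n => ⟨_, Submodule.mem_span_singleton_self _⟩) (Finset.range N)

lemma inner_op_approx (h : H) (N : ℕ) :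
    ⟪S.toH (S.op (S.approx h N)), S.toH (S.approx h N)⟫_ℝ =
      ∑ n ∈ Finset.range N, S.eig n * ‖S.toH (S.comp h n)‖ ^ 2 := by
  simp only [← S.sum_comp, map_sum, op_comp, map_smul]
  refine ((S.orthogonalFamily_comp h).inner_sum
    (fun n => S.eig n • ⟨_, Submodule.mem_span_singleton_self _⟩)
    (fun n => ⟨_, Submodule.mem_span_singleton_self _⟩) (Finset.range N)).trans ?_
  exact Finset.sum_congr rfl fun n _ => by
    rw [real_inner_smul_left, real_inner_self_eq_norm_sq, Submodule.coe_norm]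

end Projection

/-- `g` is the image of `f` under the square root of the operator. -/
def IsSqrt (f g : H) : Prop := ∀ (P : E) (ν : ℝ), S.op P = ν • P →
  ⟪g, S.toH P⟫_ℝ = √ν * ⟪f, S.toH P⟫_ℝ

variable {S}

lemma IsSqrt.comp_eq {f g : H} (h : S.IsSqrt f g) (n : ℕ) :
    S.comp g n = √(S.eig n) • S.comp f n := by
  set D := S.comp g n - √(S.eig n) • S.comp f n with hD
  have hmem : D ∈ S.filt (n + 1) :=
    sub_mem (S.comp_mem g n) (Submodule.smul_mem _ _ (S.comp_mem f n))
  have hinner : ∀ v, ⟪S.toH D, v⟫_ℝ =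
      ⟪S.toH (S.comp g n), v⟫_ℝ - √(S.eig n) * ⟪S.toH (S.comp f n), v⟫_ℝ := fun v => by
    rw [hD, map_sub, map_smul, inner_sub_left, real_inner_smul_left]
  have horth : ∀ R ∈ S.filt n, ⟪S.toH D, S.toH R⟫_ℝ = 0 := fun R hR => by
    rw [hinner, S.inner_comp_eq_zero g hR, S.inner_comp_eq_zero f hR, mul_zero, sub_zero]
  suffices ⟪S.toH D, S.toH D⟫_ℝ = 0 from
    sub_eq_zero.1 ((map_eq_zero_iff _ S.injective).1 (inner_self_eq_zero.1 this))
  rw [hinner, S.inner_comp g hmem horth, S.inner_comp f hmem horth,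
    h D _ (S.op_eq_smul hmem horth), sub_self]

lemma IsSqrt.inner_op_approx_le {f g : H} (h : S.IsSqrt f g) (N : ℕ) :
    ⟪S.toH (S.op (S.approx f N)), S.toH (S.approx f N)⟫_ℝ ≤ ‖g‖ ^ 2 := by
  calc ⟪S.toH (S.op (S.approx f N)), S.toH (S.approx f N)⟫_ℝ
      = ∑ n ∈ Finset.range N, ‖S.toH (S.comp g n)‖ ^ 2 := by
        rw [inner_op_approx]
        refine Finset.sum_congr rfl fun n _ => ?_
        rw [h.comp_eq, map_smul, norm_smul, mul_pow, Real.norm_eq_abs, sq_abs,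
          Real.sq_sqrt (S.eig_nonneg n)]
    _ = ‖S.toH (S.approx g N)‖ ^ 2 := (S.norm_sq_approx g N).symm
    _ ≤ ‖g‖ ^ 2 := by
        rw [toH_approx]
        gcongr
        exact Submodule.norm_starProjection_apply_le _ _

lemma IsSqrt.mul_norm_sq_le [CompleteSpace H] {f g : H} (h : S.IsSqrt f g)
    (hf : ∀ R ∈ S.filt 1, ⟪f, S.toH R⟫_ℝ = 0) {c : ℝ} (hc : ∀ n, 1 ≤ n → c ≤ S.eig n) :
    c * ‖f‖ ^ 2 ≤ ‖g‖ ^ 2 := by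
  have hcomp_zero : S.toH (S.comp f 0) = 0 := by
    rw [← inner_self_eq_zero (𝕜 := ℝ), S.inner_comp f (S.comp_mem f 0)
      fun R hR => S.inner_comp_eq_zero f hR, hf _ (S.comp_mem f 0)]
  refine le_of_tendsto' (((S.tendsto_toH_approx f).norm.pow 2).const_mul c) fun N => ?_
  refine le_trans ?_ (h.inner_op_approx_le N)
  rw [inner_op_approx, norm_sq_approx, Finset.mul_sum]
  refine Finset.sum_le_sum fun n _ => ?_
  rcases n.eq_zero_or_pos with rfl | hn
  · simp [hcomp_zero]
  · exact mul_le_mul_of_nonneg_right (hc n hn) (sq_nonneg _)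

variable (S)

lemma summable_sqrt_smul_comp [CompleteSpace H] {f : H} {B : ℝ}
    (hB : ∀ N, ⟪S.toH (S.op (S.approx f N)), S.toH (S.approx f N)⟫_ℝ ≤ B) :
    Summable fun n => √(S.eig n) • S.toH (S.comp f n) := by
  have hnorm : ∀ n, ‖√(S.eig n) • S.toH (S.comp f n)‖ ^ 2 =
      S.eig n * ‖S.toH (S.comp f n)‖ ^ 2 := fun n => by
    rw [norm_smul, mul_pow, Real.norm_eq_abs, sq_abs, Real.sq_sqrt (S.eig_nonneg n)]
  refine ((S.orthogonalFamily_comp f).summable_iff_norm_sq_summable fun n =>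
    ⟨_, Submodule.smul_mem _ √(S.eig n) (Submodule.mem_span_singleton_self _)⟩).2 ?_
  simp only [Submodule.coe_norm, hnorm]
  refine summable_of_sum_range_le (c := B)
    (fun n => mul_nonneg (S.eig_nonneg n) (sq_nonneg _)) fun N => ?_
  rw [← inner_op_approx]
  exact hB N

lemma sqrt_eig_mul_inner_comp (f : H) (n : ℕ) {P : E} {ν : ℝ} (hP : S.op P = ν • P) :
    √(S.eig n) * ⟪S.toH (S.comp f n), S.toH P⟫_ℝ = √ν * ⟪S.toH (S.comp f n), S.toH P⟫_ℝ := by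
  have hsymm := S.symm (S.comp f n) P
  rw [op_comp, hP, map_smul, map_smul, real_inner_smul_left, real_inner_smul_right] at hsymm
  rcases mul_eq_mul_right_iff.1 hsymm with heig | horth
  · rw [heig]
  · rw [horth, mul_zero, mul_zero]

lemma exists_isSqrt [CompleteSpace H] {f : H} {B : ℝ}
    (hB : ∀ N, ⟪S.toH (S.op (S.approx f N)), S.toH (S.approx f N)⟫_ℝ ≤ B) :
    ∃ g, S.IsSqrt f g := by
  refine ⟨∑' n, √(S.eig n) • S.toH (S.comp f n), fun P ν hP => ?_⟩
  have hsum := (S.summable_sqrt_smul_comp hB).hasSum.tendsto_sum_nat.inner (𝕜 := ℝ)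
    (tendsto_const_nhds (x := S.toH P))
  obtain ⟨m, hm⟩ := S.exists_mem P
  refine tendsto_nhds_unique hsum (tendsto_const_nhds.congr' ?_)
  filter_upwards [eventually_ge_atTop m] with N hN
  simp only [sum_inner, real_inner_smul_left, S.sqrt_eig_mul_inner_comp f _ hP]
  rw [← Finset.mul_sum, ← sum_inner, ← map_sum, sum_comp, S.inner_approx f (S.mono hN hm)]

end EigenFiltration

end EigenFiltration

section PolynomialDensity

open Set Filter Topology MvPolynomial
open scoped InnerProductSpace ENNReal

variable {d : ℕ}

/-- The algebra of polynomial functions on `ℝ^d`. -/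
noncomputable def polyFunctions (d : ℕ) : Subalgebra ℝ C(Fin d → ℝ, ℝ) :=
  (aeval fun i : Fin d => (⟨fun x => x i, continuous_apply i⟩ : C(Fin d → ℝ, ℝ))).range

lemma exists_eval_of_mem_polyFunctions {g : C(Fin d → ℝ, ℝ)} (hg : g ∈ polyFunctions d) :
    ∃ P : MvPolynomial (Fin d) ℝ, ∀ x, g x = eval x P := by
  obtain ⟨P, rfl⟩ := hg
  refine ⟨P, fun x => ?_⟩
  induction P using MvPolynomial.induction_on with
  | C a => simp
  | add p q hp hq => simp_all
  | mul_X p i hp => simp_all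

lemma separatesPoints_polyFunctions : (polyFunctions d).SeparatesPoints := by
  intro x y hxy
  obtain ⟨i, hi⟩ := Function.ne_iff.1 hxy
  refine ⟨_, ⟨⟨fun x => x i, continuous_apply i⟩, ⟨X i, ?_⟩, rfl⟩, hi⟩
  simp

lemma exists_eval_near {f : (Fin d → ℝ) → ℝ} (hf : Continuous f) {K : Set (Fin d → ℝ)}
    (hK : IsCompact K) {ε : ℝ} (hε : 0 < ε) :
    ∃ P : MvPolynomial (Fin d) ℝ, ∀ x ∈ K, |eval x P - f x| < ε := by
  obtain ⟨g, hg, hgf⟩ :=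
    ContinuousMap.exists_mem_subalgebra_near_continuous_of_isCompact_of_separatesPoints
      separatesPoints_polyFunctions ⟨f, hf⟩ hK hε
  obtain ⟨P, hP⟩ := exists_eval_of_mem_polyFunctions hg
  exact ⟨P, fun x hx => by simpa [hP] using hgf x hx⟩

namespace SimplexWeight

variable (w : SimplexWeight d)

lemma memLp_eval (P : MvPolynomial (Fin d) ℝ) (p : ℝ≥0∞) :
    MemLp (fun x => eval x P) p w.measure :=
  w.memLp_of_continuousOn P.continuous_eval.continuousOn p

/-- The class of a polynomial in `L²(W^T)`. -/
noncomputable def polyToL2 : MvPolynomial (Fin d) ℝ →ₗ[ℝ] Lp ℝ 2 w.measure where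
  toFun P := (w.memLp_eval P 2).toLp
  map_add' P Q := by
    rw [← MemLp.toLp_add]
    exact MemLp.toLp_congr _ _ (ae_of_all _ fun x => by simp)
  map_smul' c P := by
    rw [RingHom.id_apply, ← MemLp.toLp_const_smul]
    exact MemLp.toLp_congr _ _ (ae_of_all _ fun x => by simp)

lemma coeFn_polyToL2 (P : MvPolynomial (Fin d) ℝ) :
    w.polyToL2 P =ᵐ[w.measure] fun x => eval x P := (w.memLp_eval P 2).coeFn_toLp

lemma inner_polyToL2 (u : Lp ℝ 2 w.measure) (P : MvPolynomial (Fin d) ℝ) :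
    ⟪u, w.polyToL2 P⟫_ℝ = ∫ x, u x * eval x P ∂w.measure := by
  rw [L2.inner_def]
  refine integral_congr_ae ((w.coeFn_polyToL2 P).mono fun x hx => ?_)
  simp only [hx, RCLike.inner_apply, conj_trivial, mul_comm]

lemma inner_toLp_polyToL2 {u : (Fin d → ℝ) → ℝ} (hu : MemLp u 2 w.measure)
    (P : MvPolynomial (Fin d) ℝ) :
    ⟪hu.toLp u, w.polyToL2 P⟫_ℝ = ∫ x, u x * eval x P ∂w.measure := by
  rw [inner_polyToL2]
  exact integral_congr_ae (hu.coeFn_toLp.mono fun x hx => by simp only [hx])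

lemma injective_polyToL2 : Function.Injective w.polyToL2 := by
  rw [injective_iff_map_eq_zero]
  intro P hP
  refine eq_zero_of_ae_eval_eq_zero (w.absolutelyContinuous_measure.ae_le ?_)
  have hzero := hP ▸ w.coeFn_polyToL2 P
  exact hzero.symm.trans (Lp.coeFn_zero ℝ 2 w.measure)

lemma denseRange_polyToL2 : DenseRange w.polyToL2 := by
  refine Dense.of_closure (Dense.mono ?_ (BoundedContinuousFunction.toLp_denseRange ℝ w.measure ℝ
    (p := 2) ENNReal.ofNat_ne_top))
  rintro _ ⟨g, rfl⟩
  rw [Metric.mem_closure_iff]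
  intro ε hε
  set m := (w.measure univ).toReal ^ (2 : ℝ≥0∞).toReal⁻¹
  have : 0 ≤ m := by positivity
  obtain ⟨P, hP⟩ := exists_eval_near g.continuous isCompact_simplexT
    (ε := ε / (m + 1)) (by positivity)
  refine ⟨_, ⟨P, rfl⟩, ?_⟩
  rw [dist_comm, dist_eq_norm]
  calc ‖w.polyToL2 P - BoundedContinuousFunction.toLp 2 w.measure ℝ g‖ ≤ m * (ε / (m + 1)) := by
        refine Lp.norm_le_of_ae_bound (by positivity) ?_
        filter_upwards [w.coeFn_polyToL2 P, Lp.coeFn_sub (w.polyToL2 P)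
            (BoundedContinuousFunction.toLp 2 w.measure ℝ g),
          BoundedContinuousFunction.coeFn_toLp (𝕜 := ℝ) (p := 2) w.measure g,
          w.ae_mem_simplexT] with x hPx hsub hgx hx
        rw [hsub, Pi.sub_apply, hPx, hgx]
        exact (hP x hx).le
    _ < ε := by
        rw [mul_div_assoc', div_lt_iff₀ (by positivity)]
        linarith

lemma integral_eval_mul_polyLap_comm (P Q : MvPolynomial (Fin d) ℝ) :
    ∫ x, eval x P * eval x (w.polyLap Q) ∂w.measure =
      ∫ x, eval x Q * eval x (w.polyLap P) ∂w.measure := by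
  have hPQ := w.energy_eval (contDiff_eval P).contDiffOn Q
  have hQP := w.energy_eval (contDiff_eval Q).contDiffOn P
  rw [w.energy_comm] at hPQ
  linarith

lemma lam_add_one_pos : 0 < w.lam + 1 := by
  have hexpo : 0 < ∑ k, w.expo k :=
    Finset.sum_pos (fun k _ => w.expo_pos k) ⟨none, Finset.mem_univ _⟩
  have hpair : 0 ≤ w.pairExpo * Fintype.card (OrderedPair d) :=
    mul_nonneg w.pairExpo_nonneg (Nat.cast_nonneg _)
  rw [lam, lamParam]
  linarith

lemma lam_add_one_le_eigVal {n : ℕ} (hn : 1 ≤ n) :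
    w.lam + 1 ≤ eigVal w.expo w.pairExpo n := by
  have hlam := w.lam_add_one_pos
  have hn' : (1 : ℝ) ≤ n := by exact_mod_cast hn
  rw [eigVal, ← lam]
  nlinarith

lemma eigVal_nonneg (n : ℕ) : 0 ≤ eigVal w.expo w.pairExpo n := by
  rcases n.eq_zero_or_pos with rfl | hn
  · simp [eigVal]
  · exact w.lam_add_one_pos.le.trans (w.lam_add_one_le_eigVal hn)

/-- The polynomials filtered by degree in `L²(W^T)`, with the operator `-Δ^T`. -/
noncomputable def eigenFiltration :
    EigenFiltration (MvPolynomial (Fin d) ℝ) (Lp ℝ 2 w.measure) where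
  toH := w.polyToL2
  op := -w.polyLap
  filt := totalDegreeLT (Fin d) ℝ
  eig := eigVal w.expo w.pairExpo
  injective := w.injective_polyToL2
  dense := w.denseRange_polyToL2
  filt_zero := totalDegreeLT_zero
  mono := totalDegreeLT_mono
  finiteDimensional := fun n => finite_totalDegreeLT n
  exists_mem := exists_mem_totalDegreeLT
  op_sub_smul_mem := fun n P hP => by
    simpa only [polyLap, LinearMap.neg_apply, neg_add, ← sub_eq_add_neg] using
      neg_mem (lapPoly_add_smul_mem_totalDegreeLT w.expo w.pairExpo hP)
  symm := fun P Q => by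
    rw [real_inner_comm]
    simp only [LinearMap.neg_apply, map_neg, inner_neg_right]
    exact congrArg _ ((w.inner_toLp_polyToL2 (w.memLp_eval Q 2) _).trans
      ((w.integral_eval_mul_polyLap_comm Q P).trans
        (w.inner_toLp_polyToL2 (w.memLp_eval P 2) _).symm))
  eig_nonneg := w.eigVal_nonneg

end SimplexWeight

end PolynomialDensity

section RealValued

open Filter Topology MvPolynomial
open scoped InnerProductSpace ENNReal

variable {d : ℕ}

lemma continuous_integral_mul_sq {α : Type*} {m : MeasurableSpace α} {μ : Measure α} {φ : α → ℝ}
    (hφ : MemLp φ ∞ μ) : Continuous fun u : Lp ℝ 2 μ => ∫ x, φ x * u x ^ 2 ∂μ := by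
  let T := (ContinuousLinearMap.mul ℝ ℝ).holderL μ ∞ 2 2 hφ.toLp
  have hT : ∀ u : Lp ℝ 2 μ, ∫ x, φ x * u x ^ 2 ∂μ = ⟪u, T u⟫_ℝ := fun u => by
    rw [L2.inner_def]
    have hTu := (ContinuousLinearMap.mul ℝ ℝ).coeFn_holder (r := 2) hφ.toLp u
    refine integral_congr_ae ?_
    filter_upwards [hTu, hφ.coeFn_toLp] with x hTux hφx
    change _ = (ContinuousLinearMap.mul ℝ ℝ).holder 2 hφ.toLp u x * u x
    rw [hTux, hφx, ContinuousLinearMap.mul_apply']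
    ring
  simp only [hT]
  fun_prop

lemma norm_sq_eq_integral {α : Type*} {m : MeasurableSpace α} {μ : Measure α} (u : Lp ℝ 2 μ) :
    ‖u‖ ^ 2 = ∫ x, u x ^ 2 ∂μ := by
  rw [← real_inner_self_eq_norm_sq, L2.inner_def]
  simp

lemma norm_sq_toLp {α : Type*} {m : MeasurableSpace α} {μ : Measure α} {u : α → ℝ}
    (hu : MemLp u 2 μ) : ‖hu.toLp u‖ ^ 2 = ∫ x, u x ^ 2 ∂μ := by
  rw [norm_sq_eq_integral]
  exact integral_congr_ae (hu.coeFn_toLp.mono fun x hx => by simp only [hx])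

namespace SimplexWeight

variable (w : SimplexWeight d)

lemma inner_toLp_op_eq_energy {F : (Fin d → ℝ) → ℝ} (hF : ContDiffOn ℝ 1 F (simplexT d))
    (hF' : MemLp F 2 w.measure) (P : MvPolynomial (Fin d) ℝ) :
    ⟪hF'.toLp F, w.eigenFiltration.toH (w.eigenFiltration.op P)⟫_ℝ =
      w.energy F (fun z => eval z P) := by
  rw [w.energy_eval hF]
  refine (congrArg _ (map_neg w.polyToL2 (w.polyLap P))).trans ?_
  rw [inner_neg_right, inner_toLp_polyToL2]

lemma inner_op_eq_energy (P : MvPolynomial (Fin d) ℝ) :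
    ⟪w.eigenFiltration.toH (w.eigenFiltration.op P), w.eigenFiltration.toH P⟫_ℝ =
      w.energy (fun z => eval z P) (fun z => eval z P) :=
  (real_inner_comm _ _).trans
    (w.inner_toLp_op_eq_energy (contDiff_eval P).contDiffOn (w.memLp_eval P 2) P)

lemma exists_isSqrt_toLp {F : (Fin d → ℝ) → ℝ} (hF : ContDiffOn ℝ 1 F (simplexT d))
    (hF' : MemLp F 2 w.measure) : ∃ g, w.eigenFiltration.IsSqrt (hF'.toLp F) g := by
  refine w.eigenFiltration.exists_isSqrt (B := w.energy F F) fun N => ?_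
  set S := w.eigenFiltration
  set P := S.approx (hF'.toLp F) N
  have henergy := w.inner_op_eq_energy P
  have hmixed : ⟪S.toH P, S.toH (S.op P)⟫_ℝ = w.energy F (fun z => eval z P) := by
    rw [S.inner_approx _ (S.op_mem (S.approx_mem _ _)), w.inner_toLp_op_eq_energy hF]
  have hle := w.two_mul_energy_le hF (contDiff_eval P).contDiffOn
  rw [real_inner_comm] at hmixed
  linarith

theorem radial_inequality_of_isSqrt {u g : Lp ℝ 2 w.measure} (h : w.eigenFiltration.IsSqrt u g)
    {s : ℝ} (hs : 0 < s) : w.expo none * ‖u‖ ^ 2 ≤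
      (w.lam + 1 + s) * ∫ x, bary none x * u x ^ 2 ∂w.measure + s⁻¹ * ‖g‖ ^ 2 := by
  set S := w.eigenFiltration
  have hlim := S.tendsto_toH_approx u
  have hcont := continuous_integral_mul_sq
    (w.memLp_of_continuousOn (continuous_bary none).continuousOn ∞)
  refine le_of_tendsto_of_tendsto' ((hlim.norm.pow 2).const_mul _)
    ((((hcont.tendsto u).comp hlim).const_mul _).add_const _) fun N => ?_
  set P := S.approx u N
  have hbary : ∫ x, bary none x * S.toH P x ^ 2 ∂w.measure =
      ∫ x, bary none x * eval x P ^ 2 ∂w.measure :=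
    integral_congr_ae ((w.coeFn_polyToL2 P).mono fun x hx => congrArg (bary none x * · ^ 2) hx)
  have henergy := h.inner_op_approx_le N
  rw [w.inner_op_eq_energy] at henergy
  calc w.expo none * ‖S.toH P‖ ^ 2
      = w.expo none * ∫ x, eval x P ^ 2 ∂w.measure :=
        congrArg _ (norm_sq_toLp (w.memLp_eval P 2))
    _ ≤ (w.lam + 1 + s) * ∫ x, bary none x * eval x P ^ 2 ∂w.measure +
          s⁻¹ * w.energy (fun z => eval z P) (fun z => eval z P) :=
        w.radial_inequality (contDiff_eval P).contDiffOn hs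
    _ ≤ (w.lam + 1 + s) * ∫ x, bary none x * S.toH P x ^ 2 ∂w.measure + s⁻¹ * ‖g‖ ^ 2 := by
        rw [hbary]
        gcongr

theorem spectral_gap {u g : Lp ℝ 2 w.measure} (h : w.eigenFiltration.IsSqrt u g)
    (hu : ∫ x, u x ∂w.measure = 0) : (w.lam + 1) * ‖u‖ ^ 2 ≤ ‖g‖ ^ 2 := by
  refine h.mul_norm_sq_le (fun R hR => ?_) fun n hn => w.lam_add_one_le_eigVal hn
  obtain ⟨c, rfl⟩ : ∃ c, R = C c := by
    rcases eq_or_ne R 0 with rfl | hR0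
    · exact ⟨0, (map_zero C).symm⟩
    · exact ⟨_, totalDegree_eq_zero_iff_eq_C.1
        (Nat.lt_one_iff.1 (totalDegree_lt_of_mem_totalDegreeLT hR hR0))⟩
  refine (w.inner_polyToL2 u _).trans ?_
  simp only [eval_C]
  rw [integral_mul_const, hu, zero_mul]

end SimplexWeight

end RealValued

section Uncertainty

open Filter Topology MvPolynomial

variable {d : ℕ} {𝕜 : Type*} [RCLike 𝕜]

lemma bary_none_div_two_le_one_sub_dotProduct_psiInv {x y : Fin d → ℝ} (hx : x ∈ simplexT d)
    (hy : y ∈ simplexT d) : bary none x / 2 ≤ 1 - psiInv x ⬝ᵥ psiInv y := by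
  have hdot : psiInv x ⬝ᵥ psiInv y ≤ ∑ i, (x i + y i) / 2 := by
    refine Finset.sum_le_sum fun i _ => ?_
    have hxi := Real.sq_sqrt (bary_nonneg hx (some i))
    have hyi := Real.sq_sqrt (bary_nonneg hy (some i))
    simp only [bary_some] at hxi hyi
    simp only [psiInv]
    linarith [two_mul_le_add_sq √(x i) √(y i)]
  have hy₀ := bary_nonneg hy none
  rw [← Finset.sum_div, Finset.sum_add_distrib] at hdot
  simp only [bary_none] at hy₀ ⊢
  linarith

lemma sq_div_le_mul_of_forall_le {a b M G : ℝ} (ha : 0 < a) (hb : 0 < b) (hM : 0 ≤ M)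
    (hG : a ≤ G) (h : ∀ s, 0 < s → b ≤ (a + s) * M + s⁻¹ * G) :
    b ^ 2 / (2 * (b + 2)) ≤ M * G := by
  have hG' : 0 < G := ha.trans_le hG
  have hhalf : b / 2 ≤ (b + 2) / b * (M * G) := by
    have hs := h (2 * G / b) (by positivity)
    have hinv : (2 * G / b)⁻¹ * G = b / 2 := by field_simp
    calc b / 2 ≤ (a + 2 * G / b) * M := by linarith
      _ ≤ (G + 2 * G / b) * M := by gcongr
      _ = (b + 2) / b * (M * G) := by field_simp
  calc b ^ 2 / (2 * (b + 2)) = b / (b + 2) * (b / 2) := by field_simp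
    _ ≤ b / (b + 2) * ((b + 2) / b * (M * G)) := by gcongr
    _ = M * G := by field_simp

namespace SimplexWeight

variable (w : SimplexWeight d)

lemma integral_add_mul_I_mul_eval {u v : (Fin d → ℝ) → ℝ} (hu : MemLp u 2 w.measure)
    (hv : MemLp v 2 w.measure) (P : MvPolynomial (Fin d) ℝ) :
    ∫ x, ((u x : 𝕜) + v x * RCLike.I) * ((eval x P : ℝ) : 𝕜) ∂w.measure =
      ((∫ x, u x * eval x P ∂w.measure : ℝ) : 𝕜) +
        ((∫ x, v x * eval x P ∂w.measure : ℝ) : 𝕜) * RCLike.I := by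
  have huP : Integrable (fun x => u x * eval x P) w.measure := hu.integrable_mul (w.memLp_eval P 2)
  have hvP : Integrable (fun x => v x * eval x P) w.measure := hv.integrable_mul (w.memLp_eval P 2)
  rw [← integral_ofReal, ← integral_ofReal, ← integral_mul_const,
    ← integral_add huP.ofReal (hvP.ofReal.mul_const _)]
  congr 1 with x
  simp only [RCLike.ofReal_mul]
  ring

lemma integrable_mul_eval {f : (Fin d → ℝ) → 𝕜} (hf : MemLp f 2 w.measure)
    (P : MvPolynomial (Fin d) ℝ) :
    Integrable (fun x => f x * ((eval x P : ℝ) : 𝕜)) w.measure :=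
  hf.integrable_mul (w.memLp_eval P 2).ofReal

lemma re_integral_mul_eval {f : (Fin d → ℝ) → 𝕜} (hf : MemLp f 2 w.measure)
    (P : MvPolynomial (Fin d) ℝ) :
    RCLike.re (∫ x, f x * ((eval x P : ℝ) : 𝕜) ∂w.measure) =
      ∫ x, RCLike.re (f x) * eval x P ∂w.measure := by
  rw [← integral_re (w.integrable_mul_eval hf P)]
  simp only [RCLike.re_mul_ofReal]

lemma im_integral_mul_eval {f : (Fin d → ℝ) → 𝕜} (hf : MemLp f 2 w.measure)
    (P : MvPolynomial (Fin d) ℝ) :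
    RCLike.im (∫ x, f x * ((eval x P : ℝ) : 𝕜) ∂w.measure) =
      ∫ x, RCLike.im (f x) * eval x P ∂w.measure := by
  rw [← integral_im (w.integrable_mul_eval hf P)]
  simp only [RCLike.im_mul_ofReal]

lemma integral_mul_eval {f : (Fin d → ℝ) → 𝕜} (hf : MemLp f 2 w.measure)
    (P : MvPolynomial (Fin d) ℝ) :
    ∫ x, f x * ((eval x P : ℝ) : 𝕜) ∂w.measure =
      ((∫ x, RCLike.re (f x) * eval x P ∂w.measure : ℝ) : 𝕜) +
        ((∫ x, RCLike.im (f x) * eval x P ∂w.measure : ℝ) : 𝕜) * RCLike.I := by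
  rw [← w.re_integral_mul_eval hf, ← w.im_integral_mul_eval hf, RCLike.re_add_im]

lemma exists_integral_mul_eval_eq {F : (Fin d → ℝ) → ℝ} (hF : ContDiffOn ℝ 1 F (simplexT d)) :
    ∃ g : (Fin d → ℝ) → ℝ, MemLp g 2 w.measure ∧
      ∀ (P : MvPolynomial (Fin d) ℝ) (ν : ℝ), w.eigenFiltration.op P = ν • P →
        ∫ x, g x * eval x P ∂w.measure = √ν * ∫ x, F x * eval x P ∂w.measure := by
  have hF' := w.memLp_of_continuousOn hF.continuousOn 2
  obtain ⟨g, hg⟩ := w.exists_isSqrt_toLp hF hF'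
  refine ⟨g, Lp.memLp g, fun P ν hP => ?_⟩
  rw [← w.inner_polyToL2 g P, ← w.inner_toLp_polyToL2 hF' P]
  exact hg P ν hP

lemma exists_isSqrtNegLaplacian {f : (Fin d → ℝ) → 𝕜} (hf : ContDiffOn ℝ 1 f (simplexT d)) :
    ∃ g : (Fin d → ℝ) → 𝕜, w.IsSqrtNegLaplacian f g := by
  have hfm := w.memLp_of_continuousOn hf.continuousOn 2
  have hre : ContDiffOn ℝ 1 (fun x => RCLike.re (f x)) (simplexT d) :=
    (RCLike.reCLM (K := 𝕜)).contDiff.comp_contDiffOn hf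
  have him : ContDiffOn ℝ 1 (fun x => RCLike.im (f x)) (simplexT d) :=
    (RCLike.imCLM (K := 𝕜)).contDiff.comp_contDiffOn hf
  obtain ⟨u, hu, huP⟩ := w.exists_integral_mul_eval_eq hre
  obtain ⟨v, hv, hvP⟩ := w.exists_integral_mul_eval_eq him
  have hu' : MemLp (fun x => (u x : 𝕜)) 2 w.measure := hu.ofReal
  have hv' : MemLp (fun x => (v x : 𝕜)) 2 w.measure := hv.ofReal
  refine ⟨fun x => (u x : 𝕜) + v x * RCLike.I, hu'.add (hv'.mul_const _), fun P ν hP => ?_⟩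
  have hP' := (w.ae_laplacian_eigen_iff P ν).1 hP
  rw [w.integral_add_mul_I_mul_eval hu hv, w.integral_mul_eval hfm, huP P ν hP', hvP P ν hP']
  push_cast
  ring

lemma integrable_mul_norm_sq {f : (Fin d → ℝ) → 𝕜} (hf : MemLp f 2 w.measure)
    {φ : (Fin d → ℝ) → ℝ} (hφ : Continuous φ) :
    Integrable (fun x => φ x * ‖f x‖ ^ 2) w.measure := by
  obtain ⟨C, hC⟩ := isCompact_simplexT.exists_bound_of_continuousOn (s := simplexT d)
    hφ.continuousOn
  exact ((memLp_two_iff_integrable_sq_norm hf.1).1 hf).bdd_mul (c := C)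
    hφ.aestronglyMeasurable (w.ae_mem_simplexT.mono hC)

lemma integral_mul_norm_sq {f : (Fin d → ℝ) → 𝕜} (hf : MemLp f 2 w.measure)
    {φ : (Fin d → ℝ) → ℝ} (hφ : Continuous φ) :
    ∫ x, φ x * ‖f x‖ ^ 2 ∂w.measure = (∫ x, φ x * hf.re.toLp _ x ^ 2 ∂w.measure) +
      ∫ x, φ x * hf.im.toLp _ x ^ 2 ∂w.measure := by
  have hre := w.integrable_mul_norm_sq (Lp.memLp (hf.re.toLp _)) hφ
  have him := w.integrable_mul_norm_sq (Lp.memLp (hf.im.toLp _)) hφ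
  simp only [Real.norm_eq_abs, sq_abs] at hre him
  rw [← integral_add hre him]
  refine integral_congr_ae ?_
  filter_upwards [hf.re.coeFn_toLp, hf.im.coeFn_toLp] with x hxre hxim
  rw [hxre, hxim, RCLike.norm_sq_eq_def]
  ring

lemma integral_norm_sq {f : (Fin d → ℝ) → 𝕜} (hf : MemLp f 2 w.measure) :
    ∫ x, ‖f x‖ ^ 2 ∂w.measure = ‖hf.re.toLp _‖ ^ 2 + ‖hf.im.toLp _‖ ^ 2 := by
  simpa only [one_mul, norm_sq_eq_integral] using
    w.integral_mul_norm_sq hf (φ := fun _ => 1) continuous_const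

lemma continuous_spread {f : (Fin d → ℝ) → 𝕜} (hf : MemLp f 2 w.measure) :
    Continuous (w.spread f) := by
  have hspread : w.spread f = fun y => (∫ x, ‖f x‖ ^ 2 ∂w.measure) -
      ∑ i, √(y i) * ∫ x, √(x i) * ‖f x‖ ^ 2 ∂w.measure := by
    funext y
    have hint : ∀ i ∈ Finset.univ,
        Integrable (fun x => √(y i) * (√(x i) * ‖f x‖ ^ 2)) w.measure := fun i _ =>
      (w.integrable_mul_norm_sq hf (φ := fun x => √(x i)) (by fun_prop)).const_mul _
    simp only [← integral_const_mul]
    rw [spread, ← integral_finsetSum _ hint,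
      ← integral_sub ((memLp_two_iff_integrable_sq_norm hf.1).1 hf) (integrable_finsetSum _ hint)]
    congr 1 with x
    simp only [dotProduct, psiInv, sub_mul, one_mul, Finset.sum_mul]
    congr 1
    exact Finset.sum_congr rfl fun i _ => by ring
  rw [hspread]
  fun_prop

lemma exists_isLeast_spread {f : (Fin d → ℝ) → 𝕜} (hf : MemLp f 2 w.measure) :
    ∃ m, IsLeast (w.spread f '' simplexT d) m :=
  (isCompact_simplexT.image (w.continuous_spread hf)).exists_isLeast
    ((openSimplex_nonempty.mono openSimplex_subset).image _)

lemma integral_bary_mul_norm_sq_div_two_le_spread {f : (Fin d → ℝ) → 𝕜}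
    (hf : MemLp f 2 w.measure) {y : Fin d → ℝ} (hy : y ∈ simplexT d) :
    (∫ x, bary none x * ‖f x‖ ^ 2 ∂w.measure) / 2 ≤ w.spread f y := by
  have hcont : Continuous fun x => 1 - psiInv x ⬝ᵥ psiInv y := by
    unfold dotProduct psiInv
    fun_prop
  rw [spread, ← integral_div]
  refine integral_mono_ae ((w.integrable_mul_norm_sq hf (continuous_bary none)).div_const 2)
    (w.integrable_mul_norm_sq hf hcont) ?_
  filter_upwards [w.ae_mem_simplexT] with x hx
  rw [mul_div_right_comm]
  gcongr
  exact bary_none_div_two_le_one_sub_dotProduct_psiInv hx hy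

namespace IsSqrtNegLaplacian

variable {w} {f g : (Fin d → ℝ) → 𝕜}

lemma isSqrt_re (h : w.IsSqrtNegLaplacian f g) (hf : MemLp f 2 w.measure) :
    w.eigenFiltration.IsSqrt (hf.re.toLp _) (h.1.re.toLp _) := by
  intro P ν hP
  have hre := congrArg RCLike.re (h.2 P ν ((w.ae_laplacian_eigen_iff P ν).2 hP))
  rw [RCLike.re_ofReal_mul, w.re_integral_mul_eval hf, w.re_integral_mul_eval h.1] at hre
  exact (w.inner_toLp_polyToL2 h.1.re P).trans
    (hre.trans (congrArg _ (w.inner_toLp_polyToL2 hf.re P).symm))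

lemma isSqrt_im (h : w.IsSqrtNegLaplacian f g) (hf : MemLp f 2 w.measure) :
    w.eigenFiltration.IsSqrt (hf.im.toLp _) (h.1.im.toLp _) := by
  intro P ν hP
  have him := congrArg RCLike.im (h.2 P ν ((w.ae_laplacian_eigen_iff P ν).2 hP))
  rw [RCLike.im_ofReal_mul, w.im_integral_mul_eval hf, w.im_integral_mul_eval h.1] at him
  exact (w.inner_toLp_polyToL2 h.1.im P).trans
    (him.trans (congrArg _ (w.inner_toLp_polyToL2 hf.im P).symm))

lemma lam_mul_integral_norm_sq_le (h : w.IsSqrtNegLaplacian f g) (hf : MemLp f 2 w.measure)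
    (hf₀ : ∫ x, f x ∂w.measure = 0) :
    (w.lam + 1) * ∫ x, ‖f x‖ ^ 2 ∂w.measure ≤ ∫ x, ‖g x‖ ^ 2 ∂w.measure := by
  have hint : Integrable f w.measure := hf.integrable one_le_two
  have hre := w.spectral_gap (h.isSqrt_re hf) <| by
    rw [integral_congr_ae hf.re.coeFn_toLp, integral_re hint, hf₀, map_zero]
  have him := w.spectral_gap (h.isSqrt_im hf) <| by
    rw [integral_congr_ae hf.im.coeFn_toLp, integral_im hint, hf₀, map_zero]
  rw [w.integral_norm_sq hf, w.integral_norm_sq h.1]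
  linarith

lemma expo_mul_integral_norm_sq_le (h : w.IsSqrtNegLaplacian f g) (hf : MemLp f 2 w.measure)
    {s : ℝ} (hs : 0 < s) : w.expo none * ∫ x, ‖f x‖ ^ 2 ∂w.measure ≤
      (w.lam + 1 + s) * ∫ x, bary none x * ‖f x‖ ^ 2 ∂w.measure +
        s⁻¹ * ∫ x, ‖g x‖ ^ 2 ∂w.measure := by
  have hre := w.radial_inequality_of_isSqrt (h.isSqrt_re hf) hs
  have him := w.radial_inequality_of_isSqrt (h.isSqrt_im hf) hs
  rw [w.integral_norm_sq hf, w.integral_norm_sq h.1,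
    w.integral_mul_norm_sq hf (continuous_bary none)]
  linarith

theorem uncertainty (h : w.IsSqrtNegLaplacian f g) (hf : MemLp f 2 w.measure)
    (hf₀ : ∫ x, f x ∂w.measure = 0) (hf₁ : ∫ x, ‖f x‖ ^ 2 ∂w.measure = 1) :
    w.expo none ^ 2 / (2 * (w.expo none + 2)) ≤
      (∫ x, bary none x * ‖f x‖ ^ 2 ∂w.measure) * ∫ x, ‖g x‖ ^ 2 ∂w.measure := by
  refine sq_div_le_mul_of_forall_le w.lam_add_one_pos (w.expo_pos none) ?_ ?_ fun s hs => ?_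
  · exact integral_nonneg_of_ae (w.ae_mem_simplexT.mono fun x hx =>
      mul_nonneg (bary_nonneg hx none) (sq_nonneg _))
  · simpa only [hf₁, mul_one] using h.lam_mul_integral_norm_sq_le hf hf₀
  · simpa only [hf₁, mul_one] using h.expo_mul_integral_norm_sq_le hf hs

end IsSqrtNegLaplacian

end SimplexWeight

end Uncertainty

theorem mainTheorem4 {𝕜 : Type*} [RCLike 𝕜] (d : ℕ) (w : SimplexWeight d) :
    ∃ C : ℝ, 0 < C ∧
      ∀ f : (Fin d → ℝ) → 𝕜, ContDiffOn ℝ 1 f (simplexT d) →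
        ∫ x, f x ∂w.measure = 0 →
        ∫ x, ‖f x‖ ^ 2 ∂w.measure = 1 →
        ∃ m : ℝ, IsLeast (w.spread f '' simplexT d) m ∧
          (∃ g : (Fin d → ℝ) → 𝕜, w.IsSqrtNegLaplacian f g) ∧
          ∀ g : (Fin d → ℝ) → 𝕜, w.IsSqrtNegLaplacian f g →
            C ≤ m * ∫ x, ‖g x‖ ^ 2 ∂w.measure := by
  have hb := w.expo_pos none
  refine ⟨w.expo none ^ 2 / (2 * (w.expo none + 2)) / 2, by positivity, fun f hf hf₀ hf₁ => ?_⟩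
  have hfm := w.memLp_of_continuousOn hf.continuousOn 2
  obtain ⟨m, hm⟩ := w.exists_isLeast_spread hfm
  refine ⟨m, hm, w.exists_isSqrtNegLaplacian hf, fun g hg => ?_⟩
  obtain ⟨y, hy, rfl⟩ := hm.1
  calc w.expo none ^ 2 / (2 * (w.expo none + 2)) / 2
      ≤ (∫ x, bary none x * ‖f x‖ ^ 2 ∂w.measure) * (∫ x, ‖g x‖ ^ 2 ∂w.measure) / 2 := by
        gcongr
        exact hg.uncertainty hfm hf₀ hf₁
    _ = (∫ x, bary none x * ‖f x‖ ^ 2 ∂w.measure) / 2 * ∫ x, ‖g x‖ ^ 2 ∂w.measure := by ring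
    _ ≤ w.spread f y * ∫ x, ‖g x‖ ^ 2 ∂w.measure := by
        gcongr
        exact w.integral_bary_mul_norm_sq_div_two_le_spread hfm hy
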